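/- **Setting.** Let $d\ge 2$. Let $\Omega$ be a translation-invariant family of subsets $\omega\subset\mathbb R^d$ for which there are finitely many triples $(P_1^j,P_2^j,P_3^j)$, $j=1,\dots,N$, of Lipschitz domains with $\overline{P_1^j}\subset P_2^j$, $\overline{P_2^j}\subset P_3^j$ and $P_2^j\setminus\overline{P_1^j}$ Lipschitz, and constants $c,C,\tilde C>0$, such that every $\omega\in\Omega$ has the following properties. * $\mathbb R^d\setminus\omega$ is connected, and $\omega=\bigsqcup_{k\in\mathbb N}\omega^k$ with open connected nonempty $\omega^k$ of diameter $<\tfrac12$. * There are bounded open sets $\mathcal B^k_\omega$ with $\omega\cap\mathcal B^k_\omega=\omega^k$, $\mathcal B^k_\omega\setminus\overline{\omega^k}$ Lipschitz, and $\mathcal B^k_\omega-D^k-(\tfrac14,\dots,\tfrac14)\subset[-\tfrac12,\tfrac12]^d$, where $D^k_j=\inf_{x\in\omega^k}x_j$. * For every $k$ there are $j$, a Lipschitz open set $\widetilde{\mathcal B}\supset\mathcal B^k_\omega$ and a $C^2$ diffeomorphism $\varphi:P_3^j\to\widetilde{\mathcal B}$ with $\varphi(P_3^j\setminus P_2^j)=\widetilde{\mathcal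 B}\setminus\mathcal B^k_\omega$, $\varphi(P_2^j\setminus P_1^j)=\mathcal B^k_\omega\setminus\omega^k$, $\varphi(P_1^j)=\omega^k$, $c|x-y|\le|\varphi(x)-\varphi(y)|\le C|x-y|$, and first and second derivatives bounded by $\tilde C$. Equip $\Omega$ with the $\sigma$-algebra generated by the maps $\omega\mapsto\mathbb 1_\omega(q)$, $q\in\mathbb Q^d$, and with a probability measure $P$ that is invariant and ergodic under the translations $T_y\omega=\{z-y: z\in\omega\}$; $\mathbb E$ is the expectation. All function spaces are real. A random field $\overline f$ on $\Omega$ has the stationary extension $f(y,\omega)=\overline f(T_y\omega)$. Let $\mathsf C_0,\mathsf C_1$ be constant fourth-order tensors with $\mathsf C_{\alpha\beta\mu\nu}=\mathsf C_{\mu\nu\alpha\beta}=\mathsf C_{\alpha\beta\nu\mu}$ that are positive definite on symmetric matrices; write $\mathsf C\xi\cdot\eta=\mathsf C_{\alpha\beta\mu\nu}\xi_{\mu\nu}\eta_{\alpha\beta}$ and $(\nabla u)_{\mu\nu}=\partial_\mu u_\nu$. * $\mathbf L^2_0(\Omega)$ is the space of $\overline f\in L^2(\Omega;\mathbb R^d)$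 with $f(\cdot,\omega)=0$ outside $\omega$, and $\mathbf H^1_0(\Omega)$ is the space of those $\overline f\in\mathbf L^2_0(\Omega)$ whose stationary extension has a weak gradient $\nabla_y f$ that is the stationary extension of a field in $L^2(\Omega)$. * $\mathsf C^{\rm hom}$ is the tensor with $\mathsf C^{\rm hom}_{\alpha\beta\mu\nu}=\mathsf C^{\rm hom}_{\mu\nu\alpha\beta}$ and $\mathsf C^{\rm hom}\xi\cdot\xi=\inf_\psi\mathbb E[\mathbb 1_{\{0\notin\omega\}}\mathsf C_1(\overline\psi+\xi)\cdot(\overline\psi+\xi)]$ for all $\xi\in\mathbb R^{d\times d}$, the infimum being over all $\overline\psi\in L^2(\Omega;\mathbb R^{d\times d})$ with $\mathbb E[\overline\psi]=0$ whose stationary extension is almost surely the gradient of a field in $H^1_{\rm loc}(\mathbb R^d;\mathbb R^d)$. * $\mathcal A_0$ is the self-adjoint operator in $\mathbf L^2_0(\Omega)$ associated with the form $\mathbb E[\mathsf C_0\nabla_y u\cdot\nabla_y\varphi]$ on $\mathbf H^1_0(\Omega)$. * $\mathcal A^{\rm hom}$ is the self-adjoint operator in $\mathbf H=L^2(\mathbb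 R^d;\mathbb R^d)+L^2(\mathbb R^d;\mathbf L^2_0(\Omega))\subset L^2(\mathbb R^d\times\Omega;\mathbb R^d)$ associated with the form $$\int_{\mathbb R^d}\mathsf C^{\rm hom}\nabla u_1\cdot\nabla\varphi_1\,dx+\int_{\mathbb R^d}\mathbb E[\mathsf C_0\nabla_y u_0\cdot\nabla_y\varphi_0]\,dx,\qquad u_1+\overline{u_0},\ \varphi_1+\overline{\varphi_0}\in H^1(\mathbb R^d;\mathbb R^d)+L^2(\mathbb R^d;\mathbf H^1_0(\Omega)).$$ The spectrum $\sigma$ of such an operator $\mathcal A$ is the set of $\lambda\in\mathbb R$ for which $\mathcal A-\lambda$ does not have an everywhere defined bounded inverse. **Theorem 4.7.** For every $\lambda\in[0,\infty)\setminus\sigma(\mathcal A_0)$ and $i=1,\dots,d$ there is a unique $\overline{b_\lambda^{(i)}}\in\mathbf H^1_0(\Omega)$ with $\mathcal A_0\overline{b_\lambda^{(i)}}=\lambda\overline{b_\lambda^{(i)}}+e_i$, in the weak sense, that is, $\mathbb E[\mathsf C_0\nabla_y b_\lambda^{(i)}\cdot\nabla_y v]=\mathbb E[\lambda\,\overline{b_\lambda^{(i)}}\cdot\overline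 v+\overline v_i]$ for all $\overline v\in\mathbf H^1_0(\Omega)$. Let $\overline{b_\lambda}$ be the matrix with the columns $\overline{b_\lambda^{(i)}}$. The Zhikov $\boldsymbol\beta$-matrix $\boldsymbol\beta(\lambda)=\mathbb E[\lambda I+\lambda^2\overline{b_\lambda}]$ is symmetric, and its largest eigenvalue is $\beta(\lambda)=\max_{|k|=1}k\cdot\boldsymbol\beta(\lambda)k$. Moreover, $$\sigma(\mathcal A^{\rm hom})=\sigma(\mathcal A_0)\cup\overline{\{\lambda\in[0,\infty)\setminus\sigma(\mathcal A_0):\ \boldsymbol\beta(\lambda)\text{ is not negative definite}\}},$$ and equivalently $$\sigma(\mathcal A^{\rm hom})=\sigma(\mathcal A_0)\cup\{\lambda\in[0,\infty)\setminus\sigma(\mathcal A_0):\ \beta(\lambda)\ge0\}.$$ -/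

import Mathlib

open MeasureTheory
open scoped RealInnerProductSpace

namespace HighContrast

noncomputable section

/-! ## Euclidean space, matrices and fourth-order tensors -/

/-- `ℝ^d` with its Euclidean structure. -/
abbrev E (d : ℕ) : Type := EuclideanSpace ℝ (Fin d)

/-- Real `d × d` matrices with the Frobenius inner product; the entry `(μ, ν)` of the gradient of a
vector field `u` is `∂_μ u_ν`. -/
abbrev M (d : ℕ) : Type := EuclideanSpace ℝ (Fin d × Fin d)

/-- The standard basis vector `e_i`. -/
abbrev e {d : ℕ} (i : Fin d) : E d := EuclideanSpace.single i 1

/-- Fourth-order tensors `C_{αβμν}`. -/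
abbrev Tensor (d : ℕ) : Type := Fin d → Fin d → Fin d → Fin d → ℝ

/-- The contraction `C ξ · η = C_{αβμν} ξ_{μν} η_{αβ}`. -/
def Tensor.contract {d : ℕ} (C : Tensor d) (ξ η : M d) : ℝ :=
  ∑ α, ∑ β, ∑ μ, ∑ ν, C α β μ ν * ξ (μ, ν) * η (α, β)

/-- The symmetry and ellipticity conditions on a tensor of elastic coefficients. -/
structure Tensor.IsElastic {d : ℕ} (C : Tensor d) : Prop where
  major_symm : ∀ α β μ ν, C α β μ ν = C μ ν α β
  minor_symm : ∀ α β μ ν, C α β μ ν = C α β ν μ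
  elliptic : ∃ c : ℝ, 0 < c ∧
    ∀ ξ : M d, (∀ α β, ξ (α, β) = ξ (β, α)) → c * ‖ξ‖ ^ 2 ≤ C.contract ξ ξ

/-! ## Geometry of the inclusions -/

/-- An open set with Lipschitz boundary: near each boundary point and up to a rotation, it is the
region below the graph of a Lipschitz function. -/
def IsLipschitzOpen {d : ℕ} (U : Set (E d)) : Prop :=
  IsOpen U ∧ ∀ x ∈ frontier U, ∃ (n : E d) (γ : E d → ℝ) (K : NNReal) (r : ℝ),
    ‖n‖ = 1 ∧ LipschitzWith K γ ∧ 0 < r ∧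
      ∀ y ∈ Metric.ball x r, (y ∈ U ↔ ⟪n, y⟫ < γ (y - ⟪n, y⟫ • n))

/-- Finitely many triples of Lipschitz domains (model shapes of an inclusion inside an
extension domain inside a neighbourhood), with universal constants. -/
structure ModelShapes (d : ℕ) where
  N : ℕ
  P₁ : Fin N → Set (E d)
  P₂ : Fin N → Set (E d)
  P₃ : Fin N → Set (E d)
  lipschitz₁ : ∀ j, IsLipschitzOpen (P₁ j) ∧ IsConnected (P₁ j)
  lipschitz₂ : ∀ j, IsLipschitzOpen (P₂ j) ∧ IsConnected (P₂ j)
  lipschitz₃ : ∀ j, IsLipschitzOpen (P₃ j) ∧ IsConnected (P₃ j)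
  closure_subset₁ : ∀ j, closure (P₁ j) ⊆ P₂ j
  closure_subset₂ : ∀ j, closure (P₂ j) ⊆ P₃ j
  lipschitz_shell : ∀ j, IsLipschitzOpen (P₂ j \ closure (P₁ j))
  /-- lower and upper bi-Lipschitz constants, and the bound on derivatives -/
  c : ℝ
  C : ℝ
  C' : ℝ
  c_pos : 0 < c
  C_pos : 0 < C
  C'_pos : 0 < C'

/-- The corner `D` of a set: `D_j = inf_{x ∈ A} x_j`. -/
def corner {d : ℕ} (A : Set (E d)) : E d :=
  WithLp.toLp 2 fun j => sInf ((fun x : E d => x j) '' A)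

/-- `B` and its subset `A` are the image of the `j`-th model shape under a `C²` diffeomorphism with
controlled bi-Lipschitz constants and controlled first and second derivatives. -/
def IsModelled {d : ℕ} (S : ModelShapes d) (A B : Set (E d)) : Prop :=
  ∃ (j : Fin S.N) (B' : Set (E d)) (φ ψ : E d → E d),
    IsLipschitzOpen B' ∧ B ⊆ B' ∧
    ContDiffOn ℝ 2 φ (S.P₃ j) ∧ ContDiffOn ℝ 2 ψ B' ∧
    φ '' S.P₃ j = B' ∧ Set.InvOn ψ φ (S.P₃ j) B' ∧
    φ '' (S.P₃ j \ S.P₂ j) = B' \ B ∧ φ '' (S.P₂ j \ S.P₁ j) = B \ A ∧ φ '' S.P₁ j = A ∧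
    (∀ x ∈ S.P₃ j, ∀ y ∈ S.P₃ j,
      S.c * ‖x - y‖ ≤ ‖φ x - φ y‖ ∧ ‖φ x - φ y‖ ≤ S.C * ‖x - y‖) ∧
    (∀ x ∈ S.P₃ j, ‖iteratedFDeriv ℝ 1 φ x‖ ≤ S.C' ∧ ‖iteratedFDeriv ℝ 2 φ x‖ ≤ S.C')

/-- The geometric assumptions on one collection `ω` of inclusions: `ω` is the disjoint union of the
inclusions `inc k`, with extension domains `nbhd k`. -/
structure IsInclusionSystem {d : ℕ} (S : ModelShapes d) (ω : Set (E d))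
    (inc nbhd : ℕ → Set (E d)) : Prop where
  connected_compl : IsConnected ωᶜ
  union : ω = ⋃ k, inc k
  disjoint : Pairwise fun k l => Disjoint (inc k) (inc l)
  isOpen_inc : ∀ k, IsOpen (inc k)
  connected_inc : ∀ k, IsConnected (inc k)
  isOpen_nbhd : ∀ k, IsOpen (nbhd k)
  bounded_nbhd : ∀ k, Bornology.IsBounded (nbhd k)
  inter_nbhd : ∀ k, ω ∩ nbhd k = inc k
  lipschitz_shell : ∀ k, IsLipschitzOpen (nbhd k \ closure (inc k))
  diam_inc : ∀ k, Metric.diam (inc k) < 1 / 2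
  nbhd_subset_cube : ∀ k, ∀ x ∈ nbhd k, ∀ j,
    x j - corner (inc k) j - 1 / 4 ∈ Set.Icc (-1 / 2 : ℝ) (1 / 2)
  modelled : ∀ k, IsModelled S (inc k) (nbhd k)

/-! ## The probability space -/

/-- A family of subsets of `ℝ^d` that is closed under translations. -/
structure ConfigFamily (d : ℕ) where
  sets : Set (Set (E d))
  shift_mem : ∀ ω ∈ sets, ∀ y : E d, (fun z => z - y) '' ω ∈ sets

/-- The sample space `Ω`: its points `ω` are the members of the family. -/
def Config {d : ℕ} (𝒪 : ConfigFamily d) : Type := {ω : Set (E d) // ω ∈ 𝒪.sets}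

/-- All members of the family satisfy the geometric assumptions, with the same model shapes and
constants. -/
def ConfigFamily.IsAdmissible {d : ℕ} (𝒪 : ConfigFamily d) : Prop :=
  ∃ S : ModelShapes d, ∀ ω ∈ 𝒪.sets, ∃ inc nbhd : ℕ → Set (E d), IsInclusionSystem S ω inc nbhd

variable {d : ℕ} {𝒪 : ConfigFamily d}

/-- The set of inclusions of a point of the sample space. -/
def Config.set (ω : Config 𝒪) : Set (E d) := ω.1

/-- The σ-algebra generated by the maps `ω ↦ 1_ω(q)`, `q ∈ ℚ^d`. -/
instance : MeasurableSpace (Config 𝒪) :=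
  MeasurableSpace.generateFrom
    {F | ∃ q : Fin d → ℚ, F = {ω | WithLp.toLp 2 (fun i => (q i : ℝ)) ∈ ω.set}}

/-- The translation `T_y ω = {z - y | z ∈ ω}`. -/
def T (y : E d) (ω : Config 𝒪) : Config 𝒪 :=
  ⟨(fun z => z - y) '' ω.1, 𝒪.shift_mem ω.1 ω.2 y⟩

/-- The event that the origin lies in an inclusion. -/
def originIn (𝒪 : ConfigFamily d) : Set (Config 𝒪) := {ω | (0 : E d) ∈ ω.set}

/-- Invariance and ergodicity of `P` under translations. -/
structure IsStationaryErgodic (P : Measure (Config 𝒪)) : Prop where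
  invariant : ∀ (y : E d) (F : Set (Config 𝒪)), MeasurableSet F → P (T y '' F) = P F
  ergodic : ∀ F : Set (Config 𝒪), MeasurableSet F →
    (∀ y : E d, P (symmDiff (T y '' F) F) = 0) → P F = 0 ∨ P F = 1

/-! ## Sobolev spaces -/

/-- `G` is the weak gradient of `u` on `ℝ^d`: `G_{μν} = ∂_μ u_ν`. -/
def HasWeakGrad (u : E d → E d) (G : E d → M d) : Prop :=
  LocallyIntegrable u ∧ LocallyIntegrable G ∧
    ∀ φ : E d → ℝ, ContDiff ℝ (⊤ : ℕ∞) φ → HasCompactSupport φ → ∀ μ ν : Fin d,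
      ∫ y, u y ν * fderiv ℝ φ y (e μ) = -∫ y, G y (μ, ν) * φ y

/-- Local square integrability on `ℝ^d`. -/
def IsL2Loc {F : Type*} [NormedAddCommGroup F] (f : E d → F) : Prop :=
  ∀ K : Set (E d), IsCompact K → MemLp f 2 (volume.restrict K)

/-- `G` is the stochastic gradient of the random variable `u`: almost surely, the stationary
extension `y ↦ G (T_y ω)` is the weak gradient of the stationary extension `y ↦ u (T_y ω)`. -/
def HasStochGrad (P : Measure (Config 𝒪)) (u : Config 𝒪 → E d) (G : Config 𝒪 → M d) : Prop :=
  ∀ᵐ ω ∂P, HasWeakGrad (fun y => u (T y ω)) (fun y => G (T y ω))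

/-- The space `L²_0(Ω)` of square integrable random vectors whose stationary extension vanishes
outside the inclusions. As `y ∉ ω` if and only if `0 ∉ T_y ω`, this means that the random vector
itself vanishes where the origin is outside the inclusions. -/
def L2zero (P : Measure (Config 𝒪)) : Submodule ℝ (Lp (E d) 2 P) where
  carrier := {f | ∀ᵐ ω ∂P, ω ∉ originIn 𝒪 → f ω = 0}
  add_mem' := by
    intro f g hf hg
    filter_upwards [hf, hg, Lp.coeFn_add f g] with ω h1 h2 h3 h
    rw [h3, Pi.add_apply, h1 h, h2 h, add_zero]
  zero_mem' := by
    filter_upwards [Lp.coeFn_zero (E d) 2 P] with ω h _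
    rw [h, Pi.zero_apply]
  smul_mem' := by
    intro c f hf
    filter_upwards [hf, Lp.coeFn_smul c f] with ω h1 h2 h
    rw [h2, Pi.smul_apply, h1 h, smul_zero]

/-- The space `L²(ℝ^d; L²_0(Ω))`, as a subspace of `L²(ℝ^d × Ω)`. -/
def L2prodZero (P : Measure (Config 𝒪)) :
    Submodule ℝ (Lp (E d) 2 ((volume : Measure (E d)).prod P)) where
  carrier := {f | ∀ᵐ p ∂((volume : Measure (E d)).prod P), p.2 ∉ originIn 𝒪 → f p = 0}
  add_mem' := by
    intro f g hf hg
    filter_upwards [hf, hg, Lp.coeFn_add f g] with ω h1 h2 h3 h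
    rw [h3, Pi.add_apply, h1 h, h2 h, add_zero]
  zero_mem' := by
    filter_upwards [Lp.coeFn_zero (E d) 2 ((volume : Measure (E d)).prod P)] with ω h _
    rw [h, Pi.zero_apply]
  smul_mem' := by
    intro c f hf
    filter_upwards [hf, Lp.coeFn_smul c f] with ω h1 h2 h
    rw [h2, Pi.smul_apply, h1 h, smul_zero]

/-- The natural embedding of `L²(ℝ^d)` into `L²(ℝ^d × Ω)`. -/
def embed (P : Measure (Config 𝒪)) [IsProbabilityMeasure P] :
    Lp (E d) 2 (volume : Measure (E d)) →ₗ[ℝ] Lp (E d) 2 ((volume : Measure (E d)).prod P) :=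
  Lp.compMeasurePreservingₗ ℝ Prod.fst measurePreserving_fst

/-- The two-scale space `H = L²(ℝ^d) + L²(ℝ^d; L²_0(Ω))`. -/
def twoScaleSpace (P : Measure (Config 𝒪)) [IsProbabilityMeasure P] :
    Submodule ℝ (Lp (E d) 2 ((volume : Measure (E d)).prod P)) :=
  LinearMap.range (embed P) ⊔ L2prodZero P

/-- `H¹(ℝ^d)`, as the set of pairs (field, weak gradient). -/
def H1 (d : ℕ) : Set (Lp (E d) 2 (volume : Measure (E d)) × Lp (M d) 2 (volume : Measure (E d))) :=
  {p | HasWeakGrad p.1 p.2}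

/-- `H¹_0(Ω)`, as the set of pairs (random vector, stochastic gradient). -/
def H1zero (P : Measure (Config 𝒪)) : Set (Lp (E d) 2 P × Lp (M d) 2 P) :=
  {p | p.1 ∈ L2zero P ∧ HasStochGrad P p.1 p.2}

/-- `L²(ℝ^d; H¹_0(Ω))`, as the set of pairs (field on `ℝ^d × Ω`, its stochastic gradient). -/
def L2H1zero (P : Measure (Config 𝒪)) :
    Set (Lp (E d) 2 ((volume : Measure (E d)).prod P) ×
      Lp (M d) 2 ((volume : Measure (E d)).prod P)) :=
  {p | p.1 ∈ L2prodZero P ∧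
    ∀ᵐ x : E d, HasStochGrad P (fun ω => p.1 (x, ω)) (fun ω => p.2 (x, ω))}

/-! ## The homogenised tensor -/

/-- Potential matrix fields on `Ω` with zero mean. -/
def Vpot (P : Measure (Config 𝒪)) : Set (Lp (M d) 2 P) :=
  {ψ | (∀ᵐ ω ∂P, IsL2Loc (fun y => ψ (T y ω)) ∧
      ∃ φ : E d → E d, IsL2Loc φ ∧ HasWeakGrad φ (fun y => ψ (T y ω))) ∧
    ∫ ω, ψ ω ∂P = 0}

/-- The quadratic form
`ξ ↦ inf {E[(1 - 1_Ω) C₁ (ψ + ξ) · (ψ + ξ)] | ψ potential with zero mean}`. -/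
def homForm (P : Measure (Config 𝒪)) (C₁ : Tensor d) (ξ : M d) : ℝ :=
  ⨅ ψ : Vpot P, ∫ ω, (1 - (originIn 𝒪).indicator 1 ω) *
    C₁.contract ((ψ : Lp (M d) 2 P) ω + ξ) ((ψ : Lp (M d) 2 P) ω + ξ) ∂P

/-- The homogenised tensor: the tensor with `C_{αβμν} = C_{μναβ}` whose quadratic form is
`homForm`, obtained by polarisation. -/
def Chom (P : Measure (Config 𝒪)) (C₁ : Tensor d) : Tensor d := fun α β μ ν =>
  (homForm P C₁ (EuclideanSpace.single (α, β) 1 + EuclideanSpace.single (μ, ν) 1) -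
    homForm P C₁ (EuclideanSpace.single (α, β) 1 - EuclideanSpace.single (μ, ν) 1)) / 4

/-! ## Operators associated with bilinear forms, and their spectra -/

/-- The graph of the operator in the Hilbert space `H ⊆ X` associated with the bilinear form `a`.
The form domain is given by a set `V` of parameters and a map `ι` from parameters to vectors:
`A x = w` if and only if `x = ι u` for some `u ∈ V` with `a(u, v) = ⟪w, ι v⟫` for all `v ∈ V`. -/
def formOperator {X W : Type*} [NormedAddCommGroup X] [InnerProductSpace ℝ X]
    (H : Submodule ℝ X) (V : Set W) (ι : W → X) (a : W → W → ℝ) : Set (H × H) :=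
  {p | ∃ u ∈ V, (p.1 : X) = ι u ∧ ∀ v ∈ V, a u v = ⟪(p.2 : X), ι v⟫}

/-- The resolvent set of an operator given by its graph: the real `l` for which `A - l` has a
bounded inverse `R` defined on the whole space. -/
def resolventSet {X : Type*} [NormedAddCommGroup X] [NormedSpace ℝ X] (A : Set (X × X)) : Set ℝ :=
  {l | ∃ R : X →L[ℝ] X, ∀ x f : X, (x, f + l • x) ∈ A ↔ x = R f}

/-- The spectrum (of a self-adjoint operator, so that it consists of real numbers). -/
def spec {X : Type*} [NormedAddCommGroup X] [NormedSpace ℝ X] (A : Set (X × X)) : Set ℝ :=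
  (resolventSet A)ᶜ

/-- The form `E[C₀ ∇u · ∇φ]` on `H¹_0(Ω)`. -/
def microForm (P : Measure (Config 𝒪)) (C₀ : Tensor d) (p q : Lp (E d) 2 P × Lp (M d) 2 P) : ℝ :=
  ∫ ω, C₀.contract (p.2 ω) (q.2 ω) ∂P

/-- The microscopic operator `A₀` in `L²_0(Ω)`. -/
def A0 (P : Measure (Config 𝒪)) (C₀ : Tensor d) : Set (L2zero P × L2zero P) :=
  formOperator (L2zero P) (H1zero P) Prod.fst (microForm P C₀)

/-- The ambient space of the form domain of the two-scale operator: `((u₁, ∇u₁), (u₀, ∇_y u₀))`. -/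
abbrev TwoScalePairs (P : Measure (Config 𝒪)) : Type :=
  (Lp (E d) 2 (volume : Measure (E d)) × Lp (M d) 2 (volume : Measure (E d))) ×
    (Lp (E d) 2 ((volume : Measure (E d)).prod P) × Lp (M d) 2 ((volume : Measure (E d)).prod P))

/-- The form `∫ C^hom ∇u₁ · ∇φ₁ + ∫ E[C₀ ∇_y u₀ · ∇_y φ₀]`. -/
def twoScaleForm (P : Measure (Config 𝒪)) (C₀ C₁ : Tensor d) (p q : TwoScalePairs P) : ℝ :=
  (∫ x, (Chom P C₁).contract (p.1.2 x) (q.1.2 x)) +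
    ∫ z, C₀.contract (p.2.2 z) (q.2.2 z) ∂((volume : Measure (E d)).prod P)

/-- The two-scale limit operator `A^hom` in `H`, with form domain
`V = H¹(ℝ^d) + L²(ℝ^d; H¹_0(Ω))`. -/
def Ahom (P : Measure (Config 𝒪)) [IsProbabilityMeasure P] (C₀ C₁ : Tensor d) :
    Set (twoScaleSpace P × twoScaleSpace P) :=
  formOperator (twoScaleSpace P) (H1 d ×ˢ L2H1zero P) (fun p => embed P p.1.1 + p.2.1)
    (twoScaleForm P C₀ C₁)

/-! ## The Zhikov matrix -/

/-- `b ∈ H¹_0(Ω)` is a (weak) solution of `A₀ b = l b + e_i`. -/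
def IsCellSolution (P : Measure (Config 𝒪)) (C₀ : Tensor d) (l : ℝ) (i : Fin d)
    (b : Lp (E d) 2 P) : Prop :=
  ∃ G : Lp (M d) 2 P, (b, G) ∈ H1zero P ∧
    ∀ q ∈ H1zero P, microForm P C₀ (b, G) q = ∫ ω, (l * ⟪b ω, q.1 ω⟫ + ⟪e i, q.1 ω⟫) ∂P

open Classical in
/-- The solution `b_l^{(i)}` of `A₀ b = l b + e_i` (for `l` outside the spectrum of `A₀`). -/
def cell (P : Measure (Config 𝒪)) (C₀ : Tensor d) (l : ℝ) (i : Fin d) : Lp (E d) 2 P :=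
  if h : ∃ b, IsCellSolution P C₀ l i b then h.choose else 0

/-- The Zhikov matrix `E[l I + l² b_l]`, where `b_l` has the columns `b_l^{(j)}`. -/
def zhikov (P : Measure (Config 𝒪)) (C₀ : Tensor d) (l : ℝ) : Matrix (Fin d) (Fin d) ℝ :=
  fun i j => ∫ ω, (l * (1 : Matrix (Fin d) (Fin d) ℝ) i j + l ^ 2 * cell P C₀ l j ω i) ∂P

/-- The maximum of `k · β(l) k` over unit vectors `k`, where `β(l)` is the Zhikov matrix. -/
def zhikovMax (P : Measure (Config 𝒪)) (C₀ : Tensor d) (l : ℝ) : ℝ :=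
  ⨆ k : Metric.sphere (0 : E d) 1, ∑ i, ∑ j, (k : E d) i * zhikov P C₀ l i j * (k : E d) j

/-- The domain `[0, ∞) \ σ(A₀)` of the Zhikov matrix. -/
def zhikovDomain (P : Measure (Config 𝒪)) (C₀ : Tensor d) : Set ℝ :=
  Set.Ici 0 \ spec (A0 P C₀)

end

end HighContrast

open HighContrast

set_option linter.unusedSectionVars false

/-! Write θ for the probability that the origin lies outside the inclusions and fix λ outside σ(A₀).
In (A^hom − λ)(u₁ + u₀) = g the microscopic part can be eliminated fibre by fibre: if Z is the
resolvent of A₀ at λ, preceded by the orthogonal projection onto L²_0(Ω), then u₀(x) = Z(g(x) +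
λu₁(x)). What is left for u₁ is a system with constant coefficients, formally −div C^hom∇u₁ − β(λ)u₁
= (data), since β(λ) is the matrix of c ↦ λc + λ²E[Zc] (`sum_zhikov`). At the wave vector k its
symbol is the acoustic tensor A(k)_{βν} = C^hom_{αβμν}k_αk_μ minus β(λ). As A(tk) = t²A(k) and A(k)
is positive definite for k ≠ 0, this symbol is singular for some k exactly when β(λ) has an
eigenvalue ≥ 0.

The proof avoids the Fourier transform. Both operators come from nonnegative closed forms and are
therefore self-adjoint (`isPosSelfAdjoint_formOperator`). Hence λ belongs to a resolvent set as soon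
as ‖p‖ ≤ C‖(A − λ)p‖ on the graph (`mem_resolventSet_of_bound`), the spectrum is closed, and
negative numbers are not in it. Three facts remain.

(1) If β(λ) is negative definite, A^hom − λ is bounded below: test the macroscopic equation with u₁,
whose energy is nonnegative, and insert the fibrewise formula for u₀ (`exists_bound_Ahom`).

(2) A lower bound for A^hom − λ passes to its symbol (`norm_symbol_le`): slowly modulated real plane
waves φ satisfy ∂_α∂_μφ ≈ −k_αk_μφ, and the elements φ(x)(c + v(ω)) with v in the domain of A₀ turn
the bound on A^hom into one on L²(Ω), for every k and c.

(3) The symbol is then used twice. If β(λ) is not negative definite, a maximal eigenpair of β(λ)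
relative to A(e₀) gives k and c ≠ 0 at which the symbol has a nonzero kernel element, so λ is in the
spectrum (`notMem_resolventSet_Ahom`). If λ is any point of the resolvent set of A^hom, letting |k|
be large makes the macroscopic amplitude c as small as desired, and the bound for A₀ − λ survives,
whence σ(A₀) ⊆ σ(A^hom) (`resolventSet_Ahom_subset`).

Two analytic inputs make the forms closed. Korn's inequality holds for any measure preserving action
of ℝ^d, because weak derivatives commute and Σ⟨∂_iu_j, ∂_ju_i⟩ = ‖div u‖² ≥ 0 (`IsFlow.korn`); it
serves Ω and ℝ^d alike. The tensor C^hom is coercive on symmetric matrices although the energy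
ignores the inclusions (`exists_coercive_Chom`). No extension operator is used: one tests by duality
with bounded, divergence free, symmetric stress fields which take a prescribed constant value on all
inclusions. These are second derivatives of a stress function that is a quadratic polynomial near
each inclusion, and they exist because the inclusions have bounded diameter and are uniformly
separated. -/

namespace HighContrast

open Set Metric Topology

/-! ## Geometry of the inclusions -/

section Geometry

variable {d : ℕ}

/-- An open set with Lipschitz boundary has no boundary point in the interior of its closure. -/
theorem IsLipschitzOpen.mem_closure_compl_closure {U : Set (E d)} (hU : IsLipschitzOpen U)
    {x : E d} (hx : x ∉ U) : x ∈ closure (closure U)ᶜ := by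
  by_cases hxc : x ∈ closure U
  swap
  · exact subset_closure hxc
  have hfr : x ∈ frontier U := by
    rw [hU.1.frontier_eq]; exact ⟨hxc, hx⟩
  obtain ⟨n, γ, K, r, hn, hγ, hr, h⟩ := hU.2 x hfr
  have hx' : γ (x - ⟪n, x⟫ • n) ≤ ⟪n, x⟫ := by
    by_contra hlt
    exact hx ((h x (mem_ball_self hr)).2 (not_le.1 hlt))
  rw [Metric.mem_closure_iff]
  intro ε hε
  set t : ℝ := min ε r / 2 with ht
  have ht0 : 0 < t := by positivity
  have htε : t < ε := by have := min_le_left ε r; linarith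
  have htr : t < r := by have := min_le_right ε r; linarith
  have hdist : dist (x + t • n) x = t := by
    rw [dist_eq_norm, add_sub_cancel_left, norm_smul, hn, mul_one, Real.norm_of_nonneg ht0.le]
  -- Moving along `n` keeps the projection onto the hyperplane and raises the height, so the new
  -- point is strictly above the graph and has a neighbourhood missing `U`.
  refine ⟨x + t • n, ?_, by rw [dist_comm, hdist]; exact htε⟩
  rw [← interior_compl, mem_interior]
  have hin : ⟪n, x + t • n⟫ = ⟪n, x⟫ + t := by
    rw [inner_add_right, inner_smul_right, real_inner_self_eq_norm_sq, hn]; ring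
  refine ⟨ball x r ∩ {y | γ (y - ⟪n, y⟫ • n) < ⟪n, y⟫}, ?_, ?_, ?_, ?_⟩
  · rintro y ⟨hy, hy'⟩ hyU
    exact lt_asymm ((h y hy).1 hyU) hy'
  · refine isOpen_ball.inter (isOpen_lt ?_ (by fun_prop))
    exact hγ.continuous.comp (by fun_prop)
  · rw [mem_ball, hdist]; exact htr
  · simp only [mem_ofPred_eq, hin]
    have : x + t • n - (⟪n, x⟫ + t) • n = x - ⟪n, x⟫ • n := by module
    rw [this]; linarith

namespace IsModelled

variable {S : ModelShapes d} {A B : Set (E d)}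

/-- The data of `IsModelled`, restricted to what the qualitative geometry needs. -/
theorem exists_chart (h : IsModelled S A B) (hAB : A ⊆ B) :
    ∃ (j : Fin S.N) (B' : Set (E d)) (φ ψ : E d → E d), IsOpen B' ∧ B ⊆ B' ∧
      ContinuousOn φ (S.P₃ j) ∧ ContinuousOn ψ B' ∧ φ '' S.P₃ j = B' ∧
      InvOn ψ φ (S.P₃ j) B' ∧ φ '' S.P₂ j = B ∧ φ '' S.P₁ j = A ∧
      S.P₁ j ⊆ S.P₂ j ∧ S.P₂ j ⊆ S.P₃ j ∧
      ∀ x ∈ S.P₃ j, ∀ y ∈ S.P₃ j, S.c * ‖x - y‖ ≤ ‖φ x - φ y‖ := by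
  obtain ⟨j, B', φ, ψ, hB', hBB', hφ, hψ, h3, hinv, -, h21, h1, hlip, -⟩ := h
  have h12 : S.P₁ j ⊆ S.P₂ j := subset_closure.trans (S.closure_subset₁ j)
  refine ⟨j, B', φ, ψ, hB'.1, hBB', hφ.continuousOn, hψ.continuousOn, h3, hinv, ?_, h1, h12,
    subset_closure.trans (S.closure_subset₂ j), fun x hx y hy => (hlip x hx y hy).1⟩
  rw [← sdiff_union_of_subset h12, image_union, h21, h1, sdiff_union_of_subset hAB]

end IsModelled

namespace ModelShapes

variable (S : ModelShapes d)

theorem exists_margin_aux (j : Fin S.N) :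
    ∃ ε > 0, Bornology.IsBounded (S.P₁ j) →
      cthickening ε (closure (S.P₁ j)) ⊆ S.P₂ j := by
  by_cases hb : Bornology.IsBounded (S.P₁ j)
  · obtain ⟨ε, hε, h⟩ := (hb.isCompact_closure).exists_cthickening_subset_open
      (S.lipschitz₂ j).1.1 (S.closure_subset₁ j)
    exact ⟨ε, hε, fun _ => h⟩
  · exact ⟨1, one_pos, fun h => absurd h hb⟩

/-- There are finitely many shapes and a compact `closure P₁` inside the open `P₂`, so one width
serves all. Unbounded shapes may be exempted: a bounded inclusion forces its model to be bounded, by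
the lower Lipschitz bound on the chart. -/
theorem exists_margin : ∃ ε > 0, ∀ j, Bornology.IsBounded (S.P₁ j) →
      cthickening ε (closure (S.P₁ j)) ⊆ S.P₂ j := by
  choose ε hε h using S.exists_margin_aux
  rcases isEmpty_or_nonempty (Fin S.N) with hN | hN
  · exact ⟨1, one_pos, fun j => hN.elim j⟩
  · refine ⟨Finset.univ.inf' Finset.univ_nonempty ε, ?_, fun j hb => ?_⟩
    · rw [gt_iff_lt, Finset.lt_inf'_iff]; exact fun j _ => hε j
    · exact (cthickening_mono (Finset.inf'_le _ (Finset.mem_univ j)) _).trans (h j hb)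

end ModelShapes

namespace IsModelled

variable {S : ModelShapes d} {A B : Set (E d)}

/-- By connectedness of the ball. Let `Q` be the image of the closed `ε`-thickening of the model
inclusion, a compact subset of `B`. By the lower Lipschitz bound the points of `B` in the ball lie
in `Q`, so `B` and the complement of `Q` split the ball into two disjoint open sets, and the centre
is in `B`. -/
theorem ball_subset (h : IsModelled S A B) (hAB : A ⊆ B) (hB : IsOpen B)
    (hA : Bornology.IsBounded A) {ε : ℝ} (hε : 0 < ε)
    (hS : ∀ j, Bornology.IsBounded (S.P₁ j) → cthickening ε (closure (S.P₁ j)) ⊆ S.P₂ j)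
    {x : E d} (hx : x ∈ A) : ball x (S.c * ε) ⊆ B := by
  obtain ⟨j, B', φ, ψ, hB', hBB', hφ, hψ, h3, hinv, h2, h1, h12, h23, hlip⟩ := h.exists_chart hAB
  have hb : Bornology.IsBounded (S.P₁ j) := by
    obtain ⟨C, hC⟩ := Metric.isBounded_iff.1 hA
    refine Metric.isBounded_iff.2 ⟨C / S.c, fun p hp q hq => ?_⟩
    rw [le_div_iff₀ S.c_pos, mul_comm, dist_eq_norm]
    refine (hlip p (h23 (h12 hp)) q (h23 (h12 hq))).trans ?_
    rw [← dist_eq_norm]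
    exact hC (h1 ▸ mem_image_of_mem φ hp) (h1 ▸ mem_image_of_mem φ hq)
  have hsub := hS j hb
  have hcomp : IsCompact (φ '' cthickening ε (closure (S.P₁ j))) :=
    (hb.isCompact_closure.cthickening).image_of_continuousOn (hφ.mono (hsub.trans h23))
  set Q := φ '' cthickening ε (closure (S.P₁ j)) with hQ
  have hQB : Q ⊆ B := h2 ▸ image_mono hsub
  have hkey : ∀ z ∈ ball x (S.c * ε), z ∈ B → z ∈ Q := by
    intro z hz hzB
    obtain ⟨q, hq, rfl⟩ := h2.symm ▸ hzB
    obtain ⟨p, hp, rfl⟩ := h1.symm ▸ hx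
    refine mem_image_of_mem φ (mem_cthickening_of_dist_le q p ε _ (subset_closure hp) ?_)
    have := hlip q (h23 hq) p (h23 (h12 hp))
    rw [mem_ball, dist_eq_norm] at hz
    rw [dist_eq_norm]
    exact le_of_mul_le_mul_left (this.trans hz.le) S.c_pos
  have hpre : IsPreconnected (ball x (S.c * ε)) := (convex_ball x _).isPreconnected
  have := hpre.subset_left_of_subset_union (u := B ∩ ball x (S.c * ε))
    (v := Qᶜ ∩ ball x (S.c * ε)) (hB.inter isOpen_ball)
    (hcomp.isClosed.isOpen_compl.inter isOpen_ball) ?_ ?_ ?_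
  · exact this.trans inter_subset_left
  · rw [disjoint_left]
    rintro z ⟨hz, hzb⟩ ⟨hz', -⟩
    exact hz' (hkey z hzb hz)
  · intro z hz
    by_cases hzB : z ∈ B
    · exact Or.inl ⟨hzB, hz⟩
    · exact Or.inr ⟨fun h => hzB (hQB h), hz⟩
  · have hm : x ∈ ball x (S.c * ε) := mem_ball_self (mul_pos S.c_pos hε)
    exact ⟨x, hm, hAB hx, hm⟩

/-- The corresponding property of the Lipschitz model shape, transported by the chart: the
continuous inverse maps points of `B` in the closure of `A` into the closure of `P₁`, so points of
`P₂` off that closure have images off the closure of `A`. -/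
theorem mem_closure_compl_closure (h : IsModelled S A B) (hAB : A ⊆ B)
    (hcl : closure A ⊆ B) {x : E d} (hxA : x ∉ A) (hx : x ∈ closure A) :
    x ∈ closure (B \ closure A) := by
  obtain ⟨j, B', φ, ψ, hB', hBB', hφ, hψ, h3, hinv, h2, h1, h12, h23, hlip⟩ := h.exists_chart hAB
  have hP : ∀ q ∈ S.P₂ j, φ q ∈ closure A → q ∈ closure (S.P₁ j) := by
    intro q hq hqA
    have hc : ContinuousWithinAt ψ A (φ q) :=
      (hψ (φ q) (hBB' (hcl hqA))).mono (hAB.trans hBB')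
    have h4 : MapsTo ψ A (S.P₁ j) := by
      rw [← h1]
      rintro _ ⟨p, hp, rfl⟩
      rw [hinv.1 (h23 (h12 hp))]; exact hp
    have := hc.mem_closure hqA h4
    rwa [hinv.1 (h23 hq)] at this
  obtain ⟨p, hp, rfl⟩ := h2.symm ▸ hcl hx
  have hpP : p ∉ S.P₁ j := fun hp1 => hxA (h1 ▸ mem_image_of_mem φ hp1)
  have hp' : p ∈ closure (S.P₂ j ∩ (closure (S.P₁ j))ᶜ) :=
    (S.lipschitz₂ j).1.1.inter_closure ⟨hp, (S.lipschitz₁ j).1.mem_closure_compl_closure hpP⟩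
  have hc : ContinuousWithinAt φ (S.P₂ j ∩ (closure (S.P₁ j))ᶜ) p :=
    (hφ p (h23 hp)).mono (inter_subset_left.trans h23)
  refine hc.mem_closure hp' ?_
  rintro q ⟨hq, hq'⟩
  exact ⟨h2 ▸ mem_image_of_mem φ hq, fun hmem => hq' (hP q hq hmem)⟩

end IsModelled

/-- An inclusion system in which every inclusion is surrounded by a layer of thickness `δ` that
stays in its extension domain. -/
structure IsSeparated {d : ℕ} (δ : ℝ) (ω : Set (E d)) (inc nbhd : ℕ → Set (E d)) : Prop where
  union : ω = ⋃ k, inc k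
  disjoint : Pairwise fun k l => Disjoint (inc k) (inc l)
  isOpen_inc : ∀ k, IsOpen (inc k)
  nonempty_inc : ∀ k, (inc k).Nonempty
  isOpen_nbhd : ∀ k, IsOpen (nbhd k)
  inter_nbhd : ∀ k, ω ∩ nbhd k = inc k
  ball_subset : ∀ k, ∀ x ∈ inc k, ball x δ ⊆ nbhd k
  dist_le : ∀ k, ∀ x ∈ inc k, ∀ y ∈ inc k, dist x y ≤ 1 / 2
  compl_nonempty : ωᶜ.Nonempty
  regular : ∀ k, ∀ x ∉ inc k, x ∈ closure (inc k) → x ∈ closure (nbhd k \ closure (inc k))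

/-- The thickness `δ` is the lower Lipschitz constant times the common margin of the model shapes,
so it does not depend on `ω`. Everything later uses the geometry only through `IsSeparated`. -/
theorem ModelShapes.exists_separated (S : ModelShapes d) :
    ∃ δ > 0, ∀ ω : Set (E d), ∀ inc nbhd : ℕ → Set (E d),
      IsInclusionSystem S ω inc nbhd → IsSeparated δ ω inc nbhd := by
  obtain ⟨ε, hε, hS⟩ := S.exists_margin
  refine ⟨S.c * ε, mul_pos S.c_pos hε, fun ω inc nbhd h => ?_⟩
  have hsub : ∀ k, inc k ⊆ nbhd k := fun k => by
    rw [← h.inter_nbhd k]; exact inter_subset_right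
  have hbd : ∀ k, Bornology.IsBounded (inc k) := fun k => (h.bounded_nbhd k).subset (hsub k)
  have hball : ∀ k, ∀ x ∈ inc k, ball x (S.c * ε) ⊆ nbhd k := fun k x hx =>
    (h.modelled k).ball_subset (hsub k) (h.isOpen_nbhd k) (hbd k) hε hS hx
  have hcl : ∀ k, closure (inc k) ⊆ nbhd k := by
    intro k x hx
    obtain ⟨y, hy, hxy⟩ := Metric.mem_closure_iff.1 hx _ (mul_pos S.c_pos hε)
    exact hball k y hy (by rwa [mem_ball])
  exact
    { union := h.union
      disjoint := h.disjoint
      isOpen_inc := h.isOpen_inc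
      nonempty_inc := fun k => (h.connected_inc k).nonempty
      isOpen_nbhd := h.isOpen_nbhd
      inter_nbhd := h.inter_nbhd
      ball_subset := hball
      dist_le := fun k x hx y hy => (dist_le_diam_of_mem (hbd k) hx hy).trans (h.diam_inc k).le
      compl_nonempty := h.connected_compl.nonempty
      regular := fun k x hx hx' =>
        (h.modelled k).mem_closure_compl_closure (hsub k) (hcl k) hx hx' }

theorem ConfigFamily.IsAdmissible.exists_separated {𝒪 : ConfigFamily d} (h : 𝒪.IsAdmissible) :
    ∃ δ > 0, ∀ ω ∈ 𝒪.sets, ∃ inc nbhd : ℕ → Set (E d), IsSeparated δ ω inc nbhd := by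
  obtain ⟨S, hS⟩ := h
  obtain ⟨δ, hδ, h'⟩ := S.exists_separated
  refine ⟨δ, hδ, fun ω hω => ?_⟩
  obtain ⟨inc, nbhd, hi⟩ := hS ω hω
  exact ⟨inc, nbhd, h' _ _ _ hi⟩

namespace IsSeparated

variable {δ : ℝ} {ω : Set (E d)} {inc nbhd : ℕ → Set (E d)}

theorem isOpen (h : IsSeparated δ ω inc nbhd) : IsOpen ω := by
  rw [h.union]; exact isOpen_iUnion h.isOpen_inc

/-- A point of `ω` closer than `δ` to the inclusion `k` lies in its extension domain, and that
domain meets `ω` only in the inclusion `k`. -/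
theorem eq_of_dist_lt (h : IsSeparated δ ω inc nbhd) {k l : ℕ} {x y : E d} (hx : x ∈ inc k)
    (hy : y ∈ inc l) (hxy : dist y x < δ) : k = l := by
  by_contra hkl
  have h1 : y ∈ ω := h.union ▸ mem_iUnion_of_mem l hy
  have h2 : y ∈ inc k := by
    rw [← h.inter_nbhd k]; exact ⟨h1, h.ball_subset k x hx hxy⟩
  exact disjoint_left.1 (h.disjoint hkl) h2 hy

theorem disjoint_thickening (h : IsSeparated δ ω inc nbhd) {k l : ℕ} {x : E d}
    (hk : x ∈ thickening (δ / 2) (inc k)) (hl : x ∈ thickening (δ / 2) (inc l)) : k = l := by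
  obtain ⟨y, hy, hxy⟩ := mem_thickening_iff.1 hk
  obtain ⟨z, hz, hxz⟩ := mem_thickening_iff.1 hl
  exact h.eq_of_dist_lt hy hz (by linarith [dist_triangle_left z y x])

/-- For infinitely many inclusions this needs the separation: within distance `δ / 2` of a point,
only one inclusion can be seen. -/
theorem closure_subset (h : IsSeparated δ ω inc nbhd) (hδ : 0 < δ) {x : E d}
    (hx : x ∈ closure ω) : ∃ k, x ∈ closure (inc k) := by
  obtain ⟨y, hy, hxy⟩ := Metric.mem_closure_iff.1 hx (δ / 2) (by positivity)
  obtain ⟨k, hk⟩ := mem_iUnion.1 (h.union ▸ hy)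
  refine ⟨k, Metric.mem_closure_iff.2 fun ε hε => ?_⟩
  obtain ⟨z, hz, hxz⟩ := Metric.mem_closure_iff.1 hx (min ε (δ / 2)) (by positivity)
  obtain ⟨l, hl⟩ := mem_iUnion.1 (h.union ▸ hz)
  have hkl : k = l := h.eq_of_dist_lt hk hl (by
    have := hxz.trans_le (min_le_right _ _)
    linarith [dist_triangle_left z y x])
  exact ⟨z, hkl ▸ hl, hxz.trans_le (min_le_left _ _)⟩

/-- A collection of inclusions is a regular open set. -/
theorem interior_closure (h : IsSeparated δ ω inc nbhd) (hδ : 0 < δ) :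
    interior (closure ω) = ω := by
  refine Subset.antisymm (fun x hx => ?_) (h.isOpen.subset_interior_closure)
  by_contra hxω
  obtain ⟨k, hk⟩ := h.closure_subset hδ (interior_subset hx)
  have hxk : x ∉ inc k := fun hmem => hxω (h.union ▸ mem_iUnion_of_mem k hmem)
  -- A boundary point inside `interior (closure ω)` would have nearby a point of the extension
  -- domain that is off the closure of inclusion `k` but in the closure of `ω`. In the extension
  -- domain `ω` is nothing but inclusion `k`.
  obtain ⟨y, hy, hy', hy''⟩ := mem_closure_iff.1 (h.regular k x hxk hk) _ isOpen_interior hx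
  have : y ∈ closure (nbhd k ∩ ω) := (h.isOpen_nbhd k).inter_closure ⟨hy', interior_subset hy⟩
  rw [inter_comm, h.inter_nbhd] at this
  exact hy'' this

end IsSeparated

end Geometry

/-! ## Measurability of the translations -/

section Measurability

variable {d : ℕ} {𝒪 : ConfigFamily d}

/-- A point of `ℝ^d` with rational coordinates. -/
def ratPoint (q : Fin d → ℚ) : E d := WithLp.toLp 2 fun i => (q i : ℝ)

theorem denseRange_ratPoint : DenseRange (ratPoint (d := d)) := by
  have h1 : DenseRange (fun (q : Fin d → ℚ) (i : Fin d) => (q i : ℝ)) :=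
    DenseRange.piMap fun _ => Rat.denseRange_cast
  exact (PiLp.homeomorph 2 (fun _ : Fin d => ℝ)).symm.surjective.denseRange.comp h1
    (PiLp.homeomorph 2 (fun _ : Fin d => ℝ)).symm.continuous

theorem measurableSet_ratPoint_mem (q : Fin d → ℚ) :
    MeasurableSet {ω : Config 𝒪 | ratPoint q ∈ ω.set} :=
  MeasurableSpace.measurableSet_generateFrom ⟨q, rfl⟩

/-- This makes `L²(Ω)` separable, as needed for Korn's inequality and for choosing one null set for
all test functions. -/
instance : MeasurableSpace.CountablyGenerated (Config 𝒪) where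
  isCountablyGenerated := ⟨_, by
    have : {F : Set (Config 𝒪) | ∃ q : Fin d → ℚ,
        F = {ω | WithLp.toLp 2 (fun i => (q i : ℝ)) ∈ ω.set}} =
        range fun q : Fin d → ℚ => {ω : Config 𝒪 | ratPoint q ∈ ω.set} := by
      ext F; simp only [mem_ofPred_eq, mem_range, eq_comm]; rfl
    rw [this]; exact countable_range _, rfl⟩

variable (𝒪) in
/-- All members of the family are regular open proper subsets of `ℝ^d`. -/
def ConfigFamily.IsRegular : Prop :=
  ∀ ω ∈ 𝒪.sets, IsOpen ω ∧ interior (closure ω) = ω ∧ ωᶜ.Nonempty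

theorem ConfigFamily.IsAdmissible.isRegular (h : 𝒪.IsAdmissible) : 𝒪.IsRegular := by
  obtain ⟨δ, hδ, h⟩ := h.exists_separated
  intro ω hω
  obtain ⟨inc, nbhd, hi⟩ := h ω hω
  exact ⟨hi.isOpen, hi.interior_closure hδ, hi.compl_nonempty⟩

/-- The σ-algebra only sees rational points. For a regular open set they suffice: `z ∈ ω` exactly
when some rational ball around `z` has all its rational points in `ω`, for then the ball lies in
`interior (closure ω) = ω`. -/
theorem ConfigFamily.IsRegular.measurableSet_mem (h : 𝒪.IsRegular) :
    MeasurableSet {p : E d × Config 𝒪 | p.1 ∈ p.2.set} := by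
  have : {p : E d × Config 𝒪 | p.1 ∈ p.2.set} =
      ⋃ (c : Fin d → ℚ) (r : ℚ), ball (ratPoint c) r ×ˢ
        ⋂ (q : Fin d → ℚ) (_ : ratPoint q ∈ ball (ratPoint c) (r : ℝ)),
          {ω : Config 𝒪 | ratPoint q ∈ ω.set} := by
    ext ⟨z, ω⟩
    obtain ⟨ho, hr, -⟩ := h ω.1 ω.2
    simp only [mem_ofPred_eq, mem_iUnion, mem_prod, mem_iInter]
    constructor
    · intro hz
      obtain ⟨ε, hε, hb⟩ := Metric.isOpen_iff.1 ho z hz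
      obtain ⟨r, hr0, hrε⟩ := exists_rat_btwn (half_pos hε)
      have hr0' : (0 : ℝ) < r := hr0
      obtain ⟨c, hc⟩ := denseRange_ratPoint.exists_mem_open (isOpen_ball (x := z) (ε := r))
        ⟨z, mem_ball_self hr0'⟩
      refine ⟨c, r, by rwa [mem_ball_comm] at hc, fun q hq => hb ?_⟩
      rw [mem_ball] at hc hq ⊢
      linarith [dist_triangle (ratPoint q) (ratPoint c) z]
    · rintro ⟨c, r, hz, hq⟩
      change z ∈ ω.1
      rw [← hr, mem_interior]
      refine ⟨ball (ratPoint c) r, ?_, isOpen_ball, hz⟩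
      refine (denseRange_ratPoint.open_subset_closure_inter isOpen_ball).trans
        (closure_mono ?_)
      rintro _ ⟨hy, q, rfl⟩
      exact hq q hy
  rw [this]
  refine MeasurableSet.iUnion fun c => MeasurableSet.iUnion fun r => ?_
  exact measurableSet_ball.prod (MeasurableSet.iInter fun q => MeasurableSet.iInter fun _ =>
    measurableSet_ratPoint_mem q)

theorem mem_set_T {y z : E d} {ω : Config 𝒪} : z ∈ (T y ω).set ↔ z + y ∈ ω.set := by
  constructor
  · rintro ⟨x, hx, rfl⟩; rwa [sub_add_cancel]
  · intro h; exact ⟨z + y, h, by simp⟩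

theorem T_zero (ω : Config 𝒪) : T 0 ω = ω := by
  apply Subtype.ext; ext z; exact mem_set_T.trans (by rw [add_zero]; rfl)

theorem T_add (y z : E d) (ω : Config 𝒪) : T (y + z) ω = T y (T z ω) := by
  apply Subtype.ext; ext x
  refine mem_set_T.trans (Iff.trans ?_ mem_set_T.symm)
  rw [mem_set_T, add_assoc]

theorem T_mem_originIn {y : E d} {ω : Config 𝒪} : T y ω ∈ originIn 𝒪 ↔ y ∈ ω.set := by
  change (0 : E d) ∈ (T y ω).set ↔ _
  rw [mem_set_T, zero_add]

theorem measurableSet_originIn : MeasurableSet (originIn 𝒪) := by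
  convert measurableSet_ratPoint_mem (𝒪 := 𝒪) (0 : Fin d → ℚ) using 1
  ext ω
  have : ratPoint (0 : Fin d → ℚ) = 0 := by ext i; simp [ratPoint]
  rw [originIn, this]

theorem ConfigFamily.IsRegular.measurable_T (h : 𝒪.IsRegular) :
    Measurable fun p : E d × Config 𝒪 => T p.1 p.2 := by
  refine measurable_generateFrom ?_
  rintro _ ⟨q, rfl⟩
  have : Measurable fun p : E d × Config 𝒪 => (ratPoint q + p.1, p.2) := by fun_prop
  convert this h.measurableSet_mem using 1
  ext p
  exact mem_set_T

end Measurability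

open Set Filter Topology

/-! ## Measure preserving actions of `ℝ^d` -/

theorem abs_integral_mul_le {α : Type*} [MeasurableSpace α] {μ : Measure α} {f g : α → ℝ}
    (hf : MemLp f 2 μ) (hg : MemLp g 2 μ) :
    |∫ x, f x * g x ∂μ| ≤ √(∫ x, f x ^ 2 ∂μ) * √(∫ x, g x ^ 2 ∂μ) := by
  have hn : ∀ {f : α → ℝ} (hf : MemLp f 2 μ), ‖hf.toLp f‖ = √(∫ x, f x ^ 2 ∂μ) := by
    intro f hf
    rw [← Real.sqrt_sq (norm_nonneg (hf.toLp f)), ← real_inner_self_eq_norm_sq, L2.inner_def]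
    congr 1
    refine integral_congr_ae ?_
    filter_upwards [hf.coeFn_toLp] with x hx
    rw [hx]; simp [sq]
  rw [← hn hf, ← hn hg]
  refine le_trans (le_of_eq ?_) (abs_real_inner_le_norm _ _)
  rw [L2.inner_def]
  congr 1
  refine integral_congr_ae ?_
  filter_upwards [hf.coeFn_toLp, hg.coeFn_toLp] with x hx hy
  rw [hx, hy]; simp [mul_comm]

theorem norm_toLp_sq {α F : Type*} [MeasurableSpace α] {μ : Measure α} [NormedAddCommGroup F]
    [InnerProductSpace ℝ F] (f : Lp F 2 μ) : ‖f‖ ^ 2 = ∫ x, ‖f x‖ ^ 2 ∂μ := by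
  rw [← real_inner_self_eq_norm_sq, L2.inner_def]
  exact integral_congr_ae (Eventually.of_forall fun x => real_inner_self_eq_norm_sq _)

/-- A jointly measurable action of `ℝ^d` by measure preserving maps. -/
structure IsFlow {d : ℕ} {X : Type*} [MeasurableSpace X] (τ : E d → X → X) (μ : Measure X) :
    Prop where
  measurable : Measurable fun p : E d × X => τ p.1 p.2
  zero : ∀ x, τ 0 x = x
  add : ∀ y z x, τ (y + z) x = τ y (τ z x)
  measurePreserving : ∀ y, MeasurePreserving (τ y) μ μ

/-- A positive continuous weight on `ℝ^d` with integrable square. -/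
noncomputable def weight {d : ℕ} (y : E d) : ℝ := ((1 + ‖y‖) ^ (d + 1))⁻¹

section Weight

variable {d : ℕ}

theorem weight_pos (y : E d) : 0 < weight y := by
  unfold weight; positivity

theorem continuous_weight : Continuous (weight (d := d)) := by
  unfold weight
  refine Continuous.inv₀ (by fun_prop) fun y => by positivity

theorem integrable_weight_sq : Integrable fun y : E d => weight y ^ 2 := by
  have := integrable_one_add_norm (E := E d) (μ := volume) (r := ((d + 1) * 2 : ℕ)) (by
    rw [finrank_euclideanSpace, Fintype.card_fin]; norm_cast; omega)
  refine this.congr (Eventually.of_forall fun y => ?_)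
  simp only [weight]
  rw [Real.rpow_neg (by positivity), Real.rpow_natCast, inv_pow, ← pow_mul]

end Weight

/-! ### Weak gradients on `ℝ^d` form a linear relation -/

section WeakGrad

variable {d : ℕ} {u u' : E d → E d} {G G' : E d → M d}

theorem integrable_mul_of_locallyIntegrable {f φ : E d → ℝ} (hf : LocallyIntegrable f)
    (hφ : Continuous φ) (hc : HasCompactSupport φ) : Integrable fun y => f y * φ y := by
  have := hf.integrable_smul_left_of_hasCompactSupport hφ hc
  exact this.congr (Eventually.of_forall fun y => by simp [mul_comm])

theorem _root_.MeasureTheory.LocallyIntegrable.coord {ι : Type*} [Fintype ι] {f : E d → EuclideanSpace ℝ ι}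
    (hf : LocallyIntegrable f) (i : ι) : LocallyIntegrable fun y => f y i := by
  intro x
  obtain ⟨s, hs, h⟩ := hf x
  exact ⟨s, hs, (EuclideanSpace.proj (𝕜 := ℝ) i).integrable_comp h⟩

theorem continuous_fderiv_apply {φ : E d → ℝ} (hφ : ContDiff ℝ (⊤ : ℕ∞) φ) (v : E d) :
    Continuous fun y => fderiv ℝ φ y v :=
  (hφ.continuous_fderiv (by simp)).clm_apply continuous_const

theorem contDiff_fderiv_apply {φ : E d → ℝ} (hφ : ContDiff ℝ (⊤ : ℕ∞) φ) (v : E d) :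
    ContDiff ℝ (⊤ : ℕ∞) fun y => fderiv ℝ φ y v :=
  (hφ.fderiv_right (m := (⊤ : ℕ∞)) (by simp)).clm_apply contDiff_const

theorem HasWeakGrad.congr (h : HasWeakGrad u G) (hu : u =ᵐ[volume] u') (hG : G =ᵐ[volume] G') :
    HasWeakGrad u' G' := by
  obtain ⟨h1, h2, h3⟩ := h
  refine ⟨h1.congr hu, h2.congr hG, fun φ hφ hc μ ν => ?_⟩
  have e1 : ∫ y, u' y ν * fderiv ℝ φ y (e μ) = ∫ y, u y ν * fderiv ℝ φ y (e μ) :=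
    integral_congr_ae (by filter_upwards [hu] with y hy; rw [hy])
  have e2 : ∫ y, G' y (μ, ν) * φ y = ∫ y, G y (μ, ν) * φ y :=
    integral_congr_ae (by filter_upwards [hG] with y hy; rw [hy])
  rw [e1, e2, h3 φ hφ hc]

theorem HasWeakGrad.add (h : HasWeakGrad u G) (h' : HasWeakGrad u' G') :
    HasWeakGrad (fun y => u y + u' y) (fun y => G y + G' y) := by
  obtain ⟨h1, h2, h3⟩ := h
  obtain ⟨h1', h2', h3'⟩ := h'
  refine ⟨h1.add h1', h2.add h2', fun φ hφ hc μ ν => ?_⟩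
  have hc' : HasCompactSupport fun y => fderiv ℝ φ y (e μ) := hc.fderiv_apply (𝕜 := ℝ) _
  simp only [PiLp.add_apply, add_mul]
  rw [integral_add, integral_add, h3 φ hφ hc, h3' φ hφ hc]
  · ring
  · exact integrable_mul_of_locallyIntegrable (h2.coord _) hφ.continuous hc
  · exact integrable_mul_of_locallyIntegrable (h2'.coord _) hφ.continuous hc
  · exact integrable_mul_of_locallyIntegrable (h1.coord _) (continuous_fderiv_apply hφ _) hc'
  · exact integrable_mul_of_locallyIntegrable (h1'.coord _) (continuous_fderiv_apply hφ _) hc'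

theorem HasWeakGrad.smul (h : HasWeakGrad u G) (c : ℝ) :
    HasWeakGrad (fun y => c • u y) (fun y => c • G y) := by
  obtain ⟨h1, h2, h3⟩ := h
  refine ⟨h1.smul c, h2.smul c, fun φ hφ hc μ ν => ?_⟩
  simp only [PiLp.smul_apply, smul_eq_mul, mul_assoc]
  rw [integral_const_mul, integral_const_mul, h3 φ hφ hc]
  ring

theorem hasWeakGrad_zero : HasWeakGrad (fun _ : E d => (0 : E d)) (fun _ => (0 : M d)) :=
  ⟨locallyIntegrable_const 0, locallyIntegrable_const 0, fun φ _ _ μ ν => by simp⟩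

end WeakGrad

theorem IsL2Loc.locallyIntegrable {d : ℕ} {F : Type*} [NormedAddCommGroup F] {f : E d → F}
    (hf : IsL2Loc f) : LocallyIntegrable f := by
  rw [locallyIntegrable_iff]
  intro K hK
  have : IsFiniteMeasure (volume.restrict K) := isFiniteMeasure_restrict.2 hK.measure_ne_top
  exact (hf K hK).integrable (by norm_num)

/-! ### Almost every orbit: Fubini's theorem for measure preserving actions -/

namespace IsFlow

variable {d : ℕ} {X : Type*} [MeasurableSpace X] {τ : E d → X → X} {μ : Measure X} [SFinite μ]

/-- The shear `(y, x) ↦ (y, τ_y x)` is what transfers statements about almost every `x` to almost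
every point of almost every orbit. -/
theorem skew (h : IsFlow τ μ) : MeasurePreserving (fun p : E d × X => (p.1, τ p.1 p.2))
    (volume.prod μ) (volume.prod μ) :=
  (MeasurePreserving.id volume).skew_product h.measurable
    (Eventually.of_forall fun y => (h.measurePreserving y).map_eq)

theorem quasi (h : IsFlow τ μ) : Measure.QuasiMeasurePreserving
    (fun p : E d × X => τ p.1 p.2) (volume.prod μ) μ :=
  Measure.quasiMeasurePreserving_snd.comp h.skew.quasiMeasurePreserving

theorem ae_orbit (h : IsFlow τ μ) {p : X → Prop} (hp : ∀ᵐ x ∂μ, p x) :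
    ∀ᵐ x ∂μ, ∀ᵐ y : E d, p (τ y x) := by
  have h1 := h.quasi.ae hp
  have h2 : ∀ᵐ q ∂(μ.prod (volume : Measure (E d))), p (τ q.2 q.1) :=
    Measure.measurePreserving_swap.quasiMeasurePreserving.ae h1
  exact Measure.ae_ae_of_ae_prod h2

theorem aestronglyMeasurable_orbit {F : Type*} [TopologicalSpace F]
    (h : IsFlow τ μ) {f : X → F} (hf : AEStronglyMeasurable f μ) :
    AEStronglyMeasurable (fun p : E d × X => f (τ p.1 p.2)) (volume.prod μ) :=
  hf.comp_quasiMeasurePreserving h.quasi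

theorem ae_aestronglyMeasurable_orbit {F : Type*} [TopologicalSpace F]
    (h : IsFlow τ μ) {f : X → F} (hf : AEStronglyMeasurable f μ) :
    ∀ᵐ x ∂μ, AEStronglyMeasurable (fun y => f (τ y x)) (volume : Measure (E d)) := by
  obtain ⟨g, hg, hfg⟩ := hf
  filter_upwards [h.ae_orbit hfg] with x hx
  refine ⟨fun y => g (τ y x), hg.comp_measurable (h.measurable.comp measurable_prodMk_right), hx⟩

theorem integrable_orbit (h : IsFlow τ μ) {η : E d → ℝ} (hη : Integrable η) {f : X → ℝ}
    (hf : Integrable f μ) :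
    Integrable (fun p : E d × X => η p.1 * f (τ p.1 p.2)) (volume.prod μ) :=
  h.skew.integrable_comp_of_integrable (hη.mul_prod hf)

omit [SFinite μ] in
theorem integral_comp (h : IsFlow τ μ) {F : Type*} [NormedAddCommGroup F] [NormedSpace ℝ F]
    {f : X → F} (hf : AEStronglyMeasurable f μ) (y : E d) :
    ∫ x, f (τ y x) ∂μ = ∫ x, f x ∂μ := by
  have hy := h.measurePreserving y
  conv_rhs => rw [← hy.map_eq]
  rw [integral_map hy.measurable.aemeasurable (by rwa [hy.map_eq])]

theorem integral_orbit (h : IsFlow τ μ) {η : E d → ℝ} (hη : Integrable η) {f : X → ℝ}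
    (hf : Integrable f μ) :
    ∫ x, (∫ y, η y * f (τ y x)) ∂μ = (∫ y, η y) * ∫ x, f x ∂μ := by
  rw [← integral_integral_swap (h.integrable_orbit hη hf), ← integral_mul_const]
  refine integral_congr_ae (Eventually.of_forall fun y => ?_)
  simp only
  rw [integral_const_mul, h.integral_comp hf.aestronglyMeasurable]

variable {F : Type*} [NormedAddCommGroup F]

/-- An orbit of a square integrable function is in general not square integrable on `ℝ^d`. After
multiplication by `weight`, whose square is integrable, it is so for almost every starting point, by
Fubini and invariance. -/
theorem ae_memLp_weight (h : IsFlow τ μ) {f : X → F} (hf : MemLp f 2 μ) :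
    ∀ᵐ x ∂μ, MemLp (fun y => weight y * ‖f (τ y x)‖) 2 (volume : Measure (E d)) := by
  have h1 : Integrable (fun x => ‖f x‖ ^ 2) μ := hf.integrable_norm_pow (by norm_num)
  filter_upwards [(h.integrable_orbit (d := d) integrable_weight_sq h1).prod_left_ae,
    h.ae_aestronglyMeasurable_orbit hf.1] with x hx hm
  rw [memLp_two_iff_integrable_sq]
  · simpa only [mul_pow] using hx
  · exact continuous_weight.aestronglyMeasurable.mul hm.norm

theorem ae_isL2Loc (h : IsFlow τ μ) {f : X → F} (hf : MemLp f 2 μ) :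
    ∀ᵐ x ∂μ, IsL2Loc fun y : E d => f (τ y x) := by
  filter_upwards [h.ae_memLp_weight hf, h.ae_aestronglyMeasurable_orbit hf.1] with x hx hm K hK
  obtain ⟨C, hC⟩ := hK.exists_bound_of_continuousOn (f := fun y : E d => (weight y)⁻¹)
    (continuous_weight.inv₀ fun y => (weight_pos y).ne').continuousOn
  refine (hx.restrict K).of_le_mul (c := C) hm.restrict ?_
  refine (ae_restrict_iff' hK.measurableSet).2 (Eventually.of_forall fun y hy => ?_)
  have h1 := hC y hy
  have h2 := weight_pos y
  rw [Real.norm_of_nonneg (inv_nonneg.2 h2.le), inv_le_iff_one_le_mul₀ h2] at h1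
  rw [Real.norm_of_nonneg (mul_nonneg h2.le (norm_nonneg _)), ← mul_assoc]
  exact le_mul_of_one_le_left (norm_nonneg _) h1

/-- Along a subsequence, convergence in `L²(X)` is inherited by almost all orbits. -/
theorem exists_subseq (h : IsFlow τ μ) {f : ℕ → Lp F 2 μ} {g : Lp F 2 μ}
    (hf : Tendsto f atTop (𝓝 g)) : ∃ ns : ℕ → ℕ, StrictMono ns ∧ ∀ᵐ x ∂μ,
      Tendsto (fun n => ∫ y : E d, (weight y * ‖f (ns n) (τ y x) - g (τ y x)‖) ^ 2) atTop (𝓝 0) := by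
  have hint : ∀ n, Integrable (fun p : E d × X => weight p.1 ^ 2 *
      ‖(f n - g : Lp F 2 μ) (τ p.1 p.2)‖ ^ 2) (volume.prod μ) := fun n =>
    h.integrable_orbit (f := fun x => ‖(f n - g : Lp F 2 μ) x‖ ^ 2) integrable_weight_sq
      ((Lp.memLp (f n - g)).integrable_norm_pow (by norm_num))
  set v : ℕ → X → ℝ := fun n x => ∫ y : E d, weight y ^ 2 * ‖(f n - g : Lp F 2 μ) (τ y x)‖ ^ 2
    with hv
  have hv0 : ∀ n x, 0 ≤ v n x := fun n x => integral_nonneg fun y => by positivity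
  have hvint : ∀ n, Integrable (v n) μ := fun n => (hint n).integral_prod_right
  have hvI : ∀ n, ∫ x, v n x ∂μ = (∫ y : E d, weight y ^ 2) * ∫ x, ‖(f n - g : Lp F 2 μ) x‖ ^ 2 ∂μ :=
    fun n => h.integral_orbit (f := fun x => ‖(f n - g : Lp F 2 μ) x‖ ^ 2) integrable_weight_sq
      ((Lp.memLp (f n - g)).integrable_norm_pow (by norm_num))
  have hlim : Tendsto (fun n => eLpNorm (v n - fun _ => 0) 1 μ) atTop (𝓝 0) := by
    have h1 : ∀ n, eLpNorm (v n - fun _ => 0) 1 μ =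
        ENNReal.ofReal ((∫ y : E d, weight y ^ 2) * ‖f n - g‖ ^ 2) := by
      intro n
      have h2 : ‖f n - g‖ ^ 2 = ∫ x, ‖(f n - g : Lp F 2 μ) x‖ ^ 2 ∂μ := by
        have := Lp.norm_def (f n - g)
        rw [(Lp.memLp (f n - g)).eLpNorm_eq_integral_rpow_norm (by norm_num) (by norm_num)] at this
        simp only [ENNReal.toReal_ofNat, Real.rpow_ofNat] at this
        have h0 : 0 ≤ ∫ x, ‖(f n - g : Lp F 2 μ) x‖ ^ 2 ∂μ := integral_nonneg fun _ => by positivity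
        rw [this, ENNReal.toReal_ofReal (by positivity), ← Real.rpow_natCast, ← Real.rpow_mul h0]
        norm_num
      rw [h2, ← hvI, ofReal_integral_eq_lintegral_ofReal (hvint n) (Eventually.of_forall (hv0 n)),
        eLpNorm_one_eq_lintegral_enorm]
      refine lintegral_congr fun x => ?_
      simp [Real.enorm_eq_ofReal (hv0 n x)]
    simp_rw [h1]
    have h3 : Tendsto (fun n => (∫ y : E d, weight y ^ 2) * ‖f n - g‖ ^ 2) atTop (𝓝 0) := by
      have := ((tendsto_iff_norm_sub_tendsto_zero.1 hf).pow 2).const_mul (∫ y : E d, weight y ^ 2)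
      simpa using this
    simpa using ENNReal.tendsto_ofReal h3
  obtain ⟨ns, hns, hae⟩ := (tendstoInMeasure_of_tendsto_eLpNorm (p := 1) one_ne_zero
    (fun n => (hvint n).aestronglyMeasurable) aestronglyMeasurable_const hlim).exists_seq_tendsto_ae
  refine ⟨ns, hns, ?_⟩
  have hsub : ∀ᵐ x ∂μ, ∀ n, ∀ᵐ y : E d, (f n - g : Lp F 2 μ) (τ y x) = f n (τ y x) - g (τ y x) :=
    ae_all_iff.2 fun n => h.ae_orbit (Lp.coeFn_sub (f n) g)
  filter_upwards [hae, hsub] with x hx hs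
  refine hx.congr fun n => integral_congr_ae ?_
  filter_upwards [hs (ns n)] with y hy
  rw [mul_pow, ← hy]

/-- Testing with `φ` is continuous in the weighted `L²` norm, since `φ / weight` is continuous with
compact support. The majorant `w` is kept separate so that the norm of a vector field can serve for
each of its coordinates. -/
theorem tendsto_integral_mul {u : ℕ → E d → ℝ} {v : E d → ℝ} {φ : E d → ℝ} (hφ : Continuous φ)
    (hc : HasCompactSupport φ) (hu : ∀ n, LocallyIntegrable (u n)) (hv : LocallyIntegrable v)
    {w : ℕ → E d → ℝ} (hw : ∀ n, MemLp (w n) 2 volume)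
    (huw : ∀ n y, weight y * |u n y - v y| ≤ w n y)
    (hlim : Tendsto (fun n => ∫ y, w n y ^ 2) atTop (𝓝 0)) :
    Tendsto (fun n => ∫ y, u n y * φ y) atTop (𝓝 (∫ y, v y * φ y)) := by
  have hψc : Continuous fun y => (weight y)⁻¹ * |φ y| :=
    (continuous_weight.inv₀ fun y => (weight_pos y).ne').mul hφ.abs
  have hψ : MemLp (fun y => (weight y)⁻¹ * |φ y|) 2 (volume : Measure (E d)) := by
    refine hψc.memLp_of_hasCompactSupport ?_
    exact HasCompactSupport.mul_left (hc.comp_left (g := fun t => |t|) abs_zero)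
  rw [tendsto_iff_norm_sub_tendsto_zero]
  refine squeeze_zero (fun n => norm_nonneg _) (g := fun n => √(∫ y, w n y ^ 2) *
    √(∫ y, ((weight y)⁻¹ * |φ y|) ^ 2)) (fun n => ?_) ?_
  · refine le_trans ?_ ((le_abs_self _).trans (abs_integral_mul_le (hw n) hψ))
    rw [← integral_sub (integrable_mul_of_locallyIntegrable (hu n) hφ hc)
      (integrable_mul_of_locallyIntegrable hv hφ hc)]
    refine norm_integral_le_of_norm_le ((hw n).integrable_mul hψ) (Eventually.of_forall fun y => ?_)
    rw [← sub_mul, norm_mul, Real.norm_eq_abs, Real.norm_eq_abs]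
    calc |u n y - v y| * |φ y| = (weight y * |u n y - v y|) * ((weight y)⁻¹ * |φ y|) := by
          have := (weight_pos y).ne'
          field_simp
      _ ≤ _ := mul_le_mul_of_nonneg_right (huw n y)
          (mul_nonneg (inv_nonneg.2 (weight_pos y).le) (abs_nonneg _))
  · have := ((Real.continuous_sqrt.tendsto _).comp hlim).mul_const
      (√(∫ y, ((weight y)⁻¹ * |φ y|) ^ 2))
    simpa using this

end IsFlow

/-- The Sobolev space `H¹` of an action: pairs of a vector field and a matrix field in `L²` such
that along almost every orbit the latter is the weak gradient of the former. -/
def sobolev {d : ℕ} {X : Type*} [MeasurableSpace X] {τ : E d → X → X} {μ : Measure X} [SFinite μ]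
    (h : IsFlow τ μ) : Submodule ℝ (WithLp 2 (Lp (E d) 2 μ × Lp (M d) 2 μ)) where
  carrier := {p | ∀ᵐ x ∂μ, HasWeakGrad (fun y => p.fst (τ y x)) (fun y => p.snd (τ y x))}
  add_mem' := by
    intro p q hp hq
    filter_upwards [hp, hq, h.ae_orbit (Lp.coeFn_add p.fst q.fst),
      h.ae_orbit (Lp.coeFn_add p.snd q.snd)] with x h1 h2 h3 h4
    exact (h1.add h2).congr (EventuallyEq.symm h3) (EventuallyEq.symm h4)
  zero_mem' := by
    filter_upwards [h.ae_orbit (Lp.coeFn_zero (E d) 2 μ),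
      h.ae_orbit (Lp.coeFn_zero (M d) 2 μ)] with x h3 h4
    exact hasWeakGrad_zero.congr (EventuallyEq.symm h3) (EventuallyEq.symm h4)
  smul_mem' := by
    intro c p hp
    filter_upwards [hp, h.ae_orbit (Lp.coeFn_smul c p.fst),
      h.ae_orbit (Lp.coeFn_smul c p.snd)] with x h1 h3 h4
    exact (h1.smul c).congr (EventuallyEq.symm h3) (EventuallyEq.symm h4)

theorem mem_sobolev {d : ℕ} {X : Type*} [MeasurableSpace X] {τ : E d → X → X} {μ : Measure X}
    [SFinite μ] {h : IsFlow τ μ} {p : WithLp 2 (Lp (E d) 2 μ × Lp (M d) 2 μ)} :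
    p ∈ sobolev h ↔ ∀ᵐ x ∂μ, HasWeakGrad (fun y => p.fst (τ y x)) (fun y => p.snd (τ y x)) :=
  Iff.rfl

/-- Weak gradients are preserved by limits in a weighted `L²` space. -/
theorem HasWeakGrad.of_tendsto {d : ℕ} {u : ℕ → E d → E d} {G : ℕ → E d → M d} {v : E d → E d}
    {H : E d → M d} (h : ∀ n, HasWeakGrad (u n) (G n)) (hv : LocallyIntegrable v)
    (hH : LocallyIntegrable H) (hu : ∀ n, MemLp (fun y => weight y * ‖u n y - v y‖) 2 volume)
    (hG : ∀ n, MemLp (fun y => weight y * ‖G n y - H y‖) 2 volume)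
    (hu' : Tendsto (fun n => ∫ y, (weight y * ‖u n y - v y‖) ^ 2) atTop (𝓝 0))
    (hG' : Tendsto (fun n => ∫ y, (weight y * ‖G n y - H y‖) ^ 2) atTop (𝓝 0)) :
    HasWeakGrad v H := by
  refine ⟨hv, hH, fun φ hφ hc i j => ?_⟩
  have hc' : HasCompactSupport fun y => fderiv ℝ φ y (e i) := hc.fderiv_apply (𝕜 := ℝ) _
  have t1 := IsFlow.tendsto_integral_mul (continuous_fderiv_apply hφ (e i)) hc'
    (fun n => (h n).1.coord j) (hv.coord j) hu (fun n y => mul_le_mul_of_nonneg_left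
      (PiLp.norm_apply_le (u n y - v y) j) (weight_pos y).le) hu'
  have t2 := IsFlow.tendsto_integral_mul hφ.continuous hc
    (fun n => (h n).2.1.coord (i, j)) (hH.coord (i, j)) hG (fun n y => mul_le_mul_of_nonneg_left
      (PiLp.norm_apply_le (G n y - H y) (i, j)) (weight_pos y).le) hG'
  refine tendsto_nhds_unique t1 (t2.neg.congr fun n => ?_)
  exact ((h n).2.2 φ hφ hc i j).symm

/-- Passing to a subsequence twice makes fields and gradients converge along the same orbits; the
limit can then be taken orbit by orbit. -/
theorem IsFlow.ae_hasWeakGrad_of_tendsto {d : ℕ} {X : Type*} [MeasurableSpace X]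
    {τ : E d → X → X} {μ : Measure X} [SFinite μ] (h : IsFlow τ μ) {u : ℕ → Lp (E d) 2 μ}
    {G : ℕ → Lp (M d) 2 μ} {v : Lp (E d) 2 μ} {H : Lp (M d) 2 μ}
    (hp : ∀ n, ∀ᵐ x ∂μ, HasWeakGrad (fun y => u n (τ y x)) (fun y => G n (τ y x)))
    (hu : Tendsto u atTop (𝓝 v)) (hG : Tendsto G atTop (𝓝 H)) :
    ∀ᵐ x ∂μ, HasWeakGrad (fun y => v (τ y x)) (fun y => H (τ y x)) := by
  obtain ⟨ns, hns, h1⟩ := h.exists_subseq hu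
  obtain ⟨ms, hms, h2⟩ := h.exists_subseq (hG.comp hns.tendsto_atTop)
  have hw1 : ∀ᵐ x ∂μ, ∀ n, MemLp (fun y => weight y * ‖u n (τ y x) - v (τ y x)‖) 2
      (volume : Measure (E d)) :=
    ae_all_iff.2 fun n => h.ae_memLp_weight (f := fun x => u n x - v x)
      ((Lp.memLp (u n)).sub (Lp.memLp v))
  have hw2 : ∀ᵐ x ∂μ, ∀ n, MemLp (fun y => weight y * ‖G n (τ y x) - H (τ y x)‖) 2
      (volume : Measure (E d)) :=
    ae_all_iff.2 fun n => h.ae_memLp_weight (f := fun x => G n x - H x)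
      ((Lp.memLp (G n)).sub (Lp.memLp H))
  filter_upwards [h1, h2, ae_all_iff.2 hp, hw1, hw2, h.ae_isL2Loc (Lp.memLp v),
    h.ae_isL2Loc (Lp.memLp H)] with x h1 h2 hp' hw1 hw2 hl1 hl2
  exact HasWeakGrad.of_tendsto (fun n => hp' (ns (ms n))) hl1.locallyIntegrable
    hl2.locallyIntegrable (fun n => hw1 _) (fun n => hw2 _) (h1.comp hms.tendsto_atTop) h2

theorem isClosed_sobolev {d : ℕ} {X : Type*} [MeasurableSpace X] {τ : E d → X → X} {μ : Measure X}
    [SFinite μ] (h : IsFlow τ μ) :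
    IsClosed (sobolev h : Set (WithLp 2 (Lp (E d) 2 μ × Lp (M d) 2 μ))) := by
  rw [← isSeqClosed_iff_isClosed]
  intro p q hp hpq
  rw [SetLike.mem_coe, mem_sobolev]
  exact h.ae_hasWeakGrad_of_tendsto (fun n => mem_sobolev.1 (hp n))
    (((WithLp.fstL 2 ℝ (Lp (E d) 2 μ) (Lp (M d) 2 μ)).continuous.tendsto q).comp hpq)
    (((WithLp.sndL 2 ℝ (Lp (E d) 2 μ) (Lp (M d) 2 μ)).continuous.tendsto q).comp hpq)

/-! ## Unitary representations of `ℝ^d` and Korn's inequality -/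

section Representation

variable {d : ℕ} {H : Type*} [NormedAddCommGroup H] [InnerProductSpace ℝ H]

/-- A unitary representation of `ℝ^d` with measurable coefficients. -/
structure IsUnitaryRep (U : E d → H →L[ℝ] H) : Prop where
  zero : ∀ f, U 0 f = f
  add : ∀ y z f, U (y + z) f = U y (U z f)
  inner_map : ∀ y f g, ⟪U y f, U y g⟫ = ⟪f, g⟫
  aestronglyMeasurable : ∀ f g, AEStronglyMeasurable (fun y => ⟪U y f, g⟫) volume

namespace IsUnitaryRep

variable {U : E d → H →L[ℝ] H}

theorem neg_apply (h : IsUnitaryRep U) (y : E d) (f : H) : U y (U (-y) f) = f := by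
  rw [← h.add, add_neg_cancel, h.zero]

theorem inner_left (h : IsUnitaryRep U) (y : E d) (f g : H) : ⟪U y f, g⟫ = ⟪f, U (-y) g⟫ := by
  rw [← h.inner_map y f, h.neg_apply]

theorem norm_map (h : IsUnitaryRep U) (y : E d) (f : H) : ‖U y f‖ = ‖f‖ := by
  rw [norm_eq_sqrt_real_inner, h.inner_map, ← norm_eq_sqrt_real_inner]

theorem abs_inner_le (h : IsUnitaryRep U) (y : E d) (f g : H) : |⟪U y f, g⟫| ≤ ‖f‖ * ‖g‖ := by
  rw [← h.norm_map y f]; exact abs_real_inner_le_norm _ _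

theorem locallyIntegrable (h : IsUnitaryRep U) (f g : H) :
    LocallyIntegrable fun y => ⟪U y f, g⟫ := by
  refine (locallyIntegrable_const (μ := (volume : Measure (E d))) (‖f‖ * ‖g‖)).mono
    (h.aestronglyMeasurable f g) (Eventually.of_forall fun y => ?_)
  rw [Real.norm_eq_abs, Real.norm_of_nonneg (by positivity)]
  exact h.abs_inner_le y f g

theorem integrable_mul (h : IsUnitaryRep U) {φ : E d → ℝ} (hφ : Continuous φ)
    (hc : HasCompactSupport φ) (f g : H) : Integrable fun y => φ y * ⟪U y f, g⟫ := by
  have := integrable_mul_of_locallyIntegrable (h.locallyIntegrable f g) hφ hc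
  simpa only [mul_comm] using this

variable [CompleteSpace H]

/-- The average of `φ(y) U_y f` is defined weakly, by the Riesz theorem, because only the
coefficients of the representation are assumed measurable. -/
theorem exists_average (h : IsUnitaryRep U) {φ : E d → ℝ} (hφ : Continuous φ)
    (hc : HasCompactSupport φ) (f : H) : ∃ k : H, ∀ g, ⟪k, g⟫ = ∫ y, φ y * ⟪U y f, g⟫ := by
  let L : H →ₗ[ℝ] ℝ :=
    { toFun := fun g => ∫ y, φ y * ⟪U y f, g⟫
      map_add' := fun g g' => by
        rw [← integral_add (h.integrable_mul hφ hc f g) (h.integrable_mul hφ hc f g')]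
        simp only [inner_add_right, mul_add]
      map_smul' := fun c g => by
        simp only [inner_smul_right, RingHom.id_apply, smul_eq_mul]
        rw [← integral_const_mul]
        congr 1; ext y; ring }
  have hL : ∀ g, ‖L g‖ ≤ ((∫ y, |φ y|) * ‖f‖) * ‖g‖ := by
    intro g
    rw [mul_assoc, ← integral_mul_const]
    refine norm_integral_le_of_norm_le ?_ (Eventually.of_forall fun y => ?_)
    · exact (hφ.integrable_of_hasCompactSupport hc).abs.mul_const _
    · rw [norm_mul, Real.norm_eq_abs, Real.norm_eq_abs]
      exact mul_le_mul_of_nonneg_left (h.abs_inner_le y f g) (abs_nonneg _)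
  refine ⟨(InnerProductSpace.toDual ℝ H).symm (L.mkContinuous _ hL), fun g => ?_⟩
  rw [InnerProductSpace.toDual_symm_apply]
  rfl

/-- On a separable space, measurable unitary representations are weakly continuous. -/
theorem continuous_inner [TopologicalSpace.SeparableSpace H] (h : IsUnitaryRep U) (f g : H) :
    Continuous fun y => ⟪U y f, g⟫ := by
  let S : Submodule ℝ H :=
    { carrier := {f | ∀ g, Continuous fun y => ⟪U y f, g⟫}
      add_mem' := fun ha hb g => by
        simp only [map_add, inner_add_left]; exact (ha g).add (hb g)
      zero_mem' := fun g => by simp only [map_zero, inner_zero_left]; exact continuous_const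
      smul_mem' := fun c a ha g => by
        simp only [map_smul, inner_smul_left]; exact (ha g).const_mul _ }
  have hclosed : IsClosed (S : Set H) := by
    rw [← isSeqClosed_iff_isClosed]
    intro a b ha hab g
    have hu : TendstoUniformly (fun n y => ⟪U y (a n), g⟫) (fun y => ⟪U y b, g⟫) atTop := by
      rw [Metric.tendstoUniformly_iff]
      intro ε hε
      have h1 : Tendsto (fun n => ‖b - a n‖ * ‖g‖) atTop (𝓝 0) := by
        have := (tendsto_iff_norm_sub_tendsto_zero.1 hab).mul_const ‖g‖
        simpa [norm_sub_rev] using this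
      filter_upwards [(tendsto_order.1 h1).2 ε hε] with n hn y
      rw [Real.dist_eq, ← inner_sub_left, ← map_sub]
      exact (h.abs_inner_le y _ _).trans_lt hn
    exact hu.continuous (Frequently.of_forall fun n => ha n g)
  -- Averages have continuous coefficients: these are convolutions of a locally integrable
  -- coefficient with the continuous reflected `φ`.
  have havg : ∀ {φ : E d → ℝ}, Continuous φ → HasCompactSupport φ → ∀ (f k : H),
      (∀ g, ⟪k, g⟫ = ∫ y, φ y * ⟪U y f, g⟫) → k ∈ S := by
    intro φ hφ hc f k hk g
    have h1 : (fun z => ⟪U z k, g⟫) = convolution (fun y => ⟪U y f, g⟫) (fun y => φ (-y))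
        (ContinuousLinearMap.mul ℝ ℝ) volume := by
      ext z
      rw [h.inner_left, hk, convolution_def, ← integral_sub_right_eq_self _ z]
      congr 1; ext y
      rw [← h.inner_left, ← h.add, ContinuousLinearMap.mul_apply', mul_comm, neg_sub]
      rw [add_sub_cancel]
    rw [h1]
    exact HasCompactSupport.continuous_convolution_right _
      (hc.comp_homeomorph (Homeomorph.neg (E d))) (h.locallyIntegrable f g) (hφ.comp continuous_neg)
  have htop : S = ⊤ := by
    have hS : S.topologicalClosure = S := hclosed.submodule_topologicalClosure_eq
    rw [← hS, Submodule.topologicalClosure_eq_top_iff, Submodule.eq_bot_iff]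
    intro g hg
    -- It remains to see that averages span a dense subspace. If `g` is orthogonal to all of them,
    -- each coefficient `⟪U_y f, g⟫` vanishes for almost every `y`. By separability a single `y`
    -- works for all `f`, and `U_y` is onto, so `g = 0`.
    have h1 : ∀ f, ∀ᵐ y : E d, ⟪U y f, g⟫ = 0 := fun f =>
      ae_eq_zero_of_integral_contDiff_smul_eq_zero (h.locallyIntegrable f g) fun φ hφ hc => by
        obtain ⟨k, hk⟩ := h.exists_average hφ.continuous hc f
        simp only [smul_eq_mul]
        rw [← hk g]
        exact hg k (havg hφ.continuous hc f k hk)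
    obtain ⟨D, hD, hDd⟩ := TopologicalSpace.exists_countable_dense H
    obtain ⟨y, hy⟩ := ((ae_ball_iff hD).2 fun f _ => h1 f).exists
    have h2 : ∀ f, ⟪U y f, g⟫ = 0 := by
      have hc1 : Continuous fun f => ⟪U y f, g⟫ := by fun_prop
      have := hc1.ext_on hDd continuous_const (fun f hf => hy f hf)
      exact fun f => congrFun this f
    have h3 := h2 (U (-y) g)
    rwa [h.neg_apply, inner_self_eq_zero] at h3
  have hf : f ∈ S := htop ▸ Submodule.mem_top
  exact hf g

variable (U) in
/-- `f'` is the weak derivative of `f` in the direction `v`. -/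
def HasWeakDeriv (v : E d) (f f' : H) : Prop :=
  ∀ φ : E d → ℝ, ContDiff ℝ (⊤ : ℕ∞) φ → HasCompactSupport φ → ∀ h : H,
    ∫ y, fderiv ℝ φ y v * ⟪U y f, h⟫ = -∫ y, φ y * ⟪U y f', h⟫

-- Both derivatives are moved onto the test function. The reflection `φ(-y)` appears because the
-- adjoint of `U_y` is `U_{-y}`, which exchanges the two slots between the integrations by parts. In
-- the result `v` and `w` occur only in a mixed second derivative of a smooth function.
omit [CompleteSpace H] in
theorem integral_mul_inner_deriv (h : IsUnitaryRep U) {v w : E d} {f f' g g' : H}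
    (hf : HasWeakDeriv U v f f') (hg : HasWeakDeriv U w g g') {φ : E d → ℝ}
    (hφ : ContDiff ℝ (⊤ : ℕ∞) φ) (hc : HasCompactSupport φ) :
    ∫ y, φ y * ⟪U y f', g'⟫ =
      -∫ y, fderiv ℝ (fun y => fderiv ℝ (fun z => φ (-z)) y v) y w * ⟪U y g, f⟫ := by
  have hφ' : ContDiff ℝ (⊤ : ℕ∞) fun z => φ (-z) := hφ.comp contDiff_neg
  have hc' : HasCompactSupport fun z => φ (-z) := hc.comp_homeomorph (Homeomorph.neg (E d))
  have h1 := hf φ hφ hc g'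
  have h2 := hg (fun y => fderiv ℝ (fun z => φ (-z)) y v) (contDiff_fderiv_apply hφ' v)
    (hc'.fderiv_apply (𝕜 := ℝ) v) f
  have h1' : ∫ y, φ y * ⟪U y f', g'⟫ = -∫ y, fderiv ℝ φ y v * ⟪U y f, g'⟫ := by linarith
  rw [h2, neg_neg, h1', ← integral_neg_eq_self, ← integral_neg]
  congr 1; ext y
  have h3 : fderiv ℝ (fun z => φ (-z)) y v = -fderiv ℝ φ (-y) v := by
    have h4 := ((hφ.differentiable (by simp)) (-y)).hasFDerivAt.comp y (hasFDerivAt_id y).neg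
    rw [HasFDerivAt.fderiv (f := fun z => φ (-z)) h4]
    simp
  rw [h3, neg_mul, h.inner_left, neg_neg, real_inner_comm]

/-- Mixed weak derivatives commute: `⟪∂_v f, ∂_w g⟫ = ⟪∂_w f, ∂_v g⟫`. -/
theorem inner_deriv_comm [TopologicalSpace.SeparableSpace H] (h : IsUnitaryRep U) {v w : E d}
    {f g fv fw gv gw : H} (hfv : HasWeakDeriv U v f fv) (hfw : HasWeakDeriv U w f fw)
    (hgv : HasWeakDeriv U v g gv) (hgw : HasWeakDeriv U w g gw) : ⟪fv, gw⟫ = ⟪fw, gv⟫ := by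
  have hcont : Continuous fun y => ⟪U y fv, gw⟫ - ⟪U y fw, gv⟫ :=
    (h.continuous_inner fv gw).sub (h.continuous_inner fw gv)
  have h0 : ∀ᵐ y : E d, ⟪U y fv, gw⟫ - ⟪U y fw, gv⟫ = 0 := by
    refine ae_eq_zero_of_integral_contDiff_smul_eq_zero
      ((h.locallyIntegrable fv gw).sub (h.locallyIntegrable fw gv)) fun φ hφ hc => ?_
    simp only [smul_eq_mul, mul_sub]
    rw [integral_sub (h.integrable_mul hφ.continuous hc _ _)
      (h.integrable_mul hφ.continuous hc _ _), h.integral_mul_inner_deriv hfv hgw hφ hc,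
      h.integral_mul_inner_deriv hfw hgv hφ hc, sub_eq_zero]
    congr 2; ext y
    congr 1
    have hφ' : ContDiff ℝ (⊤ : ℕ∞) fun z => φ (-z) := hφ.comp contDiff_neg
    have hd : ∀ a b : E d, fderiv ℝ (fun y => fderiv ℝ (fun z => φ (-z)) y a) y b =
        fderiv ℝ (fderiv ℝ fun z => φ (-z)) y b a := by
      intro a b
      have : DifferentiableAt ℝ (fderiv ℝ fun z => φ (-z)) y :=
        ((hφ'.fderiv_right (m := (⊤ : ℕ∞)) (by simp)).differentiable (by simp)) y
      rw [fderiv_clm_apply this (differentiableAt_const a)]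
      simp
    rw [hd, hd]
    exact (hφ'.contDiffAt.isSymmSndFDerivAt (by
      rw [minSmoothness_of_isRCLikeNormedField]; exact WithTop.coe_le_coe.2 (le_top : (2 : ℕ∞) ≤ ⊤))).eq _ _
  -- The identity is known for almost every `y`; weak continuity allows evaluation at `y = 0`, where
  -- `U_0` is the identity.
  have h1 := (hcont.ae_eq_iff_eq volume continuous_const).1 h0
  have h2 := congrFun h1 0
  simp only [h.zero] at h2
  linarith

end IsUnitaryRep

end Representation

/-! ### The symmetric part of a matrix -/

section Korn

variable {d : ℕ}

/-- The symmetric part of a matrix. -/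
noncomputable def symPart (ξ : M d) : M d := WithLp.toLp 2 fun p => (ξ (p.1, p.2) + ξ (p.2, p.1)) / 2

@[simp] theorem symPart_apply (ξ : M d) (p : Fin d × Fin d) :
    symPart ξ p = (ξ (p.1, p.2) + ξ (p.2, p.1)) / 2 := rfl

theorem norm_sq_matrix (ξ : M d) : ‖ξ‖ ^ 2 = ∑ i, ∑ j, ξ (i, j) ^ 2 := by
  rw [EuclideanSpace.norm_sq_eq, Fintype.sum_prod_type]
  simp

/-- For a gradient the cross term integrates to the squared norm of the divergence; this is how
Korn's inequality obtains the constant 2. -/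
theorem two_mul_norm_sq_symPart (ξ : M d) :
    2 * ‖symPart ξ‖ ^ 2 = ‖ξ‖ ^ 2 + ∑ i, ∑ j, ξ (i, j) * ξ (j, i) := by
  have h1 : ∑ i, ∑ j, ξ (j, i) ^ 2 = ∑ i, ∑ j, ξ (i, j) ^ 2 := Finset.sum_comm
  rw [norm_sq_matrix, norm_sq_matrix]
  have h2 : ∀ i j, symPart ξ (i, j) ^ 2 =
      (ξ (i, j) ^ 2 + ξ (j, i) ^ 2 + 2 * (ξ (i, j) * ξ (j, i))) / 4 := by
    intro i j; rw [symPart_apply]; ring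
  simp only [h2, ← Finset.sum_div, Finset.sum_add_distrib, ← Finset.mul_sum, h1]
  ring

theorem norm_symPart_le (ξ : M d) : ‖symPart ξ‖ ≤ ‖ξ‖ := by
  have h1 := two_mul_norm_sq_symPart ξ
  have h2 : ∑ i, ∑ j, ξ (i, j) * ξ (j, i) ≤ ‖ξ‖ ^ 2 := by
    have h3 : ∑ i, ∑ j, ξ (j, i) ^ 2 = ∑ i, ∑ j, ξ (i, j) ^ 2 := Finset.sum_comm
    have h4 : ∑ i, ∑ j, ξ (i, j) * ξ (j, i) ≤ ∑ i, ∑ j, (ξ (i, j) ^ 2 + ξ (j, i) ^ 2) / 2 :=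
      Finset.sum_le_sum fun i _ => Finset.sum_le_sum fun j _ => by
        nlinarith [sq_nonneg (ξ (i, j) - ξ (j, i))]
    simp only [← Finset.sum_div, Finset.sum_add_distrib, h3] at h4
    rw [norm_sq_matrix]; linarith
  exact le_of_sq_le_sq (by linarith) (norm_nonneg _)

end Korn

namespace IsFlow

variable {d : ℕ} {X : Type*} [MeasurableSpace X] {τ : E d → X → X} {μ : Measure X} [SFinite μ]

/-- The action on square integrable functions. -/
noncomputable def shift (h : IsFlow τ μ) (y : E d) : Lp ℝ 2 μ →L[ℝ] Lp ℝ 2 μ :=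
  (Lp.compMeasurePreservingₗᵢ ℝ (τ y) (h.measurePreserving y)).toContinuousLinearMap

omit [SFinite μ] in
theorem coeFn_shift (h : IsFlow τ μ) (y : E d) (f : Lp ℝ 2 μ) :
    h.shift y f =ᵐ[μ] fun x => f (τ y x) :=
  Lp.coeFn_compMeasurePreserving f (h.measurePreserving y)

omit [SFinite μ] in
theorem inner_shift (h : IsFlow τ μ) (y : E d) (f g : Lp ℝ 2 μ) :
    ⟪h.shift y f, g⟫ = ∫ x, f (τ y x) * g x ∂μ := by
  rw [L2.inner_def]
  refine integral_congr_ae ?_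
  filter_upwards [h.coeFn_shift y f] with x hx
  rw [hx]; simp [mul_comm]

theorem isUnitaryRep_shift (h : IsFlow τ μ) : IsUnitaryRep h.shift where
  zero f := by
    refine Lp.ext ?_
    filter_upwards [h.coeFn_shift 0 f] with x hx
    rw [hx, h.zero]
  add y z f := by
    refine Lp.ext ?_
    filter_upwards [h.coeFn_shift (y + z) f, h.coeFn_shift y (h.shift z f),
      (h.measurePreserving y).quasiMeasurePreserving.ae (h.coeFn_shift z f)] with x h1 h2 h3
    rw [h1, h2, h3, add_comm y z, h.add]
  inner_map y f g :=
    (Lp.compMeasurePreservingₗᵢ ℝ (τ y) (h.measurePreserving y)).inner_map_map f g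
  aestronglyMeasurable f g := by
    simp only [h.inner_shift]
    have : AEStronglyMeasurable (fun p : E d × X => f (τ p.1 p.2) * g p.2) (volume.prod μ) :=
      (h.aestronglyMeasurable_orbit (Lp.aestronglyMeasurable f)).mul
        (Lp.aestronglyMeasurable g).comp_snd
    exact this.integral_prod_right'

/-- The bridge between the representation on `L²` and the orbits: averaging a coefficient in `y` is
the same as averaging along each orbit and then integrating against `g`. -/
theorem integral_mul_inner_shift (h : IsFlow τ μ) {φ : E d → ℝ} (hφ : Integrable φ)
    (f g : Lp ℝ 2 μ) :
    ∫ y, φ y * ⟪h.shift y f, g⟫ = ∫ x, (∫ y, f (τ y x) * φ y) * g x ∂μ := by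
  have hint : Integrable (fun p : E d × X => φ p.1 * (f (τ p.1 p.2) * g p.2)) (volume.prod μ) := by
    have h1 := h.integrable_orbit (f := fun x => f x ^ 2) hφ.abs (Lp.memLp f).integrable_sq
    have h2 := hφ.abs.mul_prod (Lp.memLp g).integrable_sq
    refine (h1.add h2).mono ?_ (Eventually.of_forall fun p => ?_)
    · exact hφ.1.comp_fst.mul ((h.aestronglyMeasurable_orbit (Lp.aestronglyMeasurable f)).mul
        (Lp.aestronglyMeasurable g).comp_snd)
    · simp only [Pi.add_apply]
      rw [← mul_add, norm_mul, norm_mul, norm_mul, Real.norm_eq_abs |φ p.1|, abs_abs,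
        Real.norm_eq_abs (φ p.1)]
      refine mul_le_mul_of_nonneg_left ?_ (abs_nonneg _)
      have h3 : ‖f (τ p.1 p.2) ^ 2 + g p.2 ^ 2‖ = f (τ p.1 p.2) ^ 2 + g p.2 ^ 2 :=
        Real.norm_of_nonneg (by positivity)
      rw [h3, Real.norm_eq_abs, Real.norm_eq_abs]
      nlinarith [sq_abs (f (τ p.1 p.2)), sq_abs (g p.2), abs_nonneg (f (τ p.1 p.2)),
        abs_nonneg (g p.2), sq_nonneg (|f (τ p.1 p.2)| - |g p.2|)]
  simp only [h.inner_shift, ← integral_const_mul]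
  rw [integral_integral_swap hint]
  refine integral_congr_ae (Eventually.of_forall fun x => ?_)
  simp only [← integral_mul_const]
  refine integral_congr_ae (Eventually.of_forall fun y => ?_)
  simp only; ring

/-- A coordinate of a square integrable vector field. -/
noncomputable def coordLp {ι : Type*} [Fintype ι] (i : ι) (f : Lp (EuclideanSpace ℝ ι) 2 μ) :
    Lp ℝ 2 μ := (EuclideanSpace.proj (𝕜 := ℝ) i).compLp f

omit [SFinite μ] in
theorem coeFn_coordLp {ι : Type*} [Fintype ι] (i : ι) (f : Lp (EuclideanSpace ℝ ι) 2 μ) :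
    coordLp i f =ᵐ[μ] fun x => f x i :=
  ContinuousLinearMap.coeFn_compLp _ f

theorem hasWeakDeriv_coordLp (h : IsFlow τ μ) {p : WithLp 2 (Lp (E d) 2 μ × Lp (M d) 2 μ)}
    (hp : p ∈ sobolev h) (i j : Fin d) :
    IsUnitaryRep.HasWeakDeriv h.shift (e i) (coordLp j p.fst) (coordLp (i, j) p.snd) := by
  intro φ hφ hc g
  rw [h.integral_mul_inner_shift (hφ.continuous.integrable_of_hasCompactSupport hc),
    h.integral_mul_inner_shift ((continuous_fderiv_apply hφ _).integrable_of_hasCompactSupport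
      (hc.fderiv_apply (𝕜 := ℝ) _)), ← integral_neg]
  refine integral_congr_ae ?_
  filter_upwards [mem_sobolev.1 hp, h.ae_orbit (coeFn_coordLp j p.fst),
    h.ae_orbit (coeFn_coordLp (i, j) p.snd)] with x h1 h2 h3
  have e1 : ∫ y, coordLp j p.fst (τ y x) * fderiv ℝ φ y (e i) =
      ∫ y, p.fst (τ y x) j * fderiv ℝ φ y (e i) :=
    integral_congr_ae (by filter_upwards [h2] with y hy; rw [hy])
  have e2 : ∫ y, coordLp (i, j) p.snd (τ y x) * φ y = ∫ y, p.snd (τ y x) (i, j) * φ y :=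
    integral_congr_ae (by filter_upwards [h3] with y hy; rw [hy])
  rw [e1, e2, h1.2.2 φ hφ hc i j, neg_mul]

variable [IsSeparable μ]

/-- Korn's inequality. -/
theorem korn (h : IsFlow τ μ) {p : WithLp 2 (Lp (E d) 2 μ × Lp (M d) 2 μ)} (hp : p ∈ sobolev h) :
    ∫ x, ‖p.snd x‖ ^ 2 ∂μ ≤ 2 * ∫ x, ‖symPart (p.snd x)‖ ^ 2 ∂μ := by
  have hc : ∀ i j, Integrable (fun x => p.snd x (i, j) * p.snd x (j, i)) μ := fun i j =>
    (((EuclideanSpace.proj (𝕜 := ℝ) (i, j)).comp_memLp' (Lp.memLp p.snd)).integrable_mul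
      ((EuclideanSpace.proj (𝕜 := ℝ) (j, i)).comp_memLp' (Lp.memLp p.snd)))
  have hi : ∀ q r, ⟪coordLp q p.snd, coordLp r p.snd⟫ = ∫ x, p.snd x q * p.snd x r ∂μ := by
    intro q r
    rw [L2.inner_def]
    refine integral_congr_ae ?_
    filter_upwards [coeFn_coordLp q p.snd, coeFn_coordLp r p.snd] with x h1 h2
    rw [h1, h2]; simp [mul_comm]
  have : Fact ((2 : ENNReal) ≠ ⊤) := ⟨by norm_num⟩
  -- Commuting the weak derivatives, `⟪∂_i u_j, ∂_j u_i⟫ = ⟪∂_i u_i, ∂_j u_j⟫`, so the sum over `i,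
  -- j` is the squared norm of the divergence.
  have hsum : 0 ≤ ∫ x, ∑ i, ∑ j, p.snd x (i, j) * p.snd x (j, i) ∂μ := by
    rw [integral_finsetSum _ fun i _ => integrable_finsetSum _ fun j _ => hc i j]
    simp only [integral_finsetSum _ fun j _ => hc _ j]
    have : ∀ i j, ∫ x, p.snd x (i, j) * p.snd x (j, i) ∂μ =
        ⟪coordLp (i, i) p.snd, coordLp (j, j) p.snd⟫ := by
      intro i j
      rw [← hi, h.isUnitaryRep_shift.inner_deriv_comm (h.hasWeakDeriv_coordLp hp i j)
        (h.hasWeakDeriv_coordLp hp j j) (h.hasWeakDeriv_coordLp hp i i)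
        (h.hasWeakDeriv_coordLp hp j i), real_inner_comm]
    simp only [this, ← inner_sum, ← sum_inner]
    exact real_inner_self_nonneg
  have hG : Integrable (fun x => ‖p.snd x‖ ^ 2) μ :=
    (Lp.memLp p.snd).integrable_norm_pow (by norm_num)
  rw [← integral_const_mul]
  simp only [two_mul_norm_sq_symPart]
  rw [integral_add hG (integrable_finsetSum _ fun i _ => integrable_finsetSum _ fun j _ => hc i j)]
  linarith

end IsFlow

/-! ## Operators associated with closed forms -/

section Spectrum

variable {H : Type*} [NormedAddCommGroup H] [InnerProductSpace ℝ H]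

/-- A nonnegative self-adjoint operator, given by its graph. -/
structure IsPosSelfAdjoint (A : Set (H × H)) : Prop where
  symm : ∀ p ∈ A, ∀ q ∈ A, ⟪p.2, q.1⟫ = ⟪p.1, q.2⟫
  nonneg : ∀ p ∈ A, 0 ≤ ⟪p.2, p.1⟫
  neg_one_mem : -1 ∈ resolventSet A

namespace IsPosSelfAdjoint

variable {A : Set (H × H)} {l : ℝ}

theorem _root_.HighContrast.exists_bound_of_mem_resolventSet (hl : l ∈ resolventSet A) :
    ∃ C, 0 ≤ C ∧ ∀ p ∈ A, ‖p.1‖ ≤ C * ‖p.2 - l • p.1‖ := by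
  obtain ⟨R, hR⟩ := hl
  refine ⟨‖R‖, norm_nonneg _, fun p hp => ?_⟩
  have h1 : p.1 = R (p.2 - l • p.1) := (hR _ _).1 (by rwa [sub_add_cancel])
  calc ‖p.1‖ = ‖R (p.2 - l • p.1)‖ := by rw [← h1]
    _ ≤ _ := R.le_opNorm _

/-- With `S = (A + 1)⁻¹` one has `(A - l) S = 1 - (l + 1) S =: T'`, a bounded symmetric operator,
which inherits the lower bound. A symmetric operator bounded below is bijective, and `S T'⁻¹` is the
resolvent at `l`. -/
theorem mem_resolventSet_of_bound [CompleteSpace H] (hA : IsPosSelfAdjoint A) {C : ℝ}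
    (hC : ∀ p ∈ A, ‖p.1‖ ≤ C * ‖p.2 - l • p.1‖) : l ∈ resolventSet A := by
  obtain ⟨S, hS⟩ := hA.neg_one_mem
  have hmem : ∀ f, (S f, f - S f) ∈ A := fun f => by
    have := (hS (S f) f).2 rfl
    rwa [neg_one_smul, ← sub_eq_add_neg] at this
  have hsymm : ∀ f g, ⟪S f, g⟫ = ⟪f, S g⟫ := by
    intro f g
    have := hA.symm _ (hmem f) _ (hmem g)
    simp only [inner_sub_left, inner_sub_right] at this
    linarith
  set T' : H →L[ℝ] H := ContinuousLinearMap.id ℝ H - (l + 1) • S with hT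
  have hTa : ∀ f, T' f = f - (l + 1) • S f := fun f => rfl
  have hTs : ∀ f g, ⟪T' f, g⟫ = ⟪f, T' g⟫ := by
    intro f g
    simp only [hTa, inner_sub_left, inner_sub_right, inner_smul_left, inner_smul_right, hsymm]
    simp
  set C' : ℝ := 1 + |l + 1| * |C| with hC'
  have hC'0 : 0 < C' := by positivity
  have hbd : ∀ f, ‖f‖ ≤ C' * ‖T' f‖ := by
    intro f
    have h1 := hC _ (hmem f)
    have h2 : f - S f - l • S f = T' f := by rw [hTa]; module
    simp only [h2] at h1
    have h3 : f = T' f + (l + 1) • S f := by rw [hTa]; abel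
    calc ‖f‖ = ‖T' f + (l + 1) • S f‖ := by rw [← h3]
      _ ≤ ‖T' f‖ + |l + 1| * ‖S f‖ := by
          refine (norm_add_le _ _).trans ?_
          rw [norm_smul, Real.norm_eq_abs]
      _ ≤ ‖T' f‖ + |l + 1| * (|C| * ‖T' f‖) := by
          gcongr
          exact h1.trans (mul_le_mul_of_nonneg_right (le_abs_self C) (norm_nonneg _))
      _ = C' * ‖T' f‖ := by rw [hC']; ring
  -- Surjectivity by Lax–Milgram: the form `⟪T' f, T' g⟫` is coercive, and solving it for `⟪h, g⟫`
  -- gives `T' (T' f) = h` by symmetry.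
  let B : H →L[ℝ] H →L[ℝ] ℝ := (innerSL ℝ).bilinearComp T' T'
  have hBa : ∀ f g, B f g = ⟪T' f, T' g⟫ := fun f g => rfl
  have hB : IsCoercive B := by
    refine ⟨(C' ^ 2)⁻¹, by positivity, fun f => ?_⟩
    rw [hBa, real_inner_self_eq_norm_sq, inv_mul_eq_div, div_mul_eq_mul_div, div_le_iff₀ (by positivity)]
    nlinarith [hbd f, norm_nonneg f, norm_nonneg (T' f)]
  have hinj : Function.Injective T' := by
    rw [injective_iff_map_eq_zero]
    intro f hf
    have := hbd f
    rw [hf, norm_zero, mul_zero] at this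
    exact norm_le_zero_iff.1 this
  have hsurj : Function.Surjective T' := by
    intro h
    refine ⟨T' (hB.continuousLinearEquivOfBilin.symm h), ?_⟩
    refine ext_inner_right ℝ fun g => ?_
    rw [hTs, ← hBa, ← hB.continuousLinearEquivOfBilin_apply,
      ContinuousLinearEquiv.apply_symm_apply]
  let e' := ContinuousLinearEquiv.ofBijective T' (LinearMap.ker_eq_bot.2 hinj)
    (LinearMap.range_eq_top.2 hsurj)
  have he : ∀ f, T' (e'.symm f) = f := fun f => e'.apply_symm_apply f
  refine ⟨S ∘L (e'.symm : H →L[ℝ] H), fun x f => ?_⟩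
  have h1 : f + l • x = (f + (l + 1) • x) + (-1 : ℝ) • x := by module
  rw [h1, hS]
  constructor
  · intro h
    have h2 : T' (f + (l + 1) • x) = f := by rw [hTa, ← h]; abel
    have h3 : e'.symm f = f + (l + 1) • x := hinj (by rw [he, h2])
    change x = S (e'.symm f)
    rw [h3]; exact h
  · intro h
    change x = S (e'.symm f) at h
    have h2 : e'.symm f = f + (l + 1) • x := by
      have := he f
      rw [hTa, ← h] at this
      exact sub_eq_iff_eq_add.1 this
    rw [← h2]; exact h

theorem mem_resolventSet_of_neg [CompleteSpace H] (hA : IsPosSelfAdjoint A) (hl : l < 0) :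
    l ∈ resolventSet A := by
  refine hA.mem_resolventSet_of_bound (C := (-l)⁻¹) fun p hp => ?_
  have h1 := hA.nonneg p hp
  have h2 : ⟪p.2 - l • p.1, p.1⟫ ≤ ‖p.2 - l • p.1‖ * ‖p.1‖ := real_inner_le_norm _ _
  rw [inner_sub_left, inner_smul_left, real_inner_self_eq_norm_sq] at h2
  simp only [conj_trivial] at h2
  rw [inv_mul_eq_div, le_div_iff₀ (by linarith)]
  rcases (norm_nonneg p.1).eq_or_lt with h0 | h0
  · rw [← h0, zero_mul]; exact norm_nonneg _
  · refine le_of_mul_le_mul_right ?_ h0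
    nlinarith

theorem isClosed_spec [CompleteSpace H] (hA : IsPosSelfAdjoint A) : IsClosed (spec A) := by
  rw [spec, isClosed_compl_iff, Metric.isOpen_iff]
  intro l hl
  obtain ⟨C, hC0, hC⟩ := exists_bound_of_mem_resolventSet hl
  -- The radius makes `C * |m - l| ≤ 1 / 2`, so the perturbation is absorbed into the left side at
  -- the cost of doubling `C`.
  refine ⟨(2 * (C + 1))⁻¹, by positivity, fun m hm => ?_⟩
  refine hA.mem_resolventSet_of_bound (C := 2 * C) fun p hp => ?_
  rw [Metric.mem_ball, Real.dist_eq] at hm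
  have h1 := hC p hp
  have h2 : ‖p.2 - l • p.1‖ ≤ ‖p.2 - m • p.1‖ + |m - l| * ‖p.1‖ := by
    rw [← Real.norm_eq_abs, ← norm_smul]
    refine le_trans (le_of_eq ?_) (norm_add_le _ _)
    congr 1; module
  have h3 : C * |m - l| ≤ 1 / 2 := by
    have h4 : |m - l| ≤ (2 * (C + 1))⁻¹ := hm.le
    calc C * |m - l| ≤ (C + 1) * (2 * (C + 1))⁻¹ := by gcongr; linarith
      _ = 1 / 2 := by field_simp
  have h5 : C * (|m - l| * ‖p.1‖) ≤ 1 / 2 * ‖p.1‖ := by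
    rw [← mul_assoc]; exact mul_le_mul_of_nonneg_right h3 (norm_nonneg _)
  nlinarith [mul_le_mul_of_nonneg_left h2 hC0]

end IsPosSelfAdjoint

end Spectrum

/-- A nonnegative symmetric form that is closed (its domain is parametrised by a Hilbert space `K`
on which the form plus the squared norm is coercive) gives rise to a self-adjoint operator. -/
theorem isPosSelfAdjoint_formOperator {X W K : Type*} [NormedAddCommGroup X]
    [InnerProductSpace ℝ X] [CompleteSpace X] [NormedAddCommGroup K] [InnerProductSpace ℝ K]
    [CompleteSpace K] {D : Submodule ℝ X} {V : Set W} {ι : W → X} {a : W → W → ℝ} (j : K → W)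
    (hj : range j = V) (I : K →L[ℝ] X) (hI : ∀ k, ι (j k) = I k) (hID : ∀ k, I k ∈ D)
    (B : K →L[ℝ] K →L[ℝ] ℝ) (hB : ∀ k k', a (j k) (j k') = B k k')
    (hsymm : ∀ k k', B k k' = B k' k) (hnonneg : ∀ k, 0 ≤ B k k) {c : ℝ} (hc : 0 < c)
    (hcoer : ∀ k, c * ‖k‖ ^ 2 ≤ B k k + ‖I k‖ ^ 2) :
    IsPosSelfAdjoint (formOperator D V ι a) := by
  subst hj
  have hrep : ∀ p ∈ formOperator D (range j) ι a, ∃ k, (p.1 : X) = I k ∧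
      ∀ k', B k k' = ⟪(p.2 : X), I k'⟫ := by
    rintro p ⟨_, ⟨k, rfl⟩, h1, h2⟩
    exact ⟨k, h1.trans (hI k), fun k' => by rw [← hB, h2 _ (mem_range_self k'), hI]⟩
  refine ⟨fun p hp q hq => ?_, fun p hp => ?_, ?_⟩
  · obtain ⟨k, h1, h2⟩ := hrep p hp
    obtain ⟨k', h1', h2'⟩ := hrep q hq
    rw [Submodule.coe_inner, Submodule.coe_inner, h1', ← h2, h1, real_inner_comm, ← h2', hsymm]
  · obtain ⟨k, h1, h2⟩ := hrep p hp
    rw [Submodule.coe_inner, h1, ← h2]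
    exact hnonneg k
  · let Q : K →L[ℝ] K →L[ℝ] ℝ := (innerSL ℝ).bilinearComp I I
    let B' : K →L[ℝ] K →L[ℝ] ℝ := B + Q
    have hB'a : ∀ k k', B' k k' = B k k' + ⟪I k, I k'⟫ := fun k k' => rfl
    have hB' : IsCoercive B' := by
      refine ⟨c, hc, fun k => ?_⟩
      rw [hB'a, real_inner_self_eq_norm_sq, mul_assoc, ← sq]
      exact hcoer k
    let F := hB'.continuousLinearEquivOfBilin
    have hF : ∀ k k', ⟪F k, k'⟫ = B' k k' := hB'.continuousLinearEquivOfBilin_apply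
    -- The form plus the inner product is coercive on `K`; with `F` its Riesz operator, `F⁻¹ I*`
    -- solves the weak form of `(A + 1) x = f`.
    let R₀ : D →L[ℝ] K := (F.symm : K →L[ℝ] K) ∘L (ContinuousLinearMap.adjoint I) ∘L D.subtypeL
    have hR₀ : ∀ (f : D) (k : K), k = R₀ f ↔ ∀ k', B' k k' = ⟪(f : X), I k'⟫ := by
      intro f k
      have h1 : k = R₀ f ↔ F k = ContinuousLinearMap.adjoint I (f : X) := by
        change k = F.symm _ ↔ _
        rw [ContinuousLinearEquiv.eq_symm_apply]; rfl
      rw [h1]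
      constructor
      · intro h k'
        rw [← hF, h, ContinuousLinearMap.adjoint_inner_left]
      · intro h
        refine ext_inner_right ℝ fun k' => ?_
        rw [hF, h, ContinuousLinearMap.adjoint_inner_left]
    refine ⟨(I ∘L R₀).codRestrict D fun f => hID _, fun x f => ?_⟩
    have hval : ∀ f : D, (((I ∘L R₀).codRestrict D fun f => hID _) f : X) = I (R₀ f) := fun f => rfl
    rw [Subtype.ext_iff, hval]
    constructor
    · intro hx
      obtain ⟨k, h1, h2⟩ := hrep _ hx
      have h3 : k = R₀ f := (hR₀ f k).2 fun k' => by
        rw [hB'a, h2, ← h1]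
        simp only [neg_smul, one_smul, Submodule.coe_add, Submodule.coe_neg, inner_add_left,
          inner_neg_left]
        ring
      rw [← h3]; exact h1
    · intro hx
      refine ⟨j (R₀ f), mem_range_self _, by rw [hI]; exact hx, ?_⟩
      rintro _ ⟨k', rfl⟩
      have h3 := (hR₀ f (R₀ f)).1 rfl k'
      rw [hB'a] at h3
      rw [hB, hI]
      simp only [neg_smul, one_smul, Submodule.coe_add, Submodule.coe_neg, inner_add_left,
        inner_neg_left, hx]
      linarith

/-! ## The actions of `ℝ^d` -/

section Actions

variable {d : ℕ} {𝒪 : ConfigFamily d} {P : Measure (Config 𝒪)}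

theorem isFlow_translation (d : ℕ) :
    IsFlow (fun y x : E d => x + y) (volume : Measure (E d)) where
  measurable := by fun_prop
  zero x := add_zero x
  add y z x := by abel
  measurePreserving y := measurePreserving_add_right volume y

theorem isFlow_T (h𝒪 : 𝒪.IsRegular) (hP : IsStationaryErgodic P) :
    IsFlow (T (𝒪 := 𝒪)) P where
  measurable := h𝒪.measurable_T
  zero := T_zero
  add := T_add
  measurePreserving y := by
    have hm : Measurable (T (𝒪 := 𝒪) y) := h𝒪.measurable_T.comp measurable_prodMk_left
    refine ⟨hm, Measure.ext fun F hF => ?_⟩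
    rw [Measure.map_apply hm hF, ← hP.invariant (-y) F hF]
    congr 1; ext ω
    constructor
    · intro h
      exact ⟨T y ω, h, by rw [← T_add, neg_add_cancel, T_zero]⟩
    · rintro ⟨ω', h, rfl⟩
      rw [mem_preimage, ← T_add, add_neg_cancel, T_zero]
      exact h

/-- The origin lies outside the inclusions with positive probability. -/
theorem measure_compl_originIn_ne_zero [IsProbabilityMeasure P] (h𝒪 : 𝒪.IsRegular)
    (h : IsFlow (T (𝒪 := 𝒪)) P) : P (originIn 𝒪)ᶜ ≠ 0 := by
  intro h0
  have h1 : ∀ᵐ ω ∂P, ω ∈ originIn 𝒪 := by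
    rw [ae_iff]; exact h0
  -- If the origin were almost surely inside, almost every point of some `ω` would be inside, so `ω`
  -- would be dense. A dense regular open set is all of `ℝ^d`, but the complement of `ω` is
  -- nonempty.
  obtain ⟨ω, hω⟩ := (h.ae_orbit h1).exists
  simp only [T_mem_originIn] at hω
  obtain ⟨ho, hr, x, hx⟩ := h𝒪 ω.1 ω.2
  have hd : Dense ω.1 := Measure.dense_of_ae hω
  rw [hd.closure_eq, interior_univ] at hr
  exact hx (hr ▸ mem_univ x)

end Actions

/-! ## Tensors -/

namespace Tensor

variable {d : ℕ} (C : Tensor d)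

/-- The linear map `ξ ↦ C ξ`. -/
noncomputable def op : M d →L[ℝ] M d :=
  LinearMap.toContinuousLinearMap
    { toFun := fun ξ => WithLp.toLp 2 fun p => ∑ μ, ∑ ν, C p.1 p.2 μ ν * ξ (μ, ν)
      map_add' := fun ξ η => by
        ext p; simp [mul_add, Finset.sum_add_distrib]
      map_smul' := fun c ξ => by
        ext p; simp only [PiLp.smul_apply, smul_eq_mul, RingHom.id_apply, Finset.mul_sum]
        refine Finset.sum_congr rfl fun μ _ => Finset.sum_congr rfl fun ν _ => by ring }

theorem op_apply (ξ : M d) (p : Fin d × Fin d) :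
    C.op ξ p = ∑ μ, ∑ ν, C p.1 p.2 μ ν * ξ (μ, ν) := rfl

theorem contract_eq (ξ η : M d) : C.contract ξ η = ⟪C.op ξ, η⟫ := by
  rw [PiLp.inner_apply, Fintype.sum_prod_type, contract]
  refine Finset.sum_congr rfl fun α _ => Finset.sum_congr rfl fun β _ => ?_
  simp [op_apply, Finset.mul_sum, mul_comm]

variable {C}

theorem contract_comm (hC : ∀ α β μ ν, C α β μ ν = C μ ν α β) (ξ η : M d) :
    C.contract ξ η = C.contract η ξ := by
  have h1 : ∀ ξ η, C.contract ξ η = ∑ p : Fin d × Fin d, ∑ q : Fin d × Fin d,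
      C p.1 p.2 q.1 q.2 * ξ q * η p := fun ξ η => by
    simp only [contract, Fintype.sum_prod_type]
  rw [h1, h1, Finset.sum_comm]
  refine Finset.sum_congr rfl fun q _ => Finset.sum_congr rfl fun p _ => ?_
  rw [hC p.1 p.2 q.1 q.2]; ring

theorem IsElastic.contract_comm (hC : C.IsElastic) (ξ η : M d) :
    C.contract ξ η = C.contract η ξ :=
  Tensor.contract_comm hC.major_symm ξ η

theorem IsElastic.contract_symPart_left (hC : C.IsElastic) (ξ η : M d) :
    C.contract (symPart ξ) η = C.contract ξ η := by
  rw [contract_eq, contract_eq]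
  congr 1
  ext p
  have h1 : ∑ μ, ∑ ν, C p.1 p.2 μ ν * ξ (ν, μ) = ∑ μ, ∑ ν, C p.1 p.2 μ ν * ξ (μ, ν) := by
    rw [Finset.sum_comm]
    refine Finset.sum_congr rfl fun μ _ => Finset.sum_congr rfl fun ν _ => ?_
    rw [hC.minor_symm]
  have h2 : ∀ μ ν, C p.1 p.2 μ ν * symPart ξ (μ, ν) =
      (C p.1 p.2 μ ν * ξ (μ, ν) + C p.1 p.2 μ ν * ξ (ν, μ)) / 2 := by
    intro μ ν; rw [symPart_apply]; ring
  simp only [op_apply, h2, ← Finset.sum_div, Finset.sum_add_distrib, h1]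
  ring

theorem IsElastic.exists_coercive (hC : C.IsElastic) :
    ∃ c : ℝ, 0 < c ∧ ∀ ξ : M d, c * ‖symPart ξ‖ ^ 2 ≤ C.contract ξ ξ := by
  obtain ⟨c, hc, h⟩ := hC.elliptic
  refine ⟨c, hc, fun ξ => ?_⟩
  have h1 := h (symPart ξ) fun α β => by simp only [symPart_apply]; ring
  rwa [hC.contract_symPart_left, hC.contract_comm, hC.contract_symPart_left] at h1

theorem IsElastic.contract_self_nonneg (hC : C.IsElastic) (ξ : M d) : 0 ≤ C.contract ξ ξ := by
  obtain ⟨c, hc, h⟩ := hC.exists_coercive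
  exact le_trans (by positivity) (h ξ)

/-- A square root of the quadratic form of a tensor. -/
theorem IsElastic.exists_sqrt (hC : C.IsElastic) :
    ∃ B : M d →L[ℝ] M d, ∀ ξ, C.contract ξ ξ = ‖B ξ‖ ^ 2 := by
  have hsymm : (C.op : M d →ₗ[ℝ] M d).IsSymmetric := fun ξ η => by
    have := hC.contract_comm ξ η
    rw [contract_eq, contract_eq, real_inner_comm ξ] at this
    exact this
  have hn : Module.finrank ℝ (M d) = Fintype.card (Fin d × Fin d) := finrank_euclideanSpace
  let b := hsymm.eigenvectorBasis hn
  have hb : ∀ i, C.op (b i) = hsymm.eigenvalues hn i • b i := fun i =>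
    hsymm.apply_eigenvectorBasis hn i
  have hpos : ∀ i, 0 ≤ hsymm.eigenvalues hn i := fun i => by
    have := hC.contract_self_nonneg (b i)
    rwa [contract_eq, hb, inner_smul_left, real_inner_self_eq_norm_sq, b.orthonormal.1 i, one_pow,
      mul_one] at this
  let B : M d →L[ℝ] M d :=
    ∑ i, (√(hsymm.eigenvalues hn i)) • (innerSL ℝ (b i)).smulRight (b i)
  have hB : ∀ ξ, B ξ = ∑ i, (√(hsymm.eigenvalues hn i) * ⟪b i, ξ⟫) • b i := fun ξ => by
    simp [B, smul_smul]
  refine ⟨B, fun ξ => ?_⟩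
  rw [contract_eq, ← b.sum_inner_mul_inner, ← real_inner_self_eq_norm_sq, hB,
    b.orthonormal.inner_sum]
  refine Finset.sum_congr rfl fun i _ => ?_
  have h1 : ⟪C.op ξ, b i⟫ = hsymm.eigenvalues hn i * ⟪b i, ξ⟫ := by
    have h2 : ⟪C.op ξ, b i⟫ = ⟪ξ, C.op (b i)⟫ := hsymm ξ (b i)
    rw [h2, hb, inner_smul_right, real_inner_comm]
  rw [h1, conj_trivial]
  linear_combination -⟪b i, ξ⟫ ^ 2 * Real.mul_self_sqrt (hpos i)

end Tensor

/-! ## The homogenised tensor -/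

/-- The infimum is the squared distance from `J z` to the subspace `J(V)`, hence the squared norm of
a projection; as `J(V)` need not be closed, the value is only approached. Being the square of a
linear map of `z`, it is a genuine quadratic form, which is what polarisation requires. -/
theorem iInf_norm_sq_eq {Z Y : Type*} [NormedAddCommGroup Z] [NormedSpace ℝ Z]
    [NormedAddCommGroup Y] [InnerProductSpace ℝ Y] [CompleteSpace Y] (V : Submodule ℝ Z)
    (J : Z →L[ℝ] Y) (z : Z) :
    ⨅ ψ : (V : Set Z), ‖J (ψ + z)‖ ^ 2 =
      ‖(V.map (J : Z →ₗ[ℝ] Y))ᗮ.starProjection (J z)‖ ^ 2 := by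
  set S := V.map (J : Z →ₗ[ℝ] Y) with hS
  set y := Sᗮ.starProjection (J z) with hy
  have hbdd : BddBelow (range fun ψ : (V : Set Z) => ‖J (ψ + z)‖ ^ 2) :=
    ⟨0, by rintro _ ⟨ψ, rfl⟩; positivity⟩
  have : Nonempty (V : Set Z) := ⟨⟨0, V.zero_mem⟩⟩
  refine le_antisymm ?_ (le_ciInf fun ψ => ?_)
  · have hmem : y - J z ∈ closure (S : Set Y) := by
      rw [← Submodule.topologicalClosure_coe, SetLike.mem_coe,
        ← Submodule.orthogonal_orthogonal_eq_closure, ← Submodule.neg_mem_iff, neg_sub]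
      exact Submodule.sub_starProjection_mem_orthogonal _
    have hε : ∀ ε > 0, (⨅ ψ : (V : Set Z), ‖J (ψ + z)‖ ^ 2) ≤ (‖y‖ + ε) ^ 2 := by
      intro ε hε
      obtain ⟨s, ⟨ψ, hψ, rfl⟩, hs⟩ := Metric.mem_closure_iff.1 hmem ε hε
      refine (ciInf_le hbdd ⟨ψ, hψ⟩).trans ?_
      refine pow_le_pow_left₀ (norm_nonneg _) ?_ 2
      rw [dist_eq_norm, norm_sub_rev] at hs
      have : J (ψ + z) = y + (J ψ - (y - J z)) := by rw [map_add]; abel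
      simp only [this]
      exact (norm_add_le _ _).trans (add_le_add_right hs.le _)
    refine ge_of_tendsto (x := 𝓝[>] 0) (f := fun ε => (‖y‖ + ε) ^ 2) ?_
      (eventually_mem_nhdsWithin.mono fun ε h => hε ε h)
    have : Tendsto (fun ε => (‖y‖ + ε) ^ 2) (𝓝 0) (𝓝 ((‖y‖ + 0) ^ 2)) :=
      Continuous.tendsto (by fun_prop) _
    rw [add_zero] at this
    exact this.mono_left nhdsWithin_le_nhds
  · have h1 : y = Sᗮ.starProjection (J (ψ + z)) := by
      rw [map_add, map_add]
      have : Sᗮ.starProjection (J ψ) = 0 := by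
        rw [Submodule.starProjection_apply_eq_zero_iff]
        exact Submodule.le_orthogonal_orthogonal _ (Submodule.mem_map_of_mem ψ.2)
      rw [this, zero_add]
    rw [h1]
    exact pow_le_pow_left₀ (norm_nonneg _) (Submodule.norm_starProjection_apply_le _ _) 2

theorem exists_iInf_norm_sq_eq {Z Y : Type*} [NormedAddCommGroup Z] [NormedSpace ℝ Z]
    [NormedAddCommGroup Y] [InnerProductSpace ℝ Y] [CompleteSpace Y] (V : Submodule ℝ Z)
    (J : Z →L[ℝ] Y) :
    ∃ Q : Y →L[ℝ] Y, ∀ z, ⨅ ψ : (V : Set Z), ‖J (ψ + z)‖ ^ 2 = ‖Q (J z)‖ ^ 2 :=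
  ⟨_, iInf_norm_sq_eq V J⟩

section Chom

variable {d : ℕ} {𝒪 : ConfigFamily d} {P : Measure (Config 𝒪)}

theorem IsL2Loc.congr {F : Type*} [NormedAddCommGroup F] {f g : E d → F} (hf : IsL2Loc f)
    (h : f =ᵐ[volume] g) : IsL2Loc g :=
  fun K hK => (hf K hK).ae_eq (ae_restrict_of_ae h)

theorem IsL2Loc.add {F : Type*} [NormedAddCommGroup F] {f g : E d → F} (hf : IsL2Loc f)
    (hg : IsL2Loc g) : IsL2Loc fun y => f y + g y :=
  fun K hK => (hf K hK).add (hg K hK)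

theorem IsL2Loc.smul {F : Type*} [NormedAddCommGroup F] [NormedSpace ℝ F] {f : E d → F}
    (hf : IsL2Loc f) (c : ℝ) : IsL2Loc fun y => c • f y :=
  fun K hK => (hf K hK).const_smul c

theorem integral_out_mul (f : Config 𝒪 → ℝ) :
    ∫ ω, (1 - (originIn 𝒪).indicator 1 ω) * f ω ∂P = ∫ ω in (originIn 𝒪)ᶜ, f ω ∂P := by
  rw [← integral_indicator measurableSet_originIn.compl]
  refine integral_congr_ae (Eventually.of_forall fun ω => ?_)
  by_cases h : ω ∈ originIn 𝒪
  · simp [h]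
  · simp [h]

variable [IsProbabilityMeasure P]

/-- The potential fields with zero mean form a subspace. -/
def vpotSubmodule (h : IsFlow (T (𝒪 := 𝒪)) P) : Submodule ℝ (Lp (M d) 2 P) where
  carrier := Vpot P
  add_mem' := by
    rintro a b ⟨ha, ha0⟩ ⟨hb, hb0⟩
    refine ⟨?_, ?_⟩
    · filter_upwards [ha, hb, h.ae_orbit (Lp.coeFn_add a b)] with ω h1 h2 h3
      obtain ⟨h1, φ, hφ, hφ'⟩ := h1
      obtain ⟨h2, χ, hχ, hχ'⟩ := h2
      exact ⟨(h1.add h2).congr (EventuallyEq.symm h3), _, hφ.add hχ,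
        (hφ'.add hχ').congr EventuallyEq.rfl (EventuallyEq.symm h3)⟩
    · rw [integral_congr_ae (Lp.coeFn_add a b)]
      change ∫ ω, (a ω + b ω) ∂P = 0
      rw [integral_add ((Lp.memLp a).integrable (by norm_num))
        ((Lp.memLp b).integrable (by norm_num)), ha0, hb0, add_zero]
  zero_mem' := by
    refine ⟨?_, ?_⟩
    · filter_upwards [h.ae_orbit (Lp.coeFn_zero (M d) 2 P)] with ω h3
      have h0 : ∀ {F : Type} [NormedAddCommGroup F], IsL2Loc fun _ : E d => (0 : F) :=
        fun K _ => MemLp.zero'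
      exact ⟨h0.congr (EventuallyEq.symm h3), _, h0,
        hasWeakGrad_zero.congr EventuallyEq.rfl (EventuallyEq.symm h3)⟩
    · rw [integral_congr_ae (Lp.coeFn_zero (M d) 2 P)]
      simp
  smul_mem' := by
    rintro c a ⟨ha, ha0⟩
    refine ⟨?_, ?_⟩
    · filter_upwards [ha, h.ae_orbit (Lp.coeFn_smul c a)] with ω h1 h3
      obtain ⟨h1, φ, hφ, hφ'⟩ := h1
      exact ⟨(h1.smul c).congr (EventuallyEq.symm h3), _, hφ.smul c,
        (hφ'.smul c).congr EventuallyEq.rfl (EventuallyEq.symm h3)⟩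
    · rw [integral_congr_ae (Lp.coeFn_smul c a)]
      change ∫ ω, c • a ω ∂P = 0
      rw [integral_smul, ha0, smul_zero]

/-- The quadratic form of the homogenised tensor is a square of a linear map. -/
theorem exists_homForm_eq (h : IsFlow (T (𝒪 := 𝒪)) P) {C₁ : Tensor d} (hC₁ : C₁.IsElastic) :
    ∃ L : M d →L[ℝ] Lp (M d) 2 (P.restrict (originIn 𝒪)ᶜ), ∀ ξ, homForm P C₁ ξ = ‖L ξ‖ ^ 2 := by
  obtain ⟨B, hB⟩ := hC₁.exists_sqrt
  -- A square root of `C₁` followed by restriction to the event that the origin is outside, so that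
  -- `‖J (ψ + ξ)‖²` is the energy being minimised.
  let J : Lp (M d) 2 P →L[ℝ] Lp (M d) 2 (P.restrict (originIn 𝒪)ᶜ) :=
    (LpToLpRestrictCLM (Config 𝒪) (M d) ℝ P 2 (originIn 𝒪)ᶜ) ∘L (B.compLpL 2 P)
  obtain ⟨Q, hQ⟩ := exists_iInf_norm_sq_eq (vpotSubmodule h) J
  refine ⟨Q ∘L J ∘L (Lp.constL 2 P ℝ), fun ξ => ?_⟩
  have h1 : homForm P C₁ ξ = ⨅ ψ : (vpotSubmodule h : Set (Lp (M d) 2 P)),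
      ‖J (ψ + Lp.constL 2 P ℝ ξ)‖ ^ 2 := by
    refine iInf_congr fun ψ => ?_
    rw [integral_out_mul, norm_toLp_sq]
    refine integral_congr_ae ?_
    have e1 := LpToLpRestrictCLM_coeFn ℝ (originIn 𝒪)ᶜ
      (B.compLpL 2 P ((ψ : Lp (M d) 2 P) + Lp.constL 2 P ℝ ξ))
    have e2 := ae_restrict_of_ae (s := (originIn 𝒪)ᶜ)
      (B.coeFn_compLp ((ψ : Lp (M d) 2 P) + Lp.constL 2 P ℝ ξ))
    have e3 := ae_restrict_of_ae (s := (originIn 𝒪)ᶜ)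
      (Lp.coeFn_add (ψ : Lp (M d) 2 P) (Lp.constL 2 P ℝ ξ))
    have e4 := ae_restrict_of_ae (s := (originIn 𝒪)ᶜ) (Lp.coeFn_const (p := 2) (μ := P) ξ)
    filter_upwards [e1, e2, e3, e4] with ω h1 h2 h3 h4
    have h5 : J (ψ + Lp.constL 2 P ℝ ξ) ω = B ((ψ : Lp (M d) 2 P) ω + ξ) := by
      refine h1.trans (h2.trans ?_)
      rw [h3]
      exact congrArg (fun t => B ((ψ : Lp (M d) 2 P) ω + t)) h4
    rw [h5, hB]
  rw [h1, hQ]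
  rfl

/-- The homogenised tensor is the Gram matrix of a linear map, and its quadratic form is the
homogenised form. -/
theorem exists_contract_Chom_eq (h : IsFlow (T (𝒪 := 𝒪)) P) {C₁ : Tensor d}
    (hC₁ : C₁.IsElastic) :
    (∀ ξ η, (Chom P C₁).contract ξ η = (Chom P C₁).contract η ξ) ∧
      ∀ ξ, (Chom P C₁).contract ξ ξ = homForm P C₁ ξ := by
  obtain ⟨L, hL⟩ := exists_homForm_eq h hC₁
  have h1 : ∀ α β μ ν, Chom P C₁ α β μ ν =
      ⟪L (EuclideanSpace.single (α, β) 1), L (EuclideanSpace.single (μ, ν) 1)⟫ := by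
    intro α β μ ν
    rw [Chom, hL, hL, map_add, map_sub, norm_add_sq_real, norm_sub_sq_real]
    ring
  have hsum : ∀ ξ : M d, ξ = ∑ p, ξ p • (EuclideanSpace.single p 1 : M d) := by
    intro ξ
    ext q
    simp [Finset.sum_apply, Pi.single_apply]
  have h2 : ∀ ξ η, (Chom P C₁).contract ξ η = ⟪L ξ, L η⟫ := by
    intro ξ η
    conv_rhs => rw [hsum ξ, hsum η]
    simp only [map_sum, map_smul, sum_inner, inner_sum, inner_smul_left, inner_smul_right,
      Fintype.sum_prod_type, conj_trivial, Tensor.contract, h1, Finset.mul_sum]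
    refine Finset.sum_congr rfl fun α _ => Finset.sum_congr rfl fun β _ =>
      Finset.sum_congr rfl fun μ _ => Finset.sum_congr rfl fun ν _ => ?_
    rw [real_inner_comm]; ring
  refine ⟨fun ξ η => by rw [h2, h2, real_inner_comm], fun ξ => ?_⟩
  rw [h2, hL, real_inner_self_eq_norm_sq]

end Chom

/-! ## Smooth functions and their partial derivatives -/

section Partial

variable {d : ℕ}

/-- The partial derivative of a scalar function. -/
noncomputable def pd (i : Fin d) (f : E d → ℝ) : E d → ℝ := fun y => fderiv ℝ f y (e i)

theorem contDiff_pd {f : E d → ℝ} (hf : ContDiff ℝ (⊤ : ℕ∞) f) (i : Fin d) :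
    ContDiff ℝ (⊤ : ℕ∞) (pd i f) := contDiff_fderiv_apply hf (e i)

theorem hasCompactSupport_pd {f : E d → ℝ} (hf : HasCompactSupport f) (i : Fin d) :
    HasCompactSupport (pd i f) := hf.fderiv_apply (𝕜 := ℝ) (e i)

theorem pd_comm {f : E d → ℝ} (hf : ContDiff ℝ (⊤ : ℕ∞) f) (i j : Fin d) :
    pd i (pd j f) = pd j (pd i f) := by
  ext y
  have hd : ∀ a b : E d, fderiv ℝ (fun y => fderiv ℝ f y a) y b =
      fderiv ℝ (fderiv ℝ f) y b a := by
    intro a b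
    have : DifferentiableAt ℝ (fderiv ℝ f) y :=
      ((hf.fderiv_right (m := (⊤ : ℕ∞)) (by simp)).differentiable (by simp)) y
    rw [fderiv_clm_apply this (differentiableAt_const a)]
    simp
  change fderiv ℝ (fun y => fderiv ℝ f y (e j)) y (e i) =
    fderiv ℝ (fun y => fderiv ℝ f y (e i)) y (e j)
  rw [hd, hd]
  exact (hf.contDiffAt.isSymmSndFDerivAt (by
    rw [minSmoothness_of_isRCLikeNormedField]
    exact WithTop.coe_le_coe.2 (le_top : (2 : ℕ∞) ≤ ⊤))).eq _ _

theorem pd_mul {f g : E d → ℝ} (hf : ContDiff ℝ (⊤ : ℕ∞) f) (hg : ContDiff ℝ (⊤ : ℕ∞) g)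
    (i : Fin d) (y : E d) : pd i (fun z => f z * g z) y = pd i f y * g y + f y * pd i g y := by
  have h := ((hf.differentiable (by simp)) y).hasFDerivAt.mul
    ((hg.differentiable (by simp)) y).hasFDerivAt
  rw [pd, HasFDerivAt.fderiv (f := fun z => f z * g z) h]
  simp only [FunLike.coe_add, Pi.add_apply, FunLike.coe_smul, Pi.smul_apply, smul_eq_mul, pd]
  ring

theorem tsupport_pd_subset (f : E d → ℝ) (i : Fin d) : tsupport (pd i f) ⊆ tsupport f :=
  tsupport_fderiv_apply_subset ℝ (e i)

theorem integral_pd_mul {f g : E d → ℝ} (hf : ContDiff ℝ (⊤ : ℕ∞) f) (hg : ContDiff ℝ (⊤ : ℕ∞) g)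
    (hc : HasCompactSupport g) (i : Fin d) :
    ∫ y, f y * pd i g y = -∫ y, pd i f y * g y := by
  refine integral_mul_fderiv_eq_neg_fderiv_mul_of_integrable ?_ ?_ ?_ ?_ ?_
  · exact ((contDiff_pd hf i).continuous.mul hg.continuous).integrable_of_hasCompactSupport
      hc.mul_left
  · exact (hf.continuous.mul (contDiff_pd hg i).continuous).integrable_of_hasCompactSupport
      (hasCompactSupport_pd hc i).mul_left
  · exact (hf.continuous.mul hg.continuous).integrable_of_hasCompactSupport hc.mul_left
  · exact fun x _ => hf.differentiable (by simp) x
  · exact fun x _ => hg.differentiable (by simp) x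

theorem integral_pd_eq_zero {g : E d → ℝ} (hg : ContDiff ℝ (⊤ : ℕ∞) g)
    (hc : HasCompactSupport g) (i : Fin d) : ∫ y, pd i g y = 0 := by
  have := integral_pd_mul (f := fun _ : E d => (1 : ℝ)) contDiff_const hg hc i
  simpa [pd] using this

/-- Scalar convolution. -/
noncomputable def conv (g ρ : E d → ℝ) : E d → ℝ :=
  convolution g ρ (ContinuousLinearMap.mul ℝ ℝ) volume

theorem conv_apply (g ρ : E d → ℝ) (x : E d) : conv g ρ x = ∫ t, g t * ρ (x - t) := rfl

theorem contDiff_conv {g ρ : E d → ℝ} (hg : LocallyIntegrable g) (hρ : ContDiff ℝ (⊤ : ℕ∞) ρ)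
    (hc : HasCompactSupport ρ) : ContDiff ℝ (⊤ : ℕ∞) (conv g ρ) :=
  hc.contDiff_convolution_right (n := ⊤) (ContinuousLinearMap.mul ℝ ℝ) hg hρ

theorem pd_conv {g ρ : E d → ℝ} (hg : LocallyIntegrable g) (hρ : ContDiff ℝ (⊤ : ℕ∞) ρ)
    (hc : HasCompactSupport ρ) (i : Fin d) : pd i (conv g ρ) = conv g (pd i ρ) := by
  ext x
  have h := hc.hasFDerivAt_convolution_right (ContinuousLinearMap.mul ℝ ℝ) hg
    (hρ.of_le (by simp)) x
  have h2 := convolution_precompR_apply (𝕜 := ℝ) (ContinuousLinearMap.mul ℝ ℝ) hg (hc.fderiv (𝕜 := ℝ))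
    (hρ.continuous_fderiv (by simp)) x (e i)
  rw [pd, conv, h.fderiv]
  exact h2

theorem abs_conv_le {g ρ : E d → ℝ} {K : ℝ} (hg : ∀ x, |g x| ≤ K) (hρ : Integrable ρ) (x : E d) :
    |conv g ρ x| ≤ K * ∫ t, |ρ t| := by
  have h1 : ∫ t, |ρ t| = ∫ t, |ρ (x - t)| := (integral_sub_left_eq_self (fun t => |ρ t|) volume x).symm
  rw [conv_apply, h1, ← integral_const_mul, ← Real.norm_eq_abs]
  refine norm_integral_le_of_norm_le ((hρ.comp_sub_left x).abs.const_mul K)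
    (Eventually.of_forall fun t => ?_)
  rw [norm_mul, Real.norm_eq_abs, Real.norm_eq_abs]
  exact mul_le_mul_of_nonneg_right (hg t) (abs_nonneg _)

theorem conv_congr {g g' ρ : E d → ℝ} {x : E d} {r : ℝ} (hρ : tsupport ρ ⊆ Metric.closedBall 0 r)
    (h : ∀ t ∈ Metric.closedBall x r, g t = g' t) : conv g ρ x = conv g' ρ x := by
  rw [conv_apply, conv_apply]
  congr 1; ext t
  by_cases ht : t ∈ Metric.closedBall x r
  · rw [h t ht]
  · have : ρ (x - t) = 0 := by
      by_contra h0
      have h1 := hρ (subset_tsupport ρ h0)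
      rw [mem_closedBall_zero_iff] at h1
      rw [Metric.mem_closedBall, dist_comm, dist_eq_norm] at ht
      exact ht h1
    rw [this, mul_zero, mul_zero]

end Partial

/-! ## Stress functions -/

section Quadratic

variable {d : ℕ}

/-- A quadratic polynomial in two of the coordinates. -/
noncomputable def quad (a b : Fin d) (s t p r c : ℝ) (x : E d) : ℝ :=
  s / 2 * x b ^ 2 - t * (x a * x b) + p * x a + r * x b + c

theorem contDiff_quad (a b : Fin d) (s t p r c : ℝ) :
    ContDiff ℝ (⊤ : ℕ∞) (quad a b s t p r c) := by
  have h : ∀ i : Fin d, ContDiff ℝ (⊤ : ℕ∞) fun x : E d => x i := fun i =>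
    (EuclideanSpace.proj (𝕜 := ℝ) i).contDiff
  have ha := h a
  have hb := h b
  unfold quad
  fun_prop

theorem pd_quad (a b : Fin d) (s t p r c : ℝ) (i : Fin d) (x : E d) :
    pd i (quad a b s t p r c) x = (s * x b - t * x a + r) * (e i : E d) b +
      (p - t * x b) * (e i : E d) a := by
  have h : ∀ j : Fin d, HasFDerivAt (fun x : E d => x j) (EuclideanSpace.proj (𝕜 := ℝ) j) x :=
    fun j => (EuclideanSpace.proj (𝕜 := ℝ) j).hasFDerivAt
  have h1 := (((((h b).pow 2).const_mul (s / 2)).sub (((h a).mul (h b)).const_mul t)).add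
    ((h a).const_mul p)).add ((h b).const_mul r)
  have h2 := h1.add_const c
  rw [pd, HasFDerivAt.fderiv (f := quad a b s t p r c) h2]
  simp
  split_ifs <;> ring

theorem pd_quad_eq {a b : Fin d} (hab : a ≠ b) (s t p r c : ℝ) :
    pd a (quad a b s t p r c) = quad a b 0 0 0 (-t) p ∧
      pd b (quad a b s t p r c) = quad a b 0 0 (-t) s r := by
  constructor <;> ext x <;> rw [pd_quad] <;> simp [quad, hab, hab.symm] <;> ring

theorem pd_pd_quad {a b : Fin d} (hab : a ≠ b) (s t p r c : ℝ) (x : E d) :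
    pd b (pd b (quad a b s t p r c)) x = s ∧ pd a (pd a (quad a b s t p r c)) x = 0 ∧
      pd a (pd b (quad a b s t p r c)) x = -t := by
  rw [(pd_quad_eq hab s t p r c).1, (pd_quad_eq hab s t p r c).2]
  refine ⟨?_, ?_, ?_⟩ <;> rw [pd_quad] <;> simp [hab, hab.symm]

/-- Mollification maps translated quadratic polynomials to quadratic polynomials with the same
second derivatives. -/
theorem exists_conv_quad (a b : Fin d) (s t : ℝ) (z : E d) {ρ : E d → ℝ} (hρ : Continuous ρ)
    (hc : HasCompactSupport ρ) (h1 : ∫ x, ρ x = 1) :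
    ∃ p r c, conv (fun x => quad a b s t 0 0 0 (x - z)) ρ = quad a b s t p r c := by
  set A : ℝ := ∫ y, (y + z) a * ρ y with hA
  set B : ℝ := ∫ y, (y + z) b * ρ y with hB
  set c : ℝ := ∫ y, quad a b s t 0 0 0 (y + z) * ρ y with hc'
  have hi : ∀ f : E d → ℝ, Continuous f → Integrable fun y => f y * ρ y := fun f hf =>
    (hf.mul hρ).integrable_of_hasCompactSupport hc.mul_left
  have hI0 : Integrable ρ := hρ.integrable_of_hasCompactSupport hc
  have hco : ∀ i : Fin d, Continuous fun y : E d => (y + z) i := fun i =>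
    (EuclideanSpace.proj (𝕜 := ℝ) i).continuous.comp (continuous_id.add continuous_const)
  have hq : Continuous fun y : E d => quad a b s t 0 0 0 (y + z) :=
    (contDiff_quad a b s t 0 0 0).continuous.comp (continuous_id.add continuous_const)
  -- The coefficients come from expanding the quadratic at `x - (y + z)`; the part quadratic in `x`
  -- is unchanged because `ρ` has integral one.
  refine ⟨t * B, t * A - s * B, c, ?_⟩
  ext x
  rw [conv_apply, ← integral_sub_left_eq_self _ volume x]
  have e1 : ∀ y, quad a b s t 0 0 0 (x - y - z) * ρ (x - (x - y)) =
      quad a b s t 0 0 0 x * ρ y + t * x a * ((y + z) b * ρ y) +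
        (t * x b) * ((y + z) a * ρ y) - s * x b * ((y + z) b * ρ y) +
        quad a b s t 0 0 0 (y + z) * ρ y := by
    intro y
    rw [sub_sub_cancel]
    simp only [quad, PiLp.sub_apply, PiLp.add_apply]
    ring
  simp only [e1]
  rw [integral_add, integral_sub, integral_add, integral_add, integral_const_mul,
    integral_const_mul, integral_const_mul, integral_const_mul, h1, ← hA, ← hB, ← hc']
  · simp only [quad]; ring
  · exact hI0.const_mul _
  · exact (hi _ (hco b)).const_mul _
  · exact (hI0.const_mul _).add ((hi _ (hco b)).const_mul _)
  · exact (hi _ (hco a)).const_mul _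
  · exact ((hI0.const_mul _).add ((hi _ (hco b)).const_mul _)).add ((hi _ (hco a)).const_mul _)
  · exact (hi _ (hco b)).const_mul _
  · exact (((hI0.const_mul _).add ((hi _ (hco b)).const_mul _)).add
      ((hi _ (hco a)).const_mul _)).sub ((hi _ (hco b)).const_mul _)
  · exact hi _ hq

theorem abs_quad_le (a b : Fin d) (s t : ℝ) {x : E d} {R : ℝ} (hx : ‖x‖ ≤ R) :
    |quad a b s t 0 0 0 x| ≤ (|s| + |t|) * R ^ 2 := by
  have ha : |x a| ≤ R := (PiLp.norm_apply_le x a).trans hx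
  have hb : |x b| ≤ R := (PiLp.norm_apply_le x b).trans hx
  have hR : 0 ≤ R := (norm_nonneg x).trans hx
  have h1 : |x b| ^ 2 ≤ R ^ 2 := pow_le_pow_left₀ (abs_nonneg _) hb 2
  have h2 : |x a| * |x b| ≤ R ^ 2 := by
    rw [sq]; exact mul_le_mul ha hb (abs_nonneg _) hR
  have h3 : quad a b s t 0 0 0 x = s / 2 * x b ^ 2 - t * (x a * x b) := by simp [quad]
  rw [h3]
  refine (abs_sub _ _).trans ?_
  rw [abs_mul, abs_mul, abs_mul, abs_div, abs_pow, abs_two]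
  nlinarith [mul_le_mul_of_nonneg_left h1 (abs_nonneg s),
    mul_le_mul_of_nonneg_left h2 (abs_nonneg t), mul_nonneg (abs_nonneg s) (sq_nonneg R)]

end Quadratic

/-- A smooth function whose derivatives of first and second order are bounded by `K` and whose
second derivatives on `ω` are prescribed: it generates a bounded divergence free symmetric matrix
field that is constant on `ω`. -/
structure IsStressFunction {d : ℕ} (ω : Set (E d)) (a b : Fin d) (s t K : ℝ) (Θ : E d → ℝ) :
    Prop where
  smooth : ContDiff ℝ (⊤ : ℕ∞) Θ
  bound : ∀ i x, |pd i Θ x| ≤ K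
  bound₂ : ∀ i j x, |pd i (pd j Θ) x| ≤ K
  eq_bb : ∀ x ∈ ω, pd b (pd b Θ) x = s
  eq_aa : ∀ x ∈ ω, pd a (pd a Θ) x = 0
  eq_ab : ∀ x ∈ ω, pd a (pd b Θ) x = -t

/-- The thickenings of the inclusions are disjoint, so a quadratic polynomial may be chosen on each
of them separately. Centring it at a point of the inclusion keeps its values bounded independently
of where the inclusion lies, while the second derivatives are the same on all of them. -/
theorem IsSeparated.exists_locally_quad {d : ℕ} {δ : ℝ} (hδ : 0 < δ) {ω : Set (E d)}
    {inc nbhd : ℕ → Set (E d)} (h : IsSeparated δ ω inc nbhd) (a b : Fin d) (s t : ℝ) :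
    ∃ g : E d → ℝ, LocallyIntegrable g ∧ (∀ x, |g x| ≤ (|s| + |t|) * (1 + δ) ^ 2) ∧
      ∀ k, ∃ z, ∀ x ∈ Metric.thickening (δ / 2) (inc k), g x = quad a b s t 0 0 0 (x - z) := by
  choose z hz using h.nonempty_inc
  set V : ℕ → Set (E d) := fun k => Metric.thickening (δ / 2) (inc k) with hV
  set O : Set (E d) := ⋃ k, V k with hO
  have hex : ∀ x ∈ O, ∃ k, x ∈ V k := fun x hx => mem_iUnion.1 hx
  classical
  set κ : E d → ℕ := fun x => if hx : x ∈ O then (hex x hx).choose else 0 with hκ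
  have hκ' : ∀ k, ∀ x ∈ V k, κ x = k := by
    intro k x hx
    have hxO : x ∈ O := mem_iUnion_of_mem k hx
    simp only [hκ, dif_pos hxO]
    exact h.disjoint_thickening (hex x hxO).choose_spec hx
  set f : E d → ℝ := fun x => quad a b s t 0 0 0 (x - z (κ x)) with hf
  have hVo : ∀ k, IsOpen (V k) := fun k => Metric.isOpen_thickening
  have hOo : IsOpen O := isOpen_iUnion hVo
  have hcont : ContinuousOn f O := by
    intro x hx
    obtain ⟨k, hk⟩ := hex x hx
    have : f =ᶠ[𝓝 x] fun x => quad a b s t 0 0 0 (x - z k) := by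
      filter_upwards [(hVo k).mem_nhds hk] with y hy
      simp only [hf, hκ' k y hy]
    refine ContinuousAt.continuousWithinAt (ContinuousAt.congr ?_ this.symm)
    exact ((contDiff_quad a b s t 0 0 0).continuous.comp
      (continuous_id.sub continuous_const)).continuousAt
  have hbd : ∀ x, |O.indicator f x| ≤ (|s| + |t|) * (1 + δ) ^ 2 := by
    intro x
    by_cases hx : x ∈ O
    · rw [indicator_of_mem hx]
      obtain ⟨k, hk⟩ := hex x hx
      -- The distance to the centre is at most `1 / 2` for the diameter plus `δ / 2` for the
      -- thickening, less than `1 + δ`.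
      refine abs_quad_le a b s t ?_
      rw [hκ' k x hk, ← dist_eq_norm]
      obtain ⟨y, hy, hxy⟩ := Metric.mem_thickening_iff.1 hk
      have := h.dist_le k y hy (z k) (hz k)
      linarith [dist_triangle x y (z k)]
    · rw [indicator_of_notMem hx, abs_zero]; positivity
  refine ⟨O.indicator f, ?_, hbd, fun k => ⟨z k, fun x hx => ?_⟩⟩
  · refine (locallyIntegrable_const (μ := (volume : Measure (E d)))
      ((|s| + |t|) * (1 + δ) ^ 2)).mono ?_ (Eventually.of_forall fun x => ?_)
    · rw [aestronglyMeasurable_indicator_iff hOo.measurableSet]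
      exact hcont.aestronglyMeasurable hOo.measurableSet
    · exact (hbd x).trans (le_abs_self _)
  · rw [indicator_of_mem (mem_iUnion_of_mem k hx)]
    simp only [hf, hκ' k x hx]

/-- Mollify the locally quadratic function. All derivatives fall on the mollifier, so the bounds
depend only on `δ`, `s`, `t`; and on the inclusions the mollification is again quadratic with the
same second derivatives. -/
theorem exists_stressFunction {d : ℕ} {δ : ℝ} (hδ : 0 < δ) {a b : Fin d} (hab : a ≠ b) (s t : ℝ) :
    ∃ K, 0 ≤ K ∧ ∀ (ω : Set (E d)) (inc nbhd : ℕ → Set (E d)), IsSeparated δ ω inc nbhd →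
      ∃ Θ, IsStressFunction ω a b s t K Θ := by
  -- The mollification radius `δ / 4` is smaller than `δ / 2`, so around a point of an inclusion
  -- only its own polynomial is averaged.
  let bump : ContDiffBump (0 : E d) := ⟨δ / 8, δ / 4, by positivity, by linarith⟩
  set ρ : E d → ℝ := bump.normed volume with hρ'
  have hρ : ContDiff ℝ (⊤ : ℕ∞) ρ := bump.contDiff_normed
  have hc : HasCompactSupport ρ := bump.hasCompactSupport_normed
  have hts : tsupport ρ ⊆ Metric.closedBall 0 (δ / 4) := bump.tsupport_normed_eq.subset
  set K₁ : ℝ := ∑ i, ∫ x, |pd i ρ x| with hK₁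
  set K₂ : ℝ := ∑ i, ∑ j, ∫ x, |pd i (pd j ρ) x| with hK₂
  set L : ℝ := (|s| + |t|) * (1 + δ) ^ 2 with hL
  have hL0 : 0 ≤ L := by positivity
  have hK10 : 0 ≤ K₁ := Finset.sum_nonneg fun i _ => integral_nonneg fun x => abs_nonneg _
  have hK20 : 0 ≤ K₂ := Finset.sum_nonneg fun i _ => Finset.sum_nonneg fun j _ =>
    integral_nonneg fun x => abs_nonneg _
  refine ⟨L * (K₁ + K₂), by positivity, fun ω inc nbhd h => ?_⟩
  obtain ⟨g, hg, hgL, hgq⟩ := h.exists_locally_quad hδ a b s t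
  have hp1 : ∀ i, pd i (conv g ρ) = conv g (pd i ρ) := fun i => pd_conv hg hρ hc i
  have hp2 : ∀ i j, pd i (pd j (conv g ρ)) = conv g (pd i (pd j ρ)) := fun i j => by
    rw [hp1, pd_conv hg (contDiff_pd hρ j) (hasCompactSupport_pd hc j)]
  have hi1 : ∀ i, Integrable (pd i ρ) := fun i =>
    (contDiff_pd hρ i).continuous.integrable_of_hasCompactSupport (hasCompactSupport_pd hc i)
  have hi2 : ∀ i j, Integrable (pd i (pd j ρ)) := fun i j =>
    (contDiff_pd (contDiff_pd hρ j) i).continuous.integrable_of_hasCompactSupport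
      (hasCompactSupport_pd (hasCompactSupport_pd hc j) i)
  have hval : ∀ x ∈ ω, ∃ p r c, ∀ i j, pd i (pd j (conv g ρ)) x =
      pd i (pd j (quad a b s t p r c)) x := by
    intro x hx
    obtain ⟨k, hk⟩ := mem_iUnion.1 (h.union ▸ hx)
    obtain ⟨z, hz⟩ := hgq k
    obtain ⟨p, r, c, hq⟩ := exists_conv_quad a b s t z hρ.continuous hc bump.integral_normed
    have hqi : LocallyIntegrable fun x : E d => quad a b s t 0 0 0 (x - z) :=
      ((contDiff_quad a b s t 0 0 0).continuous.comp
        (continuous_id.sub continuous_const)).locallyIntegrable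
    refine ⟨p, r, c, fun i j => ?_⟩
    rw [← hq, hp2, pd_conv hqi hρ hc, pd_conv hqi (contDiff_pd hρ j) (hasCompactSupport_pd hc j)]
    refine conv_congr (r := δ / 4)
      ((tsupport_pd_subset _ i).trans ((tsupport_pd_subset _ j).trans hts)) fun y hy => hz y ?_
    rw [Metric.mem_closedBall] at hy
    exact Metric.mem_thickening_iff.2 ⟨x, hk, by linarith⟩
  refine ⟨conv g ρ, contDiff_conv hg hρ hc, fun i x => ?_, fun i j x => ?_, fun x hx => ?_,
    fun x hx => ?_, fun x hx => ?_⟩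
  · rw [hp1]
    refine (abs_conv_le hgL (hi1 i) x).trans (mul_le_mul_of_nonneg_left ?_ hL0)
    have := Finset.single_le_sum (f := fun i => ∫ x, |pd i ρ x|)
      (fun i _ => integral_nonneg fun x => abs_nonneg _) (Finset.mem_univ i)
    linarith
  · rw [hp2]
    refine (abs_conv_le hgL (hi2 i j) x).trans (mul_le_mul_of_nonneg_left ?_ hL0)
    have h1 := Finset.single_le_sum (f := fun j => ∫ x, |pd i (pd j ρ) x|)
      (fun j _ => integral_nonneg fun x => abs_nonneg _) (Finset.mem_univ j)
    have h2 := Finset.single_le_sum (f := fun i => ∑ j, ∫ x, |pd i (pd j ρ) x|)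
      (fun i _ => Finset.sum_nonneg fun j _ => integral_nonneg fun x => abs_nonneg _)
      (Finset.mem_univ i)
    linarith
  all_goals
    obtain ⟨p, r, c, hq⟩ := hval x hx
    rw [hq]
  · exact (pd_pd_quad hab s t p r c x).1
  · exact (pd_pd_quad hab s t p r c x).2.1
  · exact (pd_pd_quad hab s t p r c x).2.2

/-! ## Coercivity of the homogenised tensor -/

theorem integrable_inner_of_memLp {α F : Type*} [MeasurableSpace α] {μ : Measure α}
    [NormedAddCommGroup F] [InnerProductSpace ℝ F] {f g : α → F} (hf : MemLp f 2 μ)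
    (hg : MemLp g 2 μ) : Integrable (fun x => ⟪f x, g x⟫) μ := by
  refine (L2.integrable_inner (𝕜 := ℝ) (hf.toLp f) (hg.toLp g)).congr ?_
  filter_upwards [hf.coeFn_toLp, hg.coeFn_toLp] with x h1 h2
  rw [h1, h2]

/-! ### Curl free fields tested with stress fields -/

section CurlFree

variable {d : ℕ}

/-- Matrix fields whose columns are curl free in the sense of distributions. -/
def IsCurlFree (U : E d → M d) : Prop :=
  LocallyIntegrable U ∧ ∀ φ : E d → ℝ, ContDiff ℝ (⊤ : ℕ∞) φ → HasCompactSupport φ →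
    ∀ i k j : Fin d, ∫ y, U y (i, j) * pd k φ y = ∫ y, U y (k, j) * pd i φ y

theorem HasWeakGrad.isCurlFree {u : E d → E d} {G : E d → M d} (h : HasWeakGrad u G) :
    IsCurlFree G := by
  refine ⟨h.2.1, fun φ hφ hc i k j => ?_⟩
  have h1 := h.2.2 _ (contDiff_pd hφ k) (hasCompactSupport_pd hc k) i j
  have h2 := h.2.2 _ (contDiff_pd hφ i) (hasCompactSupport_pd hc i) k j
  have h3 : ∀ y, fderiv ℝ (pd k φ) y (e i) = fderiv ℝ (pd i φ) y (e k) := fun y =>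
    congrFun (pd_comm hφ i k) y
  simp only [h3] at h1
  linarith

theorem IsCurlFree.add_const {U : E d → M d} (h : IsCurlFree U) (ξ : M d) :
    IsCurlFree fun y => U y + ξ := by
  refine ⟨h.1.add (locallyIntegrable_const ξ), fun φ hφ hc i k j => ?_⟩
  have hi : ∀ (p : Fin d × Fin d) l, ∫ y, (U y + ξ) p * pd l φ y = ∫ y, U y p * pd l φ y := by
    intro p l
    have hl := (contDiff_pd hφ l).continuous
    have hlc := hasCompactSupport_pd hc l
    simp only [PiLp.add_apply, add_mul]
    rw [integral_add (integrable_mul_of_locallyIntegrable (h.1.coord p) hl hlc)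
      ((hl.integrable_of_hasCompactSupport hlc).const_mul _), integral_const_mul,
      integral_pd_eq_zero hφ hc, mul_zero, add_zero]
  rw [hi, hi, h.2 φ hφ hc]

/-- Testing a curl free field with the stress field generated by a stress function. -/
theorem IsCurlFree.abs_integral_le {U : E d → M d} (h : IsCurlFree U) {ω : Set (E d)}
    (hω : MeasurableSet ω) {a b : Fin d} {s t K : ℝ} {Θ : E d → ℝ}
    (hΘ : IsStressFunction ω a b s t K Θ) {η : E d → ℝ} (hη : ContDiff ℝ (⊤ : ℕ∞) η)
    (hc : HasCompactSupport η) :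
    |∫ y, η y * (s * U y (a, a) + t * (U y (a, b) + U y (b, a)))| ≤
      (|s| + 2 * |t| + 4 * K) * (∫ y, |η y| * ωᶜ.indicator (fun y => ‖symPart (U y)‖) y) +
        2 * K * ((∫ y, |pd a η y| * ‖U y‖) + ∫ y, |pd b η y| * ‖U y‖) := by
  have hK : 0 ≤ K := (abs_nonneg _).trans (hΘ.bound a 0)
  have hUn : LocallyIntegrable fun y => ‖U y‖ := fun x => by
    obtain ⟨s, hs, h⟩ := h.1 x
    exact ⟨s, hs, h.norm⟩
  have hΘs := hΘ.smooth
  have hUi : ∀ (p : Fin d × Fin d) {φ : E d → ℝ}, Continuous φ → HasCompactSupport φ →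
      Integrable fun y => U y p * φ y := fun p φ hφ hφc =>
    integrable_mul_of_locallyIntegrable (h.1.coord p) hφ hφc
  have hpη : ∀ l, Continuous (pd l η) := fun l => (contDiff_pd hη l).continuous
  have hpc : ∀ l, HasCompactSupport (pd l η) := fun l => hasCompactSupport_pd hc l
  have hNi : ∀ l, Integrable fun y => |pd l η y| * ‖U y‖ := fun l => by
    have := hUn.integrable_smul_left_of_hasCompactSupport (hpη l).abs (hpc l).abs
    exact this
  have hSm : LocallyIntegrable fun y => ωᶜ.indicator (fun y => ‖symPart (U y)‖) y := by
    refine hUn.mono ?_ (Eventually.of_forall fun y => ?_)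
    · refine AEStronglyMeasurable.indicator ?_ hω.compl
      have hcont : Continuous (symPart (d := d)) := by
        unfold symPart
        fun_prop
      exact (hcont.comp_aestronglyMeasurable h.1.aestronglyMeasurable).norm
    · rw [norm_norm]
      refine (norm_indicator_le_norm_self _ _).trans ?_
      rw [norm_norm]
      exact norm_symPart_le _
  have hSi : Integrable fun y => |η y| * ωᶜ.indicator (fun y => ‖symPart (U y)‖) y :=
    hSm.integrable_smul_left_of_hasCompactSupport hη.continuous.abs hc.abs
  -- the two integrations by parts
  have key : ∀ i k j l, ∫ y, U y (i, j) * (pd k (pd l Θ) y * η y + pd l Θ y * pd k η y) =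
      ∫ y, U y (k, j) * (pd i (pd l Θ) y * η y + pd l Θ y * pd i η y) := by
    intro i k j l
    have := h.2 (fun y => pd l Θ y * η y) ((contDiff_pd hΘs l).mul hη) hc.mul_left i k j
    simpa only [pd_mul (contDiff_pd hΘs l) hη] using this
  have hint : ∀ p k l, Integrable fun y =>
      U y p * (pd k (pd l Θ) y * η y + pd l Θ y * pd k η y) := fun p k l => by
    refine hUi p ?_ ?_
    · exact ((contDiff_pd (contDiff_pd hΘs l) k).continuous.mul hη.continuous).add
        ((contDiff_pd hΘs l).continuous.mul (hpη k))
    · exact hc.mul_left.add (hpc k).mul_left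
  -- The two columns `a` and `b` of `U` are tested with `η ∂_bΘ` and `η ∂_aΘ`. Together this pairs
  -- `U` with the symmetric stress having entries `∂_b∂_bΘ` at `(a, a)`, `∂_a∂_aΘ` at `(b, b)` and
  -- `-∂_a∂_bΘ` at `(a, b)` and `(b, a)`, up to terms with derivatives of `η`.
  have k1 := key a b a b
  have k2 := key b a b a
  set J1 : E d → ℝ := fun y => U y (a, a) * (pd b (pd b Θ) y * η y + pd b Θ y * pd b η y) with hJ1
  set J2 : E d → ℝ := fun y => U y (b, a) * (pd a (pd b Θ) y * η y + pd b Θ y * pd a η y) with hJ2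
  set J3 : E d → ℝ := fun y => U y (b, b) * (pd a (pd a Θ) y * η y + pd a Θ y * pd a η y) with hJ3
  set J4 : E d → ℝ := fun y => U y (a, b) * (pd b (pd a Θ) y * η y + pd a Θ y * pd b η y) with hJ4
  have i1 : Integrable J1 := hint _ _ _
  have i2 : Integrable J2 := hint _ _ _
  have i3 : Integrable J3 := hint _ _ _
  have i4 : Integrable J4 := hint _ _ _
  have i12 : Integrable fun y => J1 y - J2 y := i1.sub i2
  have i34 : Integrable fun y => J3 y - J4 y := i3.sub i4
  have iJ : Integrable fun y => J1 y - J2 y + (J3 y - J4 y) := i12.add i34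
  have hzero : ∫ y, (J1 y - J2 y + (J3 y - J4 y)) = 0 := by
    rw [integral_add i12 i34, integral_sub i1 i2, integral_sub i3 i4, k1, k2]
    ring
  have hFi : Integrable fun y => η y * (s * U y (a, a) + t * (U y (a, b) + U y (b, a))) := by
    have := (((hUi (a, a) hη.continuous hc).const_mul s).add
      (((hUi (a, b) hη.continuous hc).add (hUi (b, a) hη.continuous hc)).const_mul t))
    refine this.congr (Eventually.of_forall fun y => ?_)
    simp only [Pi.add_apply]; ring
  -- Subtracting zero replaces the constant coefficients `s, t` by their difference from the stress,
  -- which vanishes on `ω`. Only `symPart U` outside `ω` survives, besides the terms carrying a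
  -- derivative of `η`.
  have hsub : ∫ y, η y * (s * U y (a, a) + t * (U y (a, b) + U y (b, a))) =
      ∫ y, (η y * (s * U y (a, a) + t * (U y (a, b) + U y (b, a))) -
        (J1 y - J2 y + (J3 y - J4 y))) := by
    rw [integral_sub hFi iJ, hzero, sub_zero]
  rw [hsub]
  have hb : ∀ y, ‖η y * (s * U y (a, a) + t * (U y (a, b) + U y (b, a))) -
        (J1 y - J2 y + (J3 y - J4 y))‖ ≤
      (|s| + 2 * |t| + 4 * K) * (|η y| * ωᶜ.indicator (fun y => ‖symPart (U y)‖) y) +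
        2 * K * (|pd a η y| * ‖U y‖ + |pd b η y| * ‖U y‖) := by
    intro y
    have hp : ∀ p, |U y p| ≤ ‖U y‖ := fun p => PiLp.norm_apply_le (U y) p
    have hq : ∀ p, |symPart (U y) p| ≤ ‖symPart (U y)‖ := fun p => PiLp.norm_apply_le (symPart (U y)) p
    have hcomm : pd b (pd a Θ) y = pd a (pd b Θ) y := congrFun (pd_comm hΘs b a) y
    set S := symPart (U y) with hS
    have e1 : S (a, a) = U y (a, a) := by rw [hS, symPart_apply]; ring
    have e2 : S (b, b) = U y (b, b) := by rw [hS, symPart_apply]; ring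
    have e3 : U y (a, b) + U y (b, a) = 2 * S (a, b) := by rw [hS, symPart_apply]; ring
    have hsplit : η y * (s * U y (a, a) + t * (U y (a, b) + U y (b, a))) -
        (J1 y - J2 y + (J3 y - J4 y)) =
        η y * ((s - pd b (pd b Θ) y) * S (a, a) + 2 * ((t + pd a (pd b Θ) y) * S (a, b)) -
          pd a (pd a Θ) y * S (b, b)) +
        (pd a η y * (pd b Θ y * U y (b, a) - pd a Θ y * U y (b, b)) +
          pd b η y * (pd a Θ y * U y (a, b) - pd b Θ y * U y (a, a))) := by
      have e3' : 2 * S (a, b) = U y (a, b) + U y (b, a) := e3.symm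
      simp only [hJ1, hJ2, hJ3, hJ4, e1, e2, hcomm]
      linear_combination (-(η y * (t + pd a (pd b Θ) y))) * e3'
    rw [hsplit, Real.norm_eq_abs]
    have hlow : ∀ (l i j : Fin d) (p q : Fin d × Fin d),
        |pd l η y * (pd i Θ y * U y p - pd j Θ y * U y q)| ≤ 2 * K * (|pd l η y| * ‖U y‖) := by
      intro l i j p q
      rw [abs_mul]
      have h1 : |pd i Θ y * U y p| ≤ K * ‖U y‖ := by
        rw [abs_mul]; exact mul_le_mul (hΘ.bound i y) (hp p) (abs_nonneg _) hK
      have h2 : |pd j Θ y * U y q| ≤ K * ‖U y‖ := by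
        rw [abs_mul]; exact mul_le_mul (hΘ.bound j y) (hp q) (abs_nonneg _) hK
      have h3 := (abs_sub (pd i Θ y * U y p) (pd j Θ y * U y q)).trans (add_le_add h1 h2)
      calc |pd l η y| * |pd i Θ y * U y p - pd j Θ y * U y q|
          ≤ |pd l η y| * (K * ‖U y‖ + K * ‖U y‖) := mul_le_mul_of_nonneg_left h3 (abs_nonneg _)
        _ = _ := by ring
    refine (abs_add_le _ _).trans (add_le_add ?_ ((abs_add_le _ _).trans ?_))
    · by_cases hy : y ∈ ω
      · rw [hΘ.eq_bb y hy, hΘ.eq_aa y hy, hΘ.eq_ab y hy, sub_self, add_neg_cancel]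
        simp only [zero_mul, mul_zero, add_zero, sub_zero, abs_zero]
        refine mul_nonneg (by positivity) (mul_nonneg (abs_nonneg _) ?_)
        exact indicator_nonneg (fun _ _ => norm_nonneg _) _
      · rw [indicator_of_mem (mem_compl hy), abs_mul]
        -- The three terms contribute `|s| + K`, `2 (|t| + K)` and `K`, which add up to `|s| + 2|t|
        -- + 4K`.
        have h1 : |(s - pd b (pd b Θ) y) * S (a, a)| ≤ (|s| + K) * ‖S‖ := by
          rw [abs_mul]
          exact mul_le_mul ((abs_sub _ _).trans (add_le_add_right (hΘ.bound₂ b b y) _)) (hq _)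
            (abs_nonneg _) (by positivity)
        have h2 : |(t + pd a (pd b Θ) y) * S (a, b)| ≤ (|t| + K) * ‖S‖ := by
          rw [abs_mul]
          exact mul_le_mul ((abs_add_le _ _).trans (add_le_add_right (hΘ.bound₂ a b y) _)) (hq _)
            (abs_nonneg _) (by positivity)
        have h3 : |pd a (pd a Θ) y * S (b, b)| ≤ K * ‖S‖ := by
          rw [abs_mul]
          exact mul_le_mul (hΘ.bound₂ a a y) (hq _) (abs_nonneg _) hK
        have h4 : |(s - pd b (pd b Θ) y) * S (a, a) + 2 * ((t + pd a (pd b Θ) y) * S (a, b)) -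
            pd a (pd a Θ) y * S (b, b)| ≤ (|s| + 2 * |t| + 4 * K) * ‖S‖ := by
          refine (abs_sub _ _).trans ?_
          have := abs_add_le ((s - pd b (pd b Θ) y) * S (a, a))
            (2 * ((t + pd a (pd b Θ) y) * S (a, b)))
          rw [abs_mul 2, abs_two] at this
          nlinarith
        calc |η y| * |_| ≤ |η y| * ((|s| + 2 * |t| + 4 * K) * ‖S‖) :=
              mul_le_mul_of_nonneg_left h4 (abs_nonneg _)
          _ = _ := by ring
    · rw [mul_add]
      exact add_le_add (hlow _ _ _ _ _) (hlow _ _ _ _ _)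
  have hNab : Integrable fun y => |pd a η y| * ‖U y‖ + |pd b η y| * ‖U y‖ := (hNi a).add (hNi b)
  have hR : Integrable fun y =>
      (|s| + 2 * |t| + 4 * K) * (|η y| * ωᶜ.indicator (fun y => ‖symPart (U y)‖) y) +
        2 * K * (|pd a η y| * ‖U y‖ + |pd b η y| * ‖U y‖) :=
    (hSi.const_mul _).add (hNab.const_mul _)
  rw [← Real.norm_eq_abs]
  refine (norm_integral_le_of_norm_le hR (Eventually.of_forall hb)).trans (le_of_eq ?_)
  rw [integral_add (hSi.const_mul _) (hNab.const_mul _), integral_const_mul,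
    integral_const_mul, integral_add (hNi a) (hNi b)]

end CurlFree

/-! ### Averaging over orbits, and the lower bound for the homogenised form -/

section Coercive

variable {d : ℕ} {𝒪 : ConfigFamily d} {P : Measure (Config 𝒪)} [IsProbabilityMeasure P]

theorem pd_comp_smul {η : E d → ℝ} (hη : ContDiff ℝ (⊤ : ℕ∞) η) (r : ℝ) (i : Fin d) (y : E d) :
    pd i (fun y => η (r • y)) y = r * pd i η (r • y) := by
  have h1 : HasFDerivAt (fun y : E d => r • y) (r • ContinuousLinearMap.id ℝ (E d)) y :=
    (hasFDerivAt_id y).const_smul r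
  have h2 := ((hη.differentiable (by simp)) (r • y)).hasFDerivAt.comp y h1
  have h3 : fderiv ℝ (fun y => η (r • y)) y = _ := h2.fderiv
  rw [pd, h3]
  simp [pd]

theorem continuous_symPart : Continuous (symPart (d := d)) := by
  unfold symPart
  fun_prop

/-- Averaging the estimate for curl free fields along the orbits of a stationary field. -/
theorem abs_integral_le_of_isStressFunction (h : IsFlow (T (𝒪 := 𝒪)) P)
    (hopen : ∀ ω ∈ 𝒪.sets, IsOpen ω) {a b : Fin d} {s t K : ℝ}
    (hΘ : ∀ ω ∈ 𝒪.sets, ∃ Θ, IsStressFunction ω a b s t K Θ) {v : Config 𝒪 → M d}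
    (hv2 : MemLp v 2 P) (hv : ∀ᵐ ω ∂P, IsCurlFree fun y => v (T y ω)) :
    |∫ ω, (s * v ω (a, a) + t * (v ω (a, b) + v ω (b, a))) ∂P| ≤
      (|s| + 2 * |t| + 4 * K) *
        ∫ ω, (originIn 𝒪)ᶜ.indicator (fun ω => ‖symPart (v ω)‖) ω ∂P := by
  have hvi : Integrable v P := hv2.integrable (by norm_num)
  have hvp : ∀ p, Integrable (fun ω => v ω p) P := fun p =>
    (EuclideanSpace.proj (𝕜 := ℝ) p).integrable_comp hvi
  set F : Config 𝒪 → ℝ := fun ω => s * v ω (a, a) + t * (v ω (a, b) + v ω (b, a)) with hF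
  set G : Config 𝒪 → ℝ := (originIn 𝒪)ᶜ.indicator fun ω => ‖symPart (v ω)‖ with hG
  have hFi : Integrable F P :=
    ((hvp (a, a)).const_mul s).add (((hvp (a, b)).add (hvp (b, a))).const_mul t)
  have hGi : Integrable G P := by
    refine Integrable.indicator ?_ measurableSet_originIn.compl
    refine hvi.norm.mono (continuous_symPart.comp_aestronglyMeasurable hvi.1).norm
      (Eventually.of_forall fun ω => ?_)
    rw [norm_norm, norm_norm]
    exact norm_symPart_le _
  set A := |s| + 2 * |t| + 4 * K with hA
  -- The estimate is applied on almost every orbit and integrated over `Ω`; by stationarity each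
  -- orbit integral becomes an expectation times an integral of `η` or of its derivatives.
  have step : ∀ η : E d → ℝ, ContDiff ℝ (⊤ : ℕ∞) η → HasCompactSupport η →
      |(∫ y, η y) * ∫ ω, F ω ∂P| ≤ A * ((∫ y, |η y|) * ∫ ω, G ω ∂P) +
        2 * K * ((∫ y, |pd a η y|) * (∫ ω, ‖v ω‖ ∂P) + (∫ y, |pd b η y|) * ∫ ω, ‖v ω‖ ∂P) := by
    intro η hη hc
    have hηi : Integrable η := hη.continuous.integrable_of_hasCompactSupport hc
    have hpi : ∀ l, Integrable fun y => |pd l η y| := fun l =>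
      ((contDiff_pd hη l).continuous.integrable_of_hasCompactSupport
        (hasCompactSupport_pd hc l)).abs
    rw [← h.integral_orbit hηi hFi, ← h.integral_orbit hηi.abs hGi,
      ← h.integral_orbit (hpi a) hvi.norm, ← h.integral_orbit (hpi b) hvi.norm]
    have j1 := (h.integrable_orbit hηi.abs hGi).integral_prod_right
    have j2 := (h.integrable_orbit (hpi a) hvi.norm).integral_prod_right
    have j3 := (h.integrable_orbit (hpi b) hvi.norm).integral_prod_right
    simp only at j1 j2 j3
    have j23 : Integrable (fun ω => (∫ y, |pd a η y| * ‖v (T y ω)‖) +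
        ∫ y, |pd b η y| * ‖v (T y ω)‖) P := j2.add j3
    have j : Integrable (fun ω => A * (∫ y, |η y| * G (T y ω)) +
        2 * K * ((∫ y, |pd a η y| * ‖v (T y ω)‖) + ∫ y, |pd b η y| * ‖v (T y ω)‖)) P :=
      (j1.const_mul _).add (j23.const_mul _)
    rw [← integral_add j2 j3, ← integral_const_mul, ← integral_const_mul,
      ← integral_add (j1.const_mul _) (j23.const_mul _), ← Real.norm_eq_abs]
    refine norm_integral_le_of_norm_le j ?_
    filter_upwards [hv] with ω hω
    obtain ⟨Θ, hΘ⟩ := hΘ ω.1 ω.2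
    refine (hω.abs_integral_le (hopen ω.1 ω.2).measurableSet hΘ hη hc).trans (le_of_eq ?_)
    have e : ∀ y, G (T y ω) = (ω.1)ᶜ.indicator (fun y => ‖symPart (v (T y ω))‖) y := by
      intro y
      by_cases hy : y ∈ ω.1
      · have h1 : T y ω ∈ originIn 𝒪 := T_mem_originIn.2 hy
        simp [hG, hy, h1]
      · have h1 : T y ω ∉ originIn 𝒪 := fun hh => hy (T_mem_originIn.1 hh)
        simp [hG, hy, h1]
    simp only [e, hA]
  let bump : ContDiffBump (0 : E d) := ⟨1, 2, one_pos, one_lt_two⟩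
  set η : E d → ℝ := bump.normed volume with hη'
  have hη : ContDiff ℝ (⊤ : ℕ∞) η := bump.contDiff_normed
  have hc : HasCompactSupport η := bump.hasCompactSupport_normed
  have hη1 : ∫ y, η y = 1 := bump.integral_normed
  have hη1' : ∫ y, |η y| = 1 := by
    rw [← hη1]
    exact integral_congr_ae (Eventually.of_forall fun y => abs_of_nonneg (bump.nonneg_normed y))
  set c : ℝ := 2 * K * ((∫ y, |pd a η y|) * (∫ ω, ‖v ω‖ ∂P) + (∫ y, |pd b η y|) * ∫ ω, ‖v ω‖ ∂P)
    with hc'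
  -- Replacing `η` by `η(r ·)` multiplies all integrals by the same factor, except that those of
  -- first derivatives gain an extra `r`. These error terms therefore disappear as `r → 0`.
  have hlim : ∀ r : ℝ, 0 < r → |∫ ω, F ω ∂P| ≤ A * (∫ ω, G ω ∂P) + r * c := by
    intro r hr
    have hr' : HasCompactSupport fun y : E d => η (r • y) :=
      hc.comp_homeomorph (Homeomorph.smulOfNeZero r hr.ne')
    have hrs : ContDiff ℝ (⊤ : ℕ∞) fun y : E d => η (r • y) := hη.comp (contDiff_const_smul r)
    have h1 := step _ hrs hr'
    set D : ℝ := |(r ^ Module.finrank ℝ (E d))⁻¹| with hD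
    have hD0 : 0 < D := by positivity
    have e1 : ∀ f : E d → ℝ, ∫ y, f (r • y) = D * ∫ y, f y := fun f =>
      Measure.integral_comp_smul volume f r
    have e2 : ∀ l, ∫ y, |pd l (fun y => η (r • y)) y| = D * (r * ∫ y, |pd l η y|) := by
      intro l
      have : ∀ y, |pd l (fun y => η (r • y)) y| = r * |pd l η (r • y)| := by
        intro y
        rw [pd_comp_smul hη, abs_mul, abs_of_pos hr]
      simp only [this]
      rw [integral_const_mul, e1 fun y => |pd l η y|]
      ring
    rw [e1, e1 fun y => |η y|, e2, e2, hη1, hη1', abs_mul, mul_one, abs_of_pos hD0] at h1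
    have h2 : D * |∫ ω, F ω ∂P| ≤ D * (A * (∫ ω, G ω ∂P) + r * c) := by
      refine h1.trans (le_of_eq ?_)
      rw [hc']; ring
    exact le_of_mul_le_mul_left h2 hD0
  have ht : Tendsto (fun r : ℝ => A * (∫ ω, G ω ∂P) + r * c) (𝓝[>] 0) (𝓝 (A * ∫ ω, G ω ∂P)) := by
    have : Tendsto (fun r : ℝ => A * (∫ ω, G ω ∂P) + r * c) (𝓝 0)
        (𝓝 (A * (∫ ω, G ω ∂P) + 0 * c)) := by
      exact (tendsto_const_nhds).add (tendsto_id.mul_const c)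
    rw [zero_mul, add_zero] at this
    exact this.mono_left nhdsWithin_le_nhds
  exact ge_of_tendsto ht (eventually_mem_nhdsWithin.mono hlim)

/-- Since `ψ` has mean zero, the expectation of a linear function of `ψ + ξ` is its value at `ξ`.
The macroscopic strain is thus controlled by the strain outside the inclusions alone. -/
theorem exists_abs_le_integral_symPart (h𝒪 : 𝒪.IsAdmissible) (h : IsFlow (T (𝒪 := 𝒪)) P)
    {a b : Fin d} (hab : a ≠ b) (s t : ℝ) :
    ∃ C, ∀ ψ ∈ Vpot P, ∀ ξ : M d, |s * ξ (a, a) + t * (ξ (a, b) + ξ (b, a))| ≤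
      C * ∫ ω, (originIn 𝒪)ᶜ.indicator (fun ω => ‖symPart (ψ ω + ξ)‖) ω ∂P := by
  obtain ⟨δ, hδ, hsep⟩ := h𝒪.exists_separated
  have hreg := h𝒪.isRegular
  obtain ⟨K, hK, hΘ⟩ := exists_stressFunction hδ hab s t
  refine ⟨|s| + 2 * |t| + 4 * K, fun ψ hψ ξ => ?_⟩
  have hv2 : MemLp (fun ω => ψ ω + ξ) 2 P := (Lp.memLp ψ).add (memLp_const ξ)
  have h1 := abs_integral_le_of_isStressFunction h (fun ω hω => (hreg ω hω).1) (K := K)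
    (a := a) (b := b) (s := s) (t := t) (fun ω hω => by
      obtain ⟨inc, nbhd, hs⟩ := hsep ω hω
      exact hΘ ω inc nbhd hs) hv2 (by
      filter_upwards [hψ.1] with ω hω
      obtain ⟨-, φ, -, hφ⟩ := hω
      exact hφ.isCurlFree.add_const ξ)
  refine le_trans (le_of_eq ?_) h1
  have hψi : Integrable ψ P := (Lp.memLp ψ).integrable (by norm_num)
  have hψp : ∀ p, Integrable (fun ω => ψ ω p) P := fun p =>
    (EuclideanSpace.proj (𝕜 := ℝ) p).integrable_comp hψi
  have hψ0 : ∀ p, ∫ ω, ψ ω p ∂P = 0 := by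
    intro p
    have := (EuclideanSpace.proj (𝕜 := ℝ) p).integral_comp_comm hψi
    rw [hψ.2] at this
    simpa using this
  have hE : ∀ p, ∫ ω, (ψ ω + ξ) p ∂P = ξ p := by
    intro p
    simp only [PiLp.add_apply]
    rw [integral_add (hψp p) (integrable_const _), hψ0]
    simp
  have hI : ∀ p, Integrable (fun ω => (ψ ω + ξ) p) P := fun p =>
    (hψp p).add (integrable_const (ξ p))
  have hI2 : Integrable (fun ω => (ψ ω + ξ) (a, b) + (ψ ω + ξ) (b, a)) P := (hI _).add (hI _)
  rw [integral_add ((hI _).const_mul _) (hI2.const_mul _), integral_const_mul,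
    integral_const_mul, integral_add (hI _) (hI _), hE, hE, hE]

theorem sq_integral_indicator_le {f : Config 𝒪 → M d} (hf : MemLp f 2 P) :
    (∫ ω, (originIn 𝒪)ᶜ.indicator (fun ω => ‖symPart (f ω)‖) ω ∂P) ^ 2 ≤
      ∫ ω in (originIn 𝒪)ᶜ, ‖symPart (f ω)‖ ^ 2 ∂P := by
  have hg2 : MemLp ((originIn 𝒪)ᶜ.indicator fun ω => ‖symPart (f ω)‖) 2 P := by
    refine MemLp.indicator measurableSet_originIn.compl ?_
    refine MemLp.of_le hf (continuous_symPart.comp_aestronglyMeasurable hf.1).norm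
      (Eventually.of_forall fun ω => ?_)
    rw [norm_norm]
    exact norm_symPart_le _
  have h1 := abs_integral_mul_le hg2 (memLp_const (1 : ℝ))
  simp only [mul_one, one_pow, integral_const, probReal_univ, smul_eq_mul, Real.sqrt_one] at h1
  have h2 := (sq_le_sq₀ (abs_nonneg _) (Real.sqrt_nonneg _)).2 h1
  rw [sq_abs, Real.sq_sqrt (integral_nonneg fun ω => sq_nonneg _)] at h2
  refine h2.trans (le_of_eq ?_)
  rw [← integral_indicator measurableSet_originIn.compl]
  refine integral_congr_ae (Eventually.of_forall fun ω => ?_)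
  by_cases hω : ω ∈ originIn 𝒪 <;> simp [hω]

/-- Entrywise `L¹` bounds are summed, Cauchy–Schwarz on the probability space passes to `L²`, and
ellipticity gives the energy. The `1` in `1 + ∑ C p ^ 2` only keeps the denominator positive. -/
theorem mul_norm_sq_symPart_le {f : Config 𝒪 → M d} (hf : MemLp f 2 P) {C : Fin d × Fin d → ℝ}
    {ξ : M d} (hC : ∀ p, |symPart ξ p| ≤
      C p * ∫ ω, (originIn 𝒪)ᶜ.indicator (fun ω => ‖symPart (f ω)‖) ω ∂P)
    {C₁ : Tensor d} {c : ℝ} (hc : 0 < c) (hc₁ : ∀ ξ, c * ‖symPart ξ‖ ^ 2 ≤ C₁.contract ξ ξ) :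
    c / (1 + ∑ p, C p ^ 2) * ‖symPart ξ‖ ^ 2 ≤
      ∫ ω in (originIn 𝒪)ᶜ, C₁.contract (f ω) (f ω) ∂P := by
  set S : ℝ := 1 + ∑ p, C p ^ 2 with hS
  have hS0 : 0 < S := by
    have : 0 ≤ ∑ p, C p ^ 2 := Finset.sum_nonneg fun p _ => sq_nonneg _
    linarith
  have hN2 := sq_integral_indicator_le hf
  set N : ℝ := ∫ ω, (originIn 𝒪)ᶜ.indicator (fun ω => ‖symPart (f ω)‖) ω ∂P with hN
  have hsum : ‖symPart ξ‖ ^ 2 ≤ S * N ^ 2 := by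
    rw [EuclideanSpace.norm_sq_eq]
    calc ∑ p, ‖symPart ξ p‖ ^ 2 ≤ ∑ p, C p ^ 2 * N ^ 2 := by
          refine Finset.sum_le_sum fun p _ => ?_
          rw [← mul_pow, Real.norm_eq_abs]
          exact pow_le_pow_left₀ (abs_nonneg _) (hC p) 2
      _ = (∑ p, C p ^ 2) * N ^ 2 := by rw [Finset.sum_mul]
      _ ≤ S * N ^ 2 := by
          refine mul_le_mul_of_nonneg_right ?_ (sq_nonneg _)
          linarith
  have hlast : c * ∫ ω in (originIn 𝒪)ᶜ, ‖symPart (f ω)‖ ^ 2 ∂P ≤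
      ∫ ω in (originIn 𝒪)ᶜ, C₁.contract (f ω) (f ω) ∂P := by
    rw [← integral_const_mul]
    refine integral_mono_of_nonneg (Eventually.of_forall fun ω => by positivity) ?_
      (Eventually.of_forall fun ω => hc₁ _)
    have h1 : MemLp (fun ω => C₁.op (f ω)) 2 P := C₁.op.comp_memLp' hf
    have h2 := (integrable_inner_of_memLp h1 hf).restrict (s := (originIn 𝒪)ᶜ)
    simpa only [Tensor.contract_eq] using h2
  refine le_trans ?_ hlast
  rw [div_mul_eq_mul_div, div_le_iff₀ hS0]
  calc c * ‖symPart ξ‖ ^ 2 ≤ c * (S * N ^ 2) := mul_le_mul_of_nonneg_left hsum hc.le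
    _ ≤ c * (S * _) := mul_le_mul_of_nonneg_left (mul_le_mul_of_nonneg_left hN2 hS0.le) hc.le
    _ = _ := by ring

/-- The homogenised tensor is coercive on symmetric matrices. -/
theorem exists_coercive_Chom (hd : 2 ≤ d) (h𝒪 : 𝒪.IsAdmissible) (h : IsFlow (T (𝒪 := 𝒪)) P)
    {C₁ : Tensor d} (hC₁ : C₁.IsElastic) :
    ∃ c, 0 < c ∧ ∀ ξ, c * ‖symPart ξ‖ ^ 2 ≤ (Chom P C₁).contract ξ ξ := by
  have hentry : ∀ p : Fin d × Fin d, ∃ C, ∀ ψ ∈ Vpot P, ∀ ξ, |symPart ξ p| ≤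
      C * ∫ ω, (originIn 𝒪)ᶜ.indicator (fun ω => ‖symPart (ψ ω + ξ)‖) ω ∂P := by
    rintro ⟨a, b⟩
    by_cases hab : a = b
    · subst hab
      -- A stress function needs two distinct directions; for a diagonal entry the second is any
      -- other index, which is where `2 ≤ d` enters.
      have : Nontrivial (Fin d) := Fin.nontrivial_iff_two_le.2 hd
      obtain ⟨b, hb⟩ := exists_ne a
      obtain ⟨C, hC⟩ := exists_abs_le_integral_symPart h𝒪 h hb.symm 1 0
      refine ⟨C, fun ψ hψ ξ => le_trans (le_of_eq ?_) (hC ψ hψ ξ)⟩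
      rw [symPart_apply]; congr 1; ring
    · obtain ⟨C, hC⟩ := exists_abs_le_integral_symPart h𝒪 h hab 0 (1 / 2)
      refine ⟨C, fun ψ hψ ξ => le_trans (le_of_eq ?_) (hC ψ hψ ξ)⟩
      rw [symPart_apply]; congr 1; ring
  choose C hC using hentry
  obtain ⟨c, hc, hc₁⟩ := hC₁.exists_coercive
  have hS0 : 0 < 1 + ∑ p, C p ^ 2 := by
    have : 0 ≤ ∑ p, C p ^ 2 := Finset.sum_nonneg fun p _ => sq_nonneg _
    linarith
  refine ⟨c / (1 + ∑ p, C p ^ 2), div_pos hc hS0, fun ξ => ?_⟩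
  rw [(exists_contract_Chom_eq h hC₁).2, homForm]
  have : Nonempty (Vpot P) := ⟨⟨0, (vpotSubmodule h).zero_mem⟩⟩
  refine le_ciInf ?_
  rintro ⟨ψ, hψ⟩
  rw [integral_out_mul]
  have hv2 : MemLp (fun ω => ψ ω + ξ) 2 P := (Lp.memLp ψ).add (memLp_const ξ)
  exact mul_norm_sq_symPart_le hv2 (fun p => hC p ψ hψ ξ) hc hc₁

end Coercive

/-! ## Slices of square integrable functions on a product -/

section Slice

variable {α β F : Type*} [MeasurableSpace α] [MeasurableSpace β] {μ : Measure α} {ν : Measure β}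
  [SFinite μ] [SFinite ν] [NormedAddCommGroup F] [InnerProductSpace ℝ F]

theorem ae_memLp_slice (f : Lp F 2 (μ.prod ν)) : ∀ᵐ x ∂μ, MemLp (fun y => f (x, y)) 2 ν := by
  have h1 : Integrable (fun p => ‖f p‖ ^ 2) (μ.prod ν) :=
    (Lp.memLp f).integrable_norm_pow (by norm_num)
  filter_upwards [h1.prod_right_ae, (Lp.aestronglyMeasurable f).prodMk_left] with x hx hm
  exact (memLp_two_iff_integrable_sq_norm hm).2 hx

open Classical in
/-- The slice `y ↦ f (x, y)` of a square integrable function. -/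
noncomputable def slice (f : Lp F 2 (μ.prod ν)) (x : α) : Lp F 2 ν :=
  if h : MemLp (fun y => f (x, y)) 2 ν then h.toLp _ else 0

theorem coeFn_slice (f : Lp F 2 (μ.prod ν)) : ∀ᵐ x ∂μ, slice f x =ᵐ[ν] fun y => f (x, y) := by
  filter_upwards [ae_memLp_slice f] with x hx
  rw [slice, dif_pos hx]
  exact hx.coeFn_toLp

theorem slice_congr {f : Lp F 2 (μ.prod ν)} {g : α → β → F}
    (h : f =ᵐ[μ.prod ν] fun p => g p.1 p.2) : ∀ᵐ x ∂μ, slice f x =ᵐ[ν] g x := by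
  filter_upwards [coeFn_slice f, Measure.ae_ae_of_ae_prod h] with x h1 h2
  exact h1.trans h2

theorem slice_add (f g : Lp F 2 (μ.prod ν)) :
    ∀ᵐ x ∂μ, slice (f + g) x = slice f x + slice g x := by
  filter_upwards [coeFn_slice f, coeFn_slice g, slice_congr (g := fun x y => f (x, y) + g (x, y))
    (Lp.coeFn_add f g)] with x h1 h2 h3
  refine Lp.ext ?_
  filter_upwards [h1, h2, h3, Lp.coeFn_add (slice f x) (slice g x)] with y h1 h2 h3 h4
  rw [h3, h4, Pi.add_apply, h1, h2]

theorem slice_smul (c : ℝ) (f : Lp F 2 (μ.prod ν)) :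
    ∀ᵐ x ∂μ, slice (c • f) x = c • slice f x := by
  filter_upwards [coeFn_slice f, slice_congr (g := fun x y => c • f (x, y))
    (Lp.coeFn_smul c f)] with x h1 h3
  refine Lp.ext ?_
  filter_upwards [h1, h3, Lp.coeFn_smul c (slice f x)] with y h1 h3 h4
  rw [h3, h4, Pi.smul_apply, h1]

theorem slice_sub (f g : Lp F 2 (μ.prod ν)) :
    ∀ᵐ x ∂μ, slice (f - g) x = slice f x - slice g x := by
  have h : f - g = f + (-1 : ℝ) • g := by module
  rw [h]
  filter_upwards [slice_add f ((-1 : ℝ) • g), slice_smul (-1) g] with x h1 h2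
  rw [h1, h2]; module

theorem slice_zero : ∀ᵐ x ∂μ, slice (0 : Lp F 2 (μ.prod ν)) x = 0 := by
  filter_upwards [slice_smul (0 : ℝ) (0 : Lp F 2 (μ.prod ν))] with x h
  simpa using h

theorem integrable_inner_slice (f g : Lp F 2 (μ.prod ν)) :
    Integrable (fun x => ⟪slice f x, slice g x⟫) μ ∧
      ∫ x, ⟪slice f x, slice g x⟫ ∂μ = ⟪f, g⟫ := by
  have h := L2.integrable_inner (𝕜 := ℝ) f g
  have h1 : (fun x => ∫ y, ⟪f (x, y), g (x, y)⟫ ∂ν) =ᵐ[μ] fun x => ⟪slice f x, slice g x⟫ := by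
    filter_upwards [coeFn_slice f, coeFn_slice g] with x hf hg
    rw [L2.inner_def]
    refine integral_congr_ae ?_
    filter_upwards [hf, hg] with y h1 h2
    rw [h1, h2]
  refine ⟨h.integral_prod_left.congr h1, ?_⟩
  rw [← integral_congr_ae h1, L2.inner_def, integral_prod _ h]

theorem integrable_norm_slice_sq (f : Lp F 2 (μ.prod ν)) :
    Integrable (fun x => ‖slice f x‖ ^ 2) μ := by
  simpa only [real_inner_self_eq_norm_sq] using (integrable_inner_slice f f).1

theorem integral_norm_slice_sq (f : Lp F 2 (μ.prod ν)) : ∫ x, ‖slice f x‖ ^ 2 ∂μ = ‖f‖ ^ 2 := by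
  simpa only [real_inner_self_eq_norm_sq] using (integrable_inner_slice f f).2

/-- Along a subsequence, convergence in `L²` of a product is inherited by almost all slices. -/
theorem exists_subseq_slice {f : ℕ → Lp F 2 (μ.prod ν)} {g : Lp F 2 (μ.prod ν)}
    (hf : Tendsto f atTop (𝓝 g)) : ∃ ns : ℕ → ℕ, StrictMono ns ∧ ∀ᵐ x ∂μ,
      Tendsto (fun n => slice (f (ns n)) x) atTop (𝓝 (slice g x)) := by
  set v : ℕ → α → ℝ := fun n x => ‖slice (f n - g) x‖ ^ 2 with hv
  have hvint : ∀ n, Integrable (v n) μ := fun n => integrable_norm_slice_sq _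
  have hlim : Tendsto (fun n => eLpNorm (v n - fun _ => 0) 1 μ) atTop (𝓝 0) := by
    have h1 : ∀ n, eLpNorm (v n - fun _ => 0) 1 μ = ENNReal.ofReal (‖f n - g‖ ^ 2) := by
      intro n
      rw [← integral_norm_slice_sq, ofReal_integral_eq_lintegral_ofReal (hvint n)
        (Eventually.of_forall fun x => sq_nonneg _), eLpNorm_one_eq_lintegral_enorm]
      refine lintegral_congr fun x => ?_
      simp [hv]
    simp_rw [h1]
    have h3 := (tendsto_iff_norm_sub_tendsto_zero.1 hf).pow 2
    simpa using ENNReal.tendsto_ofReal h3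
  obtain ⟨ns, hns, hae⟩ := (tendstoInMeasure_of_tendsto_eLpNorm (p := 1) one_ne_zero
    (fun n => (hvint n).aestronglyMeasurable) aestronglyMeasurable_const hlim).exists_seq_tendsto_ae
  refine ⟨ns, hns, ?_⟩
  filter_upwards [hae, ae_all_iff.2 fun n => slice_sub (f n) g] with x hx hs
  rw [tendsto_iff_norm_sub_tendsto_zero]
  have h2 := (Real.continuous_sqrt.tendsto _).comp hx
  rw [Real.sqrt_zero] at h2
  refine h2.congr fun n => ?_
  rw [Function.comp_apply, hv, ← hs]
  exact Real.sqrt_sq (norm_nonneg _)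

theorem memLp_smul_prod {g : α → ℝ} (hg : MemLp g 2 μ) {v : β → F} (hv : MemLp v 2 ν) :
    MemLp (fun p : α × β => g p.1 • v p.2) 2 (μ.prod ν) := by
  have hm : AEStronglyMeasurable (fun p : α × β => g p.1 • v p.2) (μ.prod ν) :=
    hg.1.comp_fst.smul hv.1.comp_snd
  rw [memLp_two_iff_integrable_sq_norm hm]
  have h1 : Integrable (fun p : α × β => ‖g p.1‖ ^ 2 * ‖v p.2‖ ^ 2) (μ.prod ν) :=
    (hg.integrable_norm_pow (by norm_num)).mul_prod (hv.integrable_norm_pow (by norm_num))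
  refine h1.congr (Eventually.of_forall fun p => ?_)
  simp only [norm_smul, mul_pow]

/-- The elementary tensor `(x, y) ↦ g x • v y`. -/
noncomputable def tprod (g : Lp ℝ 2 μ) (v : Lp F 2 ν) : Lp F 2 (μ.prod ν) :=
  (memLp_smul_prod (Lp.memLp g) (Lp.memLp v)).toLp _

theorem coeFn_tprod (g : Lp ℝ 2 μ) (v : Lp F 2 ν) :
    tprod g v =ᵐ[μ.prod ν] fun p => g p.1 • v p.2 := MemLp.coeFn_toLp _

theorem slice_tprod (g : Lp ℝ 2 μ) (v : Lp F 2 ν) : ∀ᵐ x ∂μ, slice (tprod g v) x = g x • v := by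
  filter_upwards [slice_congr (g := fun x y => g x • v y) (coeFn_tprod g v)] with x hx
  exact Lp.ext (hx.trans (Lp.coeFn_smul (g x) v).symm)

theorem slice_ext {f g : Lp F 2 (μ.prod ν)} (h : ∀ᵐ x ∂μ, slice f x = slice g x) : f = g := by
  rw [← sub_eq_zero, ← norm_eq_zero, ← sq_eq_zero_iff, ← integral_norm_slice_sq]
  refine integral_eq_zero_of_ae ?_
  filter_upwards [h, slice_sub f g] with x h1 h2
  rw [h2, h1, sub_self]; simp

theorem inner_tprod (g : Lp ℝ 2 μ) (v : Lp F 2 ν) (f : Lp F 2 (μ.prod ν)) :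
    ⟪tprod g v, f⟫ = ∫ x, g x * ⟪v, slice f x⟫ ∂μ := by
  rw [← (integrable_inner_slice _ _).2]
  refine integral_congr_ae ?_
  filter_upwards [slice_tprod g v] with x hx
  rw [hx, inner_smul_left]; rfl

theorem norm_tprod (g : Lp ℝ 2 μ) (v : Lp F 2 ν) : ‖tprod g v‖ = ‖g‖ * ‖v‖ := by
  rw [← sq_eq_sq₀ (norm_nonneg _) (by positivity), ← integral_norm_slice_sq, mul_pow,
    norm_toLp_sq g, ← integral_mul_const]
  refine integral_congr_ae ?_
  filter_upwards [slice_tprod g v] with x hx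
  rw [hx, norm_smul, mul_pow]

theorem aestronglyMeasurable_inner_slice (f : Lp F 2 (μ.prod ν)) (v : Lp F 2 ν) :
    AEStronglyMeasurable (fun x => ⟪slice f x, v⟫) μ := by
  have hm : AEStronglyMeasurable (fun p : α × β => ⟪f p, v p.2⟫) (μ.prod ν) :=
    (Lp.aestronglyMeasurable f).inner (Lp.aestronglyMeasurable v).comp_snd
  refine hm.integral_prod_right'.congr ?_
  filter_upwards [coeFn_slice f] with x hf
  rw [L2.inner_def]
  refine integral_congr_ae ?_
  filter_upwards [hf] with y h1
  rw [h1]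

theorem memLp_inner_slice (f : Lp F 2 (μ.prod ν)) (v : Lp F 2 ν) :
    MemLp (fun x => ⟪slice f x, v⟫) 2 μ := by
  have hm := aestronglyMeasurable_inner_slice f v
  rw [memLp_two_iff_integrable_sq_norm hm]
  refine ((integrable_norm_slice_sq f).mul_const (‖v‖ ^ 2)).mono' (hm.norm.pow 2)
    (Eventually.of_forall fun x => ?_)
  rw [← mul_pow, Real.norm_eq_abs, abs_pow, abs_norm]
  exact pow_le_pow_left₀ (norm_nonneg _) (norm_inner_le_norm _ _) 2

variable {G : Type*} [NormedAddCommGroup G] [InnerProductSpace ℝ G]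

/-- Pairs of functions whose slices lie in a given subspace. -/
noncomputable def sliceSubmodule (S : Submodule ℝ (WithLp 2 (Lp F 2 ν × Lp G 2 ν))) :
    Submodule ℝ (WithLp 2 (Lp F 2 (μ.prod ν) × Lp G 2 (μ.prod ν))) where
  carrier := {p | ∀ᵐ x ∂μ, WithLp.toLp 2 (slice p.fst x, slice p.snd x) ∈ S}
  add_mem' := by
    intro p q hp hq
    have hp' : ∀ᵐ x ∂μ, WithLp.toLp 2 (slice p.fst x, slice p.snd x) ∈ S := hp
    have hq' : ∀ᵐ x ∂μ, WithLp.toLp 2 (slice q.fst x, slice q.snd x) ∈ S := hq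
    change ∀ᵐ x ∂μ, WithLp.toLp 2 (slice (p.fst + q.fst) x, slice (p.snd + q.snd) x) ∈ S
    filter_upwards [hp', hq', slice_add p.fst q.fst, slice_add p.snd q.snd] with x h1 h2 h3 h4
    rw [h3, h4]
    exact S.add_mem h1 h2
  zero_mem' := by
    change ∀ᵐ x ∂μ, WithLp.toLp 2 (slice (0 : Lp F 2 (μ.prod ν)) x,
      slice (0 : Lp G 2 (μ.prod ν)) x) ∈ S
    filter_upwards [slice_zero (F := F) (μ := μ) (ν := ν),
      slice_zero (F := G) (μ := μ) (ν := ν)] with x h1 h2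
    rw [h1, h2]
    exact S.zero_mem
  smul_mem' := by
    intro c p hp
    have hp' : ∀ᵐ x ∂μ, WithLp.toLp 2 (slice p.fst x, slice p.snd x) ∈ S := hp
    change ∀ᵐ x ∂μ, WithLp.toLp 2 (slice (c • p.fst) x, slice (c • p.snd) x) ∈ S
    filter_upwards [hp', slice_smul c p.fst, slice_smul c p.snd] with x h1 h3 h4
    rw [h3, h4]
    exact S.smul_mem c h1

theorem isClosed_sliceSubmodule {S : Submodule ℝ (WithLp 2 (Lp F 2 ν × Lp G 2 ν))}
    (hS : IsClosed (S : Set (WithLp 2 (Lp F 2 ν × Lp G 2 ν)))) :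
    IsClosed (sliceSubmodule (μ := μ) S :
      Set (WithLp 2 (Lp F 2 (μ.prod ν) × Lp G 2 (μ.prod ν)))) := by
  refine isClosed_of_closure_subset fun p hp => ?_
  obtain ⟨q, hq, hqp⟩ := mem_closure_iff_seq_limit.1 hp
  have h1 : Tendsto (fun n => (q n).fst) atTop (𝓝 p.fst) :=
    ((WithLp.prod_continuous_ofLp 2 _ _).fst.tendsto p).comp hqp
  have h2 : Tendsto (fun n => (q n).snd) atTop (𝓝 p.snd) :=
    ((WithLp.prod_continuous_ofLp 2 _ _).snd.tendsto p).comp hqp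
  obtain ⟨ns, hns, hn⟩ := exists_subseq_slice h1
  -- A further subsequence, so that both components converge in almost every slice.
  obtain ⟨ms, hms, hm⟩ := exists_subseq_slice (h2.comp hns.tendsto_atTop)
  have hq' : ∀ᵐ x ∂μ, ∀ n, WithLp.toLp 2 (slice (q n).fst x, slice (q n).snd x) ∈ S :=
    ae_all_iff.2 fun n => hq n
  change ∀ᵐ x ∂μ, WithLp.toLp 2 (slice p.fst x, slice p.snd x) ∈ S
  filter_upwards [hn, hm, hq'] with x h3 h4 h5
  have h6 : Tendsto (fun n => WithLp.toLp 2 (slice (q (ns (ms n))).fst x,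
      slice (q (ns (ms n))).snd x)) atTop (𝓝 (WithLp.toLp 2 (slice p.fst x, slice p.snd x))) :=
    ((WithLp.prod_continuous_toLp 2 _ _).tendsto _).comp
      ((h3.comp hms.tendsto_atTop).prodMk_nhds h4)
  exact hS.mem_of_tendsto h6 (Eventually.of_forall fun n => h5 _)

end Slice

/-- Square integrable functions that vanish on a measurable set form a closed subspace. -/
theorem isClosed_vanishing {α F : Type*} [MeasurableSpace α] {μ : Measure α}
    [NormedAddCommGroup F] [NormedSpace ℝ F] {S : Set α} (hS : MeasurableSet S) :
    IsClosed {f : Lp F 2 μ | ∀ᵐ x ∂μ, x ∈ S → f x = 0} := by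
  have h1 : {f : Lp F 2 μ | ∀ᵐ x ∂μ, x ∈ S → f x = 0} =
      (LpToLpRestrictCLM α F ℝ μ 2 S) ⁻¹' {0} := by
    ext f
    rw [mem_preimage, mem_singleton_iff, mem_ofPred_eq, ← ae_restrict_iff' hS]
    have h2 := LpToLpRestrictCLM_coeFn ℝ S f
    constructor
    · intro h
      refine Lp.ext ?_
      filter_upwards [h, h2, Lp.coeFn_zero F 2 (μ.restrict S)] with x h3 h4 h5
      rw [h4, h3, h5, Pi.zero_apply]
    · intro h
      rw [h] at h2
      filter_upwards [h2, Lp.coeFn_zero F 2 (μ.restrict S)] with x h3 h5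
      rw [← h3, h5, Pi.zero_apply]
  rw [h1]
  exact isClosed_singleton.preimage (ContinuousLinearMap.continuous _)

/-! ## The form of a gradient energy -/

section GradForm

variable {d : ℕ} {X : Type*} [MeasurableSpace X] {μ : Measure X}

/-- The bilinear form `∫ C G · G'`. -/
noncomputable def gradForm (C : Tensor d) (μ : Measure X) :
    Lp (M d) 2 μ →L[ℝ] Lp (M d) 2 μ →L[ℝ] ℝ :=
  (innerSL ℝ).bilinearComp (C.op.compLpL 2 μ) (ContinuousLinearMap.id ℝ _)

theorem gradForm_eq_inner (C : Tensor d) (G G' : Lp (M d) 2 μ) :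
    gradForm C μ G G' = ⟪C.op.compLp G, G'⟫ := rfl

theorem gradForm_apply (C : Tensor d) (G G' : Lp (M d) 2 μ) :
    gradForm C μ G G' = ∫ x, C.contract (G x) (G' x) ∂μ := by
  rw [gradForm_eq_inner, L2.inner_def]
  refine integral_congr_ae ?_
  filter_upwards [C.op.coeFn_compLp G] with x hx
  rw [hx, Tensor.contract_eq]

theorem gradForm_comm {C : Tensor d} (hC : ∀ ξ η, C.contract ξ η = C.contract η ξ)
    (G G' : Lp (M d) 2 μ) : gradForm C μ G G' = gradForm C μ G' G := by
  rw [gradForm_apply, gradForm_apply]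
  simp only [hC]

theorem gradForm_self_nonneg {C : Tensor d} (hC : ∀ ξ, 0 ≤ C.contract ξ ξ) (G : Lp (M d) 2 μ) :
    0 ≤ gradForm C μ G G := by
  rw [gradForm_apply]
  exact integral_nonneg fun x => hC _

/-- Ellipticity controls only the symmetric part of the gradient; Korn's inequality supplies the
rest, with a loss of the factor 2. -/
theorem mul_norm_sq_le_gradForm [SFinite μ] [IsSeparable μ] {τ : E d → X → X} (h : IsFlow τ μ)
    {C : Tensor d} {c : ℝ} (hc : 0 < c) (hC : ∀ ξ, c * ‖symPart ξ‖ ^ 2 ≤ C.contract ξ ξ)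
    {p : WithLp 2 (Lp (E d) 2 μ × Lp (M d) 2 μ)} (hp : p ∈ sobolev h) :
    c / 2 * ‖p.snd‖ ^ 2 ≤ gradForm C μ p.snd p.snd := by
  have h1 : c * ∫ x, ‖symPart (p.snd x)‖ ^ 2 ∂μ ≤ ∫ x, C.contract (p.snd x) (p.snd x) ∂μ := by
    rw [← integral_const_mul]
    refine integral_mono_of_nonneg (Eventually.of_forall fun ω => by positivity) ?_
      (Eventually.of_forall fun ω => hC _)
    have h1 : MemLp (fun ω => C.op (p.snd ω)) 2 μ := C.op.comp_memLp' (Lp.memLp p.snd)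
    simpa only [Tensor.contract_eq] using integrable_inner_of_memLp h1 (Lp.memLp p.snd)
  have h2 := h.korn hp
  rw [gradForm_apply, norm_toLp_sq]
  nlinarith

theorem slice_compLp {α β F G : Type*} [MeasurableSpace α] [MeasurableSpace β] {μ : Measure α}
    {ν : Measure β} [SFinite μ] [SFinite ν] [NormedAddCommGroup F] [InnerProductSpace ℝ F]
    [NormedAddCommGroup G] [InnerProductSpace ℝ G] (B : F →L[ℝ] G) (f : Lp F 2 (μ.prod ν)) :
    ∀ᵐ x ∂μ, slice (B.compLp f) x = B.compLp (slice f x) := by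
  filter_upwards [coeFn_slice f, slice_congr (g := fun x y => B (f (x, y)))
    (B.coeFn_compLp f)] with x h1 h3
  refine Lp.ext ?_
  filter_upwards [h1, h3, B.coeFn_compLp (slice f x)] with y h1 h3 h4
  rw [h3, h4, h1]

theorem gradForm_prod {β : Type*} [MeasurableSpace β] {ν : Measure β} [SFinite μ] [SFinite ν]
    (C : Tensor d) (G G' : Lp (M d) 2 (μ.prod ν)) :
    Integrable (fun x => gradForm C ν (slice G x) (slice G' x)) μ ∧
      ∫ x, gradForm C ν (slice G x) (slice G' x) ∂μ = gradForm C (μ.prod ν) G G' := by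
  have h1 := integrable_inner_slice (C.op.compLp G) G'
  have h2 : (fun x => ⟪slice (C.op.compLp G) x, slice G' x⟫) =ᵐ[μ]
      fun x => gradForm C ν (slice G x) (slice G' x) := by
    filter_upwards [slice_compLp C.op G] with x hx
    rw [hx, gradForm_eq_inner]
  exact ⟨h1.1.congr h2, by rw [← integral_congr_ae h2, h1.2, gradForm_eq_inner]⟩

end GradForm

/-! ## The microscopic operator -/

section Micro

variable {d : ℕ} {𝒪 : ConfigFamily d} {P : Measure (Config 𝒪)} [IsProbabilityMeasure P]

theorem isClosed_L2zero : IsClosed (L2zero P : Set (Lp (E d) 2 P)) :=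
  isClosed_vanishing measurableSet_originIn.compl

instance : CompleteSpace (L2zero P) := isClosed_L2zero.completeSpace_coe

/-- `H¹_0(Ω)` as a subspace of a Hilbert space. -/
noncomputable def microSpace (h : IsFlow (T (𝒪 := 𝒪)) P) :
    Submodule ℝ (WithLp 2 (Lp (E d) 2 P × Lp (M d) 2 P)) :=
  sobolev h ⊓ (L2zero P).comap (WithLp.fstL 2 ℝ (Lp (E d) 2 P) (Lp (M d) 2 P)).toLinearMap

theorem mem_microSpace {h : IsFlow (T (𝒪 := 𝒪)) P}
    {p : WithLp 2 (Lp (E d) 2 P × Lp (M d) 2 P)} :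
    p ∈ microSpace h ↔ WithLp.ofLp p ∈ H1zero P :=
  And.comm

theorem mem_sobolev_of_mem_microSpace {h : IsFlow (T (𝒪 := 𝒪)) P}
    {p : WithLp 2 (Lp (E d) 2 P × Lp (M d) 2 P)} (hp : p ∈ microSpace h) : p ∈ sobolev h :=
  (Submodule.mem_inf.1 hp).1

theorem isClosed_microSpace (h : IsFlow (T (𝒪 := 𝒪)) P) :
    IsClosed (microSpace h : Set (WithLp 2 (Lp (E d) 2 P × Lp (M d) 2 P))) :=
  (isClosed_sobolev h).inter (isClosed_L2zero.preimage (WithLp.fstL 2 ℝ _ _).continuous)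

instance (h : IsFlow (T (𝒪 := 𝒪)) P) : CompleteSpace (microSpace h) :=
  (isClosed_microSpace h).completeSpace_coe

theorem microForm_eq (C₀ : Tensor d) (p q : Lp (E d) 2 P × Lp (M d) 2 P) :
    microForm P C₀ p q = gradForm C₀ P p.2 q.2 := (gradForm_apply C₀ _ _).symm

/-- The embedding of `H¹_0(Ω)` into `L²(Ω)`. -/
noncomputable def microVal (h : IsFlow (T (𝒪 := 𝒪)) P) : microSpace h →L[ℝ] Lp (E d) 2 P :=
  (WithLp.fstL 2 ℝ (Lp (E d) 2 P) (Lp (M d) 2 P)) ∘L (microSpace h).subtypeL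

/-- The gradient on `H¹_0(Ω)`. -/
noncomputable def microGrad (h : IsFlow (T (𝒪 := 𝒪)) P) : microSpace h →L[ℝ] Lp (M d) 2 P :=
  (WithLp.sndL 2 ℝ (Lp (E d) 2 P) (Lp (M d) 2 P)) ∘L (microSpace h).subtypeL

theorem microGrad_apply {h : IsFlow (T (𝒪 := 𝒪)) P} (k : microSpace h) :
    microGrad h k = (WithLp.ofLp k.1).2 := rfl

theorem norm_sq_microSpace {h : IsFlow (T (𝒪 := 𝒪)) P} (k : microSpace h) :
    ‖k‖ ^ 2 = ‖microVal h k‖ ^ 2 + ‖microGrad h k‖ ^ 2 :=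
  WithLp.prod_norm_sq_eq_of_L2 k.1

theorem range_microSpace (h : IsFlow (T (𝒪 := 𝒪)) P) :
    range (fun k : microSpace h => WithLp.ofLp k.1) = H1zero P := by
  ext p
  constructor
  · rintro ⟨k, rfl⟩
    exact mem_microSpace.1 k.2
  · intro hp
    exact ⟨⟨WithLp.toLp 2 p, mem_microSpace.2 hp⟩, rfl⟩

theorem mul_norm_sq_le_microGrad (h : IsFlow (T (𝒪 := 𝒪)) P) {C : Tensor d} {c : ℝ} (hc : 0 < c)
    (hC : ∀ ξ, c * ‖symPart ξ‖ ^ 2 ≤ C.contract ξ ξ) (k : microSpace h) :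
    c / 2 * ‖microGrad h k‖ ^ 2 ≤ gradForm C P (microGrad h k) (microGrad h k) :=
  mul_norm_sq_le_gradForm h hc hC (mem_sobolev_of_mem_microSpace k.2)

theorem isPosSelfAdjoint_A0 (h : IsFlow (T (𝒪 := 𝒪)) P) {C₀ : Tensor d} (hC₀ : C₀.IsElastic) :
    IsPosSelfAdjoint (A0 P C₀) := by
  obtain ⟨c, hc, hcoer⟩ := hC₀.exists_coercive
  obtain ⟨B, hB⟩ : ∃ B : microSpace h →L[ℝ] microSpace h →L[ℝ] ℝ,
      ∀ k k', B k k' = gradForm C₀ P (microGrad h k) (microGrad h k') :=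
    ⟨(gradForm C₀ P).bilinearComp (microGrad h) (microGrad h), fun k k' =>
      ContinuousLinearMap.bilinearComp_apply _ _ _ _ _⟩
  refine isPosSelfAdjoint_formOperator _ (range_microSpace h) (microVal h) (fun k => rfl)
    (fun k => (mem_microSpace.1 k.2).1) B (fun k k' => ?_) (fun k k' => ?_) (fun k => ?_)
    (c := min (c / 2) 1) (by positivity) (fun k => ?_)
  · rw [hB, microForm_eq, microGrad_apply, microGrad_apply]
  · rw [hB k k', hB k' k]
    exact gradForm_comm (C := C₀) hC₀.contract_comm _ _
  · rw [hB]
    exact gradForm_self_nonneg (C := C₀) hC₀.contract_self_nonneg _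
  · have h1 := mul_norm_sq_le_microGrad (C := C₀) h hc hcoer k
    rw [norm_sq_microSpace, hB]
    refine le_trans ?_ (add_le_add_left h1 _)
    nlinarith [min_le_left (c / 2) 1, min_le_right (c / 2) 1, sq_nonneg ‖microVal h k‖,
      sq_nonneg ‖microGrad h k‖]

end Micro

/-! ## The two-scale operator -/

theorem HasWeakGrad.translate {d : ℕ} {u : E d → E d} {G : E d → M d} (h : HasWeakGrad u G)
    (x : E d) : HasWeakGrad (fun y => u (x + y)) (fun y => G (x + y)) := by
  have hloc : ∀ {F : Type} [NormedAddCommGroup F] {f : E d → F}, LocallyIntegrable f →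
      LocallyIntegrable fun y => f (x + y) := by
    intro F _ f hf
    rw [locallyIntegrable_iff] at hf ⊢
    intro K hK
    have hK' : IsCompact ((fun y => x + y) '' K) := hK.image (by fun_prop)
    have h1 := ((measurePreserving_add_left volume x).integrableOn_comp_preimage
      (MeasurableEquiv.addLeft x).measurableEmbedding).2 (hf _ hK')
    rwa [preimage_image_eq _ (add_right_injective x)] at h1
  refine ⟨hloc h.1, hloc h.2.1, fun φ hφ hc μ ν => ?_⟩
  have h1 := h.2.2 (fun y => φ (-x + y)) (hφ.comp (contDiff_const.add contDiff_id))
    (hc.comp_homeomorph (Homeomorph.addLeft (-x))) μ ν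
  have hd : ∀ y, fderiv ℝ (fun y => φ (-x + y)) y = fderiv ℝ φ (-x + y) := fun y =>
    fderiv_comp_add_left (f := φ) (-x)
  simp only [hd] at h1
  rw [← integral_add_left_eq_self _ x, ← integral_add_left_eq_self (fun y => G y (μ, ν) * _) x] at h1
  simpa only [neg_add_cancel_left] using h1

/-! ### The macroscopic Sobolev space `H¹(ℝ^d)` -/

section Macro

variable {d : ℕ}

/-- `H¹(ℝ^d)` as a subspace of a Hilbert space. -/
noncomputable def macroSpace (d : ℕ) : Submodule ℝ
    (WithLp 2 (Lp (E d) 2 (volume : Measure (E d)) × Lp (M d) 2 (volume : Measure (E d)))) :=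
  sobolev (isFlow_translation d)

/-- For the action of `ℝ^d` on itself all orbits are translates of one field, and weak gradients are
translation invariant. So the Sobolev space of this action is the usual one, and closedness and
Korn's inequality carry over from the general case. -/
theorem mem_macroSpace
    {p : WithLp 2 (Lp (E d) 2 (volume : Measure (E d)) × Lp (M d) 2 (volume : Measure (E d)))} :
    p ∈ macroSpace d ↔ WithLp.ofLp p ∈ H1 d := by
  rw [macroSpace, mem_sobolev]
  constructor
  · intro h
    obtain ⟨x, hx⟩ := h.exists
    have := hx.translate (-x)
    simp only [add_neg_cancel_left] at this
    exact this
  · intro h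
    exact Eventually.of_forall fun x => HasWeakGrad.translate h x

instance : CompleteSpace (macroSpace d) := (isClosed_sobolev _).completeSpace_coe

/-- The embedding of `H¹(ℝ^d)` into `L²(ℝ^d)`. -/
noncomputable def macroVal (d : ℕ) : macroSpace d →L[ℝ] Lp (E d) 2 (volume : Measure (E d)) :=
  (WithLp.fstL 2 ℝ (Lp (E d) 2 (volume : Measure (E d))) (Lp (M d) 2 (volume : Measure (E d)))) ∘L
    (macroSpace d).subtypeL

/-- The gradient on `H¹(ℝ^d)`. -/
noncomputable def macroGrad (d : ℕ) : macroSpace d →L[ℝ] Lp (M d) 2 (volume : Measure (E d)) :=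
  (WithLp.sndL 2 ℝ (Lp (E d) 2 (volume : Measure (E d))) (Lp (M d) 2 (volume : Measure (E d)))) ∘L
    (macroSpace d).subtypeL

theorem norm_sq_macroSpace (k : macroSpace d) :
    ‖k‖ ^ 2 = ‖macroVal d k‖ ^ 2 + ‖macroGrad d k‖ ^ 2 :=
  WithLp.prod_norm_sq_eq_of_L2 k.1

theorem mul_norm_sq_le_macroGrad {C : Tensor d} {c : ℝ} (hc : 0 < c)
    (hC : ∀ ξ, c * ‖symPart ξ‖ ^ 2 ≤ C.contract ξ ξ) (k : macroSpace d) :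
    c / 2 * ‖macroGrad d k‖ ^ 2 ≤ gradForm C volume (macroGrad d k) (macroGrad d k) :=
  mul_norm_sq_le_gradForm (isFlow_translation d) hc hC k.2

end Macro

/-! ### Sobolev fields in the fast variable, and the two-scale space -/

section TwoScale

variable {d : ℕ} {𝒪 : ConfigFamily d} {P : Measure (Config 𝒪)} [IsProbabilityMeasure P]

theorem HasStochGrad.congr (h : IsFlow (T (𝒪 := 𝒪)) P) {u u' : Config 𝒪 → E d}
    {G G' : Config 𝒪 → M d} (hu : HasStochGrad P u G) (h1 : u =ᵐ[P] u') (h2 : G =ᵐ[P] G') :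
    HasStochGrad P u' G' := by
  filter_upwards [hu, h.ae_orbit h1, h.ae_orbit h2] with ω h1 h2 h3
  exact h1.congr h2 h3

/-- `L²(ℝ^d; H¹_0(Ω))` as a subspace of a Hilbert space. -/
noncomputable def sliceSpace (h : IsFlow (T (𝒪 := 𝒪)) P) : Submodule ℝ
    (WithLp 2 (Lp (E d) 2 ((volume : Measure (E d)).prod P) ×
      Lp (M d) 2 ((volume : Measure (E d)).prod P))) :=
  sliceSubmodule (microSpace h)

theorem mem_L2prodZero_iff {f : Lp (E d) 2 ((volume : Measure (E d)).prod P)} :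
    f ∈ L2prodZero P ↔ ∀ᵐ x : E d, slice f x ∈ L2zero P := by
  have h1 : f ∈ L2prodZero P ↔ ∀ᵐ x : E d, ∀ᵐ ω ∂P, ω ∉ originIn 𝒪 → f (x, ω) = 0 := by
    refine ⟨fun hf => Measure.ae_ae_of_ae_prod hf, fun hf => ?_⟩
    -- Deducing a statement on the product from almost every slice requires a measurable set, hence
    -- a strongly measurable representative.
    obtain ⟨g, hg, hfg⟩ := Lp.aestronglyMeasurable f
    have hm : MeasurableSet {p : E d × Config 𝒪 | p.2 ∉ originIn 𝒪 → g p = 0} := by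
      have h1 : {p : E d × Config 𝒪 | p.2 ∉ originIn 𝒪 → g p = 0} =
          Prod.snd ⁻¹' originIn 𝒪 ∪ g ⁻¹' {0} := by
        ext p
        exact imp_iff_not_or.trans (by rw [not_not]; rfl)
      rw [h1]
      exact (measurable_snd measurableSet_originIn).union (hg.measurable (measurableSet_singleton 0))
    have h2 : ∀ᵐ p ∂(volume : Measure (E d)).prod P, p.2 ∉ originIn 𝒪 → g p = 0 := by
      rw [Measure.ae_prod_iff_ae_ae hm]
      filter_upwards [hf, Measure.ae_ae_of_ae_prod hfg] with x h3 h4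
      filter_upwards [h3, h4] with ω h5 h6 h7
      rw [← h6, h5 h7]
    change ∀ᵐ p ∂(volume : Measure (E d)).prod P, p.2 ∉ originIn 𝒪 → f p = 0
    filter_upwards [h2, hfg] with p h3 h4 h5
    rw [h4, h3 h5]
  rw [h1]
  have h2 := coeFn_slice f
  constructor
  · intro h
    filter_upwards [h, h2] with x h3 h4
    change ∀ᵐ ω ∂P, ω ∉ originIn 𝒪 → slice f x ω = 0
    filter_upwards [h3, h4] with ω h5 h6 h7
    rw [h6, h5 h7]
  · intro h
    filter_upwards [h, h2] with x h3 h4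
    have h3' : ∀ᵐ ω ∂P, ω ∉ originIn 𝒪 → slice f x ω = 0 := h3
    filter_upwards [h3', h4] with ω h5 h6 h7
    rw [← h6, h5 h7]

theorem mem_sliceSpace {h : IsFlow (T (𝒪 := 𝒪)) P}
    {p : WithLp 2 (Lp (E d) 2 ((volume : Measure (E d)).prod P) ×
      Lp (M d) 2 ((volume : Measure (E d)).prod P))} :
    p ∈ sliceSpace h ↔ ∀ᵐ x : E d, (slice p.fst x, slice p.snd x) ∈ H1zero P := by
  have h1 : p ∈ sliceSpace h ↔
      ∀ᵐ x : E d, WithLp.toLp 2 (slice p.fst x, slice p.snd x) ∈ microSpace h := Iff.rfl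
  simp only [h1, mem_microSpace]

theorem mem_L2H1zero_iff (h : IsFlow (T (𝒪 := 𝒪)) P)
    {p : Lp (E d) 2 ((volume : Measure (E d)).prod P) ×
      Lp (M d) 2 ((volume : Measure (E d)).prod P)} :
    p ∈ L2H1zero P ↔ ∀ᵐ x : E d, (slice p.1 x, slice p.2 x) ∈ H1zero P := by
  have h1 : p ∈ L2H1zero P ↔ p.1 ∈ L2prodZero P ∧
    ∀ᵐ x : E d, HasStochGrad P (fun ω => p.1 (x, ω)) (fun ω => p.2 (x, ω)) := Iff.rfl
  have h2 : ∀ x : E d, (slice p.1 x, slice p.2 x) ∈ H1zero P ↔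
    slice p.1 x ∈ L2zero P ∧ HasStochGrad P (slice p.1 x) (slice p.2 x) := fun x => Iff.rfl
  simp only [h1, h2, mem_L2prodZero_iff, eventually_and]
  refine and_congr_right fun _ => eventually_congr ?_
  filter_upwards [coeFn_slice p.1, coeFn_slice p.2] with x h3 h4
  exact ⟨fun hx => hx.congr h h3.symm h4.symm, fun hx => hx.congr h h3 h4⟩

theorem isClosed_sliceSpace (h : IsFlow (T (𝒪 := 𝒪)) P) :
    IsClosed (sliceSpace h : Set (WithLp 2 (Lp (E d) 2 ((volume : Measure (E d)).prod P) ×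
      Lp (M d) 2 ((volume : Measure (E d)).prod P)))) :=
  isClosed_sliceSubmodule (isClosed_microSpace h)

instance (h : IsFlow (T (𝒪 := 𝒪)) P) : CompleteSpace (sliceSpace h) :=
  (isClosed_sliceSpace h).completeSpace_coe

/-- The embedding of `L²(ℝ^d; H¹_0(Ω))` into `L²(ℝ^d × Ω)`. -/
noncomputable def sliceVal (h : IsFlow (T (𝒪 := 𝒪)) P) :
    sliceSpace h →L[ℝ] Lp (E d) 2 ((volume : Measure (E d)).prod P) :=
  (WithLp.fstL 2 ℝ (Lp (E d) 2 ((volume : Measure (E d)).prod P))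
    (Lp (M d) 2 ((volume : Measure (E d)).prod P))) ∘L (sliceSpace h).subtypeL

/-- The microscopic gradient on `L²(ℝ^d; H¹_0(Ω))`. -/
noncomputable def sliceGrad (h : IsFlow (T (𝒪 := 𝒪)) P) :
    sliceSpace h →L[ℝ] Lp (M d) 2 ((volume : Measure (E d)).prod P) :=
  (WithLp.sndL 2 ℝ (Lp (E d) 2 ((volume : Measure (E d)).prod P))
    (Lp (M d) 2 ((volume : Measure (E d)).prod P))) ∘L (sliceSpace h).subtypeL

theorem norm_sq_sliceSpace {h : IsFlow (T (𝒪 := 𝒪)) P} (k : sliceSpace h) :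
    ‖k‖ ^ 2 = ‖sliceVal h k‖ ^ 2 + ‖sliceGrad h k‖ ^ 2 :=
  WithLp.prod_norm_sq_eq_of_L2 k.1

theorem mul_norm_sq_le_sliceGrad (h : IsFlow (T (𝒪 := 𝒪)) P) {C : Tensor d} {c : ℝ} (hc : 0 < c)
    (hC : ∀ ξ, c * ‖symPart ξ‖ ^ 2 ≤ C.contract ξ ξ) (k : sliceSpace h) :
    c / 2 * ‖sliceGrad h k‖ ^ 2 ≤
      gradForm C ((volume : Measure (E d)).prod P) (sliceGrad h k) (sliceGrad h k) := by
  rw [← (gradForm_prod C _ _).2, ← integral_norm_slice_sq, ← integral_const_mul]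
  refine integral_mono_ae ((integrable_norm_slice_sq _).const_mul _) (gradForm_prod C _ _).1 ?_
  filter_upwards [mem_sliceSpace.1 k.2] with x hx
  have h1 := mul_norm_sq_le_gradForm (p := WithLp.toLp 2 (slice (sliceVal h k) x,
    slice (sliceGrad h k) x)) h hc hC (mem_sobolev_of_mem_microSpace (mem_microSpace.2 hx))
  exact h1

/-- The probability that the origin lies outside the inclusions. -/
noncomputable def outProb (P : Measure (Config 𝒪)) : ℝ := P.real (originIn 𝒪)ᶜ

theorem norm_embed (u : Lp (E d) 2 (volume : Measure (E d))) : ‖embed P u‖ = ‖u‖ :=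
  Lp.norm_compMeasurePreserving u measurePreserving_fst

theorem coeFn_embed (u : Lp (E d) 2 (volume : Measure (E d))) :
    embed P u =ᵐ[volume.prod P] fun p => u p.1 :=
  Lp.coeFn_compMeasurePreserving u measurePreserving_fst

/-- Outside the inclusions an element of the two-scale space is its macroscopic part. -/
theorem outProb_mul_norm_sq_le (u : Lp (E d) 2 (volume : Measure (E d)))
    {f : Lp (E d) 2 ((volume : Measure (E d)).prod P)} (hf : f ∈ L2prodZero P) :
    outProb P * ‖u‖ ^ 2 ≤ ‖embed P u + f‖ ^ 2 := by
  rw [norm_toLp_sq, norm_toLp_sq, mul_comm]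
  have h1 : outProb P = ∫ ω, (originIn 𝒪)ᶜ.indicator (1 : Config 𝒪 → ℝ) ω ∂P := by
    rw [integral_indicator_one measurableSet_originIn.compl, outProb]
  have hu : Integrable fun x => ‖u x‖ ^ 2 := (Lp.memLp u).integrable_norm_pow (by norm_num)
  have ho : Integrable ((originIn 𝒪)ᶜ.indicator (1 : Config 𝒪 → ℝ)) P :=
    (integrable_const 1).indicator measurableSet_originIn.compl
  rw [h1, ← integral_prod_mul]
  refine integral_mono_ae (hu.mul_prod ho)
    ((Lp.memLp (embed P u + f)).integrable_norm_pow (by norm_num)) ?_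
  have hf' : ∀ᵐ p ∂(volume : Measure (E d)).prod P, p.2 ∉ originIn 𝒪 → f p = 0 := hf
  filter_upwards [hf', coeFn_embed (P := P) u, Lp.coeFn_add (embed P u) f] with p h2 h3 h4
  by_cases hp : p.2 ∈ originIn 𝒪
  · simp [hp]
  · simp only [mem_compl_iff, hp, not_false_eq_true, indicator_of_mem, Pi.one_apply, mul_one]
    rw [h4, Pi.add_apply, h3, h2 hp, add_zero]

theorem norm_le_of_mem_L2prodZero (u : Lp (E d) 2 (volume : Measure (E d)))
    (f : Lp (E d) 2 ((volume : Measure (E d)).prod P)) :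
    ‖f‖ ≤ ‖embed P u + f‖ + ‖u‖ := by
  rw [← norm_embed (P := P) u]
  have h1 : f = (embed P u + f) - embed P u := by abel
  calc ‖f‖ = ‖(embed P u + f) - embed P u‖ := by rw [← h1]
    _ ≤ _ := norm_sub_le _ _

end TwoScale

theorem isClosed_range_of_bound {X Y : Type*} [NormedAddCommGroup X] [NormedSpace ℝ X]
    [CompleteSpace X] [NormedAddCommGroup Y] [NormedSpace ℝ Y] (J : X →L[ℝ] Y) {C : ℝ}
    (hC : ∀ q, ‖q‖ ≤ C * ‖J q‖) : IsClosed (range J) := by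
  refine (J.antilipschitz_of_bound (K := C.toNNReal) fun q => (hC q).trans ?_).isClosed_range
    J.uniformContinuous
  exact mul_le_mul_of_nonneg_right (Real.le_coe_toNNReal C) (norm_nonneg _)

/-- Sums of closed forms. -/
theorem isPosSelfAdjoint_formOperator_prod {X W₁ W₂ K₁ K₂ : Type*} [NormedAddCommGroup X]
    [InnerProductSpace ℝ X] [CompleteSpace X] [NormedAddCommGroup K₁] [InnerProductSpace ℝ K₁]
    [CompleteSpace K₁] [NormedAddCommGroup K₂] [InnerProductSpace ℝ K₂] [CompleteSpace K₂]
    {D : Submodule ℝ X} {V₁ : Set W₁} {V₂ : Set W₂} {ι : W₁ × W₂ → X}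
    {a : W₁ × W₂ → W₁ × W₂ → ℝ} (j₁ : K₁ → W₁) (hj₁ : range j₁ = V₁) (j₂ : K₂ → W₂)
    (hj₂ : range j₂ = V₂) (I₁ : K₁ →L[ℝ] X) (I₂ : K₂ →L[ℝ] X)
    (hI : ∀ k₁ k₂, ι (j₁ k₁, j₂ k₂) = I₁ k₁ + I₂ k₂) (hID : ∀ k₁ k₂, I₁ k₁ + I₂ k₂ ∈ D)
    (B₁ : K₁ →L[ℝ] K₁ →L[ℝ] ℝ) (B₂ : K₂ →L[ℝ] K₂ →L[ℝ] ℝ)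
    (hB : ∀ k₁ k₂ k₁' k₂', a (j₁ k₁, j₂ k₂) (j₁ k₁', j₂ k₂') = B₁ k₁ k₁' + B₂ k₂ k₂')
    (hsymm₁ : ∀ k k', B₁ k k' = B₁ k' k) (hsymm₂ : ∀ k k', B₂ k k' = B₂ k' k)
    (hnonneg₁ : ∀ k, 0 ≤ B₁ k k) (hnonneg₂ : ∀ k, 0 ≤ B₂ k k) {c : ℝ} (hc : 0 < c)
    (hcoer : ∀ k₁ k₂, c * (‖k₁‖ ^ 2 + ‖k₂‖ ^ 2) ≤ B₁ k₁ k₁ + B₂ k₂ k₂ + ‖I₁ k₁ + I₂ k₂‖ ^ 2) :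
    IsPosSelfAdjoint (formOperator D (V₁ ×ˢ V₂) ι a) := by
  let π₁ : WithLp 2 (K₁ × K₂) →L[ℝ] K₁ := WithLp.fstL 2 ℝ _ _
  let π₂ : WithLp 2 (K₁ × K₂) →L[ℝ] K₂ := WithLp.sndL 2 ℝ _ _
  refine isPosSelfAdjoint_formOperator (fun k : WithLp 2 (K₁ × K₂) => (j₁ k.fst, j₂ k.snd)) ?_
    (I₁ ∘L π₁ + I₂ ∘L π₂) (fun k => hI _ _) (fun k => hID _ _)
    (B₁.bilinearComp π₁ π₁ + B₂.bilinearComp π₂ π₂) (fun k k' => hB _ _ _ _)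
    (fun k k' => congrArg₂ (· + ·) (hsymm₁ _ _) (hsymm₂ _ _))
    (fun k => add_nonneg (hnonneg₁ _) (hnonneg₂ _)) hc (fun k => ?_)
  · subst hj₁ hj₂
    ext p
    constructor
    · rintro ⟨k, rfl⟩
      exact ⟨⟨_, rfl⟩, ⟨_, rfl⟩⟩
    · rintro ⟨⟨k₁, h1⟩, ⟨k₂, h2⟩⟩
      exact ⟨WithLp.toLp 2 (k₁, k₂), Prod.ext h1 h2⟩
  · rw [WithLp.prod_norm_sq_eq_of_L2]
    exact hcoer _ _

/-- Here `q` is the probability of being outside, `u₁, u₀` and `g₁, g₀` are the norms of values and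
gradients, `b₁, b₀` the energies and `s` the norm of the sum. The bounds `u₁² ≤ q⁻¹s²` and `u₀² ≤
2s² + 2u₁²` account for `2 + 3q⁻¹`; the gradients account for `2c₁⁻¹` and `2c₀⁻¹`. -/
theorem two_scale_coercivity {q c₁ c₀ u₁ g₁ u₀ g₀ b₁ b₀ s : ℝ} (hq : 0 < q) (hc₁ : 0 < c₁)
    (hc₀ : 0 < c₀) (hu₀ : 0 ≤ u₀) (h1 : c₁ / 2 * g₁ ^ 2 ≤ b₁) (h2 : c₀ / 2 * g₀ ^ 2 ≤ b₀)
    (h3 : q * u₁ ^ 2 ≤ s ^ 2) (h4 : u₀ ≤ s + u₁) :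
    (2 + 3 * q⁻¹ + 2 * c₁⁻¹ + 2 * c₀⁻¹)⁻¹ * (u₁ ^ 2 + g₁ ^ 2 + (u₀ ^ 2 + g₀ ^ 2)) ≤
      b₁ + b₀ + s ^ 2 := by
  have e1 : u₁ ^ 2 ≤ q⁻¹ * s ^ 2 := by
    rw [inv_mul_eq_div, le_div_iff₀ hq]; linarith
  have e2 : u₀ ^ 2 ≤ 2 * s ^ 2 + 2 * u₁ ^ 2 := by nlinarith [sq_nonneg (s - u₁)]
  have e3 : g₁ ^ 2 ≤ 2 * c₁⁻¹ * b₁ := by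
    have : g₁ ^ 2 = 2 * c₁⁻¹ * (c₁ / 2 * g₁ ^ 2) := by field_simp
    rw [this]; exact mul_le_mul_of_nonneg_left h1 (by positivity)
  have e4 : g₀ ^ 2 ≤ 2 * c₀⁻¹ * b₀ := by
    have : g₀ ^ 2 = 2 * c₀⁻¹ * (c₀ / 2 * g₀ ^ 2) := by field_simp
    rw [this]; exact mul_le_mul_of_nonneg_left h2 (by positivity)
  have p1 : 0 ≤ b₁ := le_trans (by positivity) h1
  have p2 : 0 ≤ b₀ := le_trans (by positivity) h2
  have i0 : 0 ≤ q⁻¹ := by positivity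
  have i1 : 0 ≤ c₁⁻¹ := by positivity
  have i2 : 0 ≤ c₀⁻¹ := by positivity
  rw [inv_mul_eq_div, div_le_iff₀ (by positivity)]
  nlinarith [mul_nonneg i0 p1, mul_nonneg i0 p2, mul_nonneg i1 p2, mul_nonneg i2 p1,
    mul_nonneg i1 (sq_nonneg s), mul_nonneg i2 (sq_nonneg s), mul_nonneg i0 (sq_nonneg s)]

section TwoScaleOperator

variable {d : ℕ} {𝒪 : ConfigFamily d} {P : Measure (Config 𝒪)} [IsProbabilityMeasure P]

theorem outProb_pos (h𝒪 : 𝒪.IsRegular) (h : IsFlow (T (𝒪 := 𝒪)) P) : 0 < outProb P :=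
  ENNReal.toReal_pos (measure_compl_originIn_ne_zero h𝒪 h) (measure_ne_top _ _)

theorem isClosed_L2prodZero :
    IsClosed (L2prodZero P : Set (Lp (E d) 2 ((volume : Measure (E d)).prod P))) :=
  isClosed_vanishing (measurable_snd measurableSet_originIn.compl)

instance : CompleteSpace (L2prodZero P) := isClosed_L2prodZero.completeSpace_coe

/-- The natural embedding as a bounded operator. -/
noncomputable def embedL (P : Measure (Config 𝒪)) [IsProbabilityMeasure P] :
    Lp (E d) 2 (volume : Measure (E d)) →L[ℝ] Lp (E d) 2 ((volume : Measure (E d)).prod P) :=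
  (embed P).mkContinuous 1 fun u => by rw [norm_embed, one_mul]

/-- The decomposition into macroscopic and microscopic parts is stable: outside the inclusions, an
event of positive probability, only the macroscopic part is visible. So the sum map is bounded below
and has closed range. -/
theorem isClosed_twoScaleSpace (hp : 0 < outProb P) :
    IsClosed (twoScaleSpace P : Set (Lp (E d) 2 ((volume : Measure (E d)).prod P))) := by
  obtain ⟨J, hJ⟩ : ∃ J : (Lp (E d) 2 (volume : Measure (E d)) × L2prodZero P) →L[ℝ]
      Lp (E d) 2 ((volume : Measure (E d)).prod P), ∀ q, J q = embed P q.1 + q.2 :=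
    ⟨(embedL P).coprod (L2prodZero P).subtypeL, fun q => rfl⟩
  have hr : (twoScaleSpace P : Set (Lp (E d) 2 ((volume : Measure (E d)).prod P))) = range J := by
    ext f
    rw [SetLike.mem_coe, twoScaleSpace, Submodule.mem_sup]
    constructor
    · rintro ⟨_, ⟨u, rfl⟩, g, hg, rfl⟩
      exact ⟨(u, ⟨g, hg⟩), hJ _⟩
    · rintro ⟨q, rfl⟩
      exact ⟨_, ⟨q.1, rfl⟩, q.2, q.2.2, (hJ q).symm⟩
  rw [hr]
  have hanti : ∀ q, ‖q‖ ≤ (1 + (√(outProb P))⁻¹) * ‖J q‖ := by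
    intro q
    have hs : 0 < √(outProb P) := Real.sqrt_pos.2 hp
    have h1 := outProb_mul_norm_sq_le q.1 q.2.2
    have h2 := norm_le_of_mem_L2prodZero (P := P) q.1 q.2.1
    rw [← hJ] at h1 h2
    have h3 : ‖q.1‖ ≤ (√(outProb P))⁻¹ * ‖J q‖ := by
      rw [inv_mul_eq_div, le_div_iff₀ hs, mul_comm]
      refine le_of_sq_le_sq ?_ (norm_nonneg _)
      rwa [mul_pow, Real.sq_sqrt hp.le]
    rw [Prod.norm_def, add_mul, one_mul]
    refine max_le ?_ ?_
    · linarith [norm_nonneg (J q)]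
    · rw [Submodule.coe_norm]; linarith
  exact isClosed_range_of_bound J hanti

theorem range_macroSpace (d : ℕ) :
    range (fun k : macroSpace d => WithLp.ofLp k.1) = H1 d := by
  ext p
  constructor
  · rintro ⟨k, rfl⟩
    exact mem_macroSpace.1 k.2
  · intro hp
    exact ⟨⟨WithLp.toLp 2 p, mem_macroSpace.2 hp⟩, rfl⟩

theorem mem_sliceSpace_iff {h : IsFlow (T (𝒪 := 𝒪)) P}
    {p : WithLp 2 (Lp (E d) 2 ((volume : Measure (E d)).prod P) ×
      Lp (M d) 2 ((volume : Measure (E d)).prod P))} :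
    p ∈ sliceSpace h ↔ WithLp.ofLp p ∈ L2H1zero P := by
  rw [mem_sliceSpace, mem_L2H1zero_iff h]; rfl

theorem range_sliceSpace (h : IsFlow (T (𝒪 := 𝒪)) P) :
    range (fun k : sliceSpace h => WithLp.ofLp k.1) = L2H1zero P := by
  ext p
  constructor
  · rintro ⟨k, rfl⟩
    exact mem_sliceSpace_iff.1 k.2
  · intro hp
    exact ⟨⟨WithLp.toLp 2 p, mem_sliceSpace_iff.2 hp⟩, rfl⟩

theorem twoScaleForm_eq (C₀ C₁ : Tensor d) (p q : TwoScalePairs P) :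
    twoScaleForm P C₀ C₁ p q = gradForm (Chom P C₁) volume p.1.2 q.1.2 +
      gradForm C₀ (volume.prod P) p.2.2 q.2.2 := by
  rw [gradForm_apply, gradForm_apply]; rfl

theorem isPosSelfAdjoint_Ahom (hd : 2 ≤ d) (h𝒪 : 𝒪.IsAdmissible) (h : IsFlow (T (𝒪 := 𝒪)) P)
    {C₀ C₁ : Tensor d} (hC₀ : C₀.IsElastic) (hC₁ : C₁.IsElastic) :
    IsPosSelfAdjoint (Ahom P C₀ C₁) := by
  obtain ⟨c₀, hc₀, hcoer₀⟩ := hC₀.exists_coercive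
  obtain ⟨c₁, hc₁, hcoer₁⟩ := exists_coercive_Chom hd h𝒪 h hC₁
  have hsymm₁ := (exists_contract_Chom_eq h hC₁).1
  have hp := outProb_pos h𝒪.isRegular h
  obtain ⟨B₁, hB₁⟩ : ∃ B : macroSpace d →L[ℝ] macroSpace d →L[ℝ] ℝ, ∀ k k', B k k' =
      gradForm (Chom P C₁) volume (macroGrad d k) (macroGrad d k') :=
    ⟨(gradForm (Chom P C₁) volume).bilinearComp (macroGrad d) (macroGrad d), fun k k' => rfl⟩
  obtain ⟨B₂, hB₂⟩ : ∃ B : sliceSpace h →L[ℝ] sliceSpace h →L[ℝ] ℝ, ∀ k k', B k k' =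
      gradForm C₀ (volume.prod P) (sliceGrad h k) (sliceGrad h k') :=
    ⟨(gradForm C₀ (volume.prod P)).bilinearComp (sliceGrad h) (sliceGrad h), fun k k' => rfl⟩
  obtain ⟨I₁, hI₁⟩ : ∃ I : macroSpace d →L[ℝ] Lp (E d) 2 ((volume : Measure (E d)).prod P),
      ∀ k, I k = embed P (macroVal d k) := ⟨embedL P ∘L macroVal d, fun k => rfl⟩
  have hz : ∀ k : sliceSpace h, sliceVal h k ∈ L2prodZero P := fun k =>
    (mem_sliceSpace_iff.1 k.2).1
  have hsum : ∀ k₁ k₂, I₁ k₁ + sliceVal h k₂ = embed P (macroVal d k₁) + sliceVal h k₂ :=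
    fun k₁ k₂ => congrArg (· + sliceVal h k₂) (hI₁ k₁)
  have hC₁nn : ∀ ξ, 0 ≤ (Chom P C₁).contract ξ ξ := fun ξ =>
    le_trans (by positivity) (hcoer₁ ξ)
  refine isPosSelfAdjoint_formOperator_prod _ (range_macroSpace d) _ (range_sliceSpace h) I₁
    (sliceVal h) (fun k₁ k₂ => ?_) (fun k₁ k₂ => ?_) B₁ B₂ (fun k₁ k₂ k₁' k₂' => ?_)
    (fun k k' => ?_) (fun k k' => ?_) (fun k => ?_) (fun k => ?_)
    (c := (2 + 3 * (outProb P)⁻¹ + 2 * c₁⁻¹ + 2 * c₀⁻¹)⁻¹) (by positivity) (fun k₁ k₂ => ?_)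
  · exact congrArg (· + sliceVal h k₂) (hI₁ k₁).symm
  · exact (congrArg (· ∈ twoScaleSpace P) (hsum k₁ k₂)).mpr
      (Submodule.add_mem_sup ⟨macroVal d k₁, rfl⟩ (hz k₂))
  · exact (twoScaleForm_eq C₀ C₁ (WithLp.ofLp k₁.1, WithLp.ofLp k₂.1)
      (WithLp.ofLp k₁'.1, WithLp.ofLp k₂'.1)).trans
      (congrArg₂ (· + ·) (hB₁ k₁ k₁').symm (hB₂ k₂ k₂').symm)
  · exact (hB₁ k k').trans ((gradForm_comm (C := Chom P C₁) hsymm₁ _ _).trans (hB₁ k' k).symm)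
  · exact (hB₂ k k').trans
      ((gradForm_comm (C := C₀) hC₀.contract_comm _ _).trans (hB₂ k' k).symm)
  · exact (gradForm_self_nonneg (C := Chom P C₁) hC₁nn _).trans_eq (hB₁ k k).symm
  · exact (gradForm_self_nonneg (C := C₀) hC₀.contract_self_nonneg _).trans_eq (hB₂ k k).symm
  · have h1 := two_scale_coercivity hp hc₁ hc₀ (norm_nonneg _)
      (mul_norm_sq_le_macroGrad hc₁ hcoer₁ k₁) (mul_norm_sq_le_sliceGrad h hc₀ hcoer₀ k₂)
      (outProb_mul_norm_sq_le (macroVal d k₁) (hz k₂)) (norm_le_of_mem_L2prodZero _ _)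
    refine le_trans (le_of_eq ?_) (h1.trans (le_of_eq ?_))
    · exact congrArg (_ * ·) (congrArg₂ (· + ·) (norm_sq_macroSpace k₁) (norm_sq_sliceSpace k₂))
    · exact (congrArg₂ (· + ·) (congrArg₂ (· + ·) (hB₁ k₁ k₁) (hB₂ k₂ k₂))
        (congrArg (‖·‖ ^ 2) (hsum k₁ k₂))).symm

end TwoScaleOperator

/-! ## Weak formulations -/

section Weak

variable {d : ℕ} {𝒪 : ConfigFamily d} {P : Measure (Config 𝒪)} [IsProbabilityMeasure P]
  {C₀ C₁ : Tensor d}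

theorem mem_A0_iff {p : L2zero P × L2zero P} : p ∈ A0 P C₀ ↔
    ∃ G, ((p.1 : Lp (E d) 2 P), G) ∈ H1zero P ∧
      ∀ q ∈ H1zero P, gradForm C₀ P G q.2 = ⟪(p.2 : Lp (E d) 2 P), q.1⟫ := by
  constructor
  · rintro ⟨u, hu, h1, h2⟩
    refine ⟨u.2, ?_, fun q hq => ?_⟩
    · rw [h1]; exact hu
    · rw [← h2 q hq, microForm_eq]
  · rintro ⟨G, hG, h⟩
    exact ⟨_, hG, rfl, fun q hq => by rw [microForm_eq, h q hq]⟩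

theorem mem_Ahom_iff {p : twoScaleSpace P × twoScaleSpace P} : p ∈ Ahom P C₀ C₁ ↔
    ∃ u₁ g₁ u₀ g₀, (u₁, g₁) ∈ H1 d ∧ (u₀, g₀) ∈ L2H1zero P ∧
      (p.1 : Lp (E d) 2 _) = embed P u₁ + u₀ ∧
      ∀ q₁ ∈ H1 d, ∀ q₀ ∈ L2H1zero P,
        gradForm (Chom P C₁) volume g₁ q₁.2 + gradForm C₀ (volume.prod P) g₀ q₀.2 =
          ⟪(p.2 : Lp (E d) 2 _), embed P q₁.1 + q₀.1⟫ := by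
  constructor
  · rintro ⟨u, hu, h1, h2⟩
    exact ⟨u.1.1, u.1.2, u.2.1, u.2.2, hu.1, hu.2, h1, fun q₁ hq₁ q₀ hq₀ =>
      (twoScaleForm_eq C₀ C₁ u (q₁, q₀)).symm.trans (h2 (q₁, q₀) ⟨hq₁, hq₀⟩)⟩
  · rintro ⟨u₁, g₁, u₀, g₀, hu₁, hu₀, h1, h2⟩
    exact ⟨((u₁, g₁), (u₀, g₀)), ⟨hu₁, hu₀⟩, h1, fun q hq =>
      (twoScaleForm_eq C₀ C₁ ((u₁, g₁), (u₀, g₀)) q).trans (h2 q.1 hq.1 q.2 hq.2)⟩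

theorem zero_mem_H1 : (0 : Lp (E d) 2 (volume : Measure (E d)) × Lp (M d) 2 (volume : Measure (E d)))
    ∈ H1 d :=
  mem_macroSpace.1 (macroSpace d).zero_mem

theorem zero_mem_L2H1zero (h : IsFlow (T (𝒪 := 𝒪)) P) :
    (0 : Lp (E d) 2 ((volume : Measure (E d)).prod P) ×
      Lp (M d) 2 ((volume : Measure (E d)).prod P)) ∈ L2H1zero P :=
  (mem_sliceSpace_iff (h := h)).1 (sliceSpace h).zero_mem

theorem smul_mem_H1zero (h : IsFlow (T (𝒪 := 𝒪)) P) (c : ℝ) {p : Lp (E d) 2 P × Lp (M d) 2 P}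
    (hp : p ∈ H1zero P) : c • p ∈ H1zero P :=
  (mem_microSpace (h := h)).1 ((microSpace h).smul_mem c (x := WithLp.toLp 2 p)
    (mem_microSpace.2 hp))

theorem tprod_mem_L2H1zero (h : IsFlow (T (𝒪 := 𝒪)) P) (g : Lp ℝ 2 (volume : Measure (E d)))
    {q : Lp (E d) 2 P × Lp (M d) 2 P} (hq : q ∈ H1zero P) :
    (tprod g q.1, tprod g q.2) ∈ L2H1zero P := by
  rw [mem_L2H1zero_iff h]
  filter_upwards [slice_tprod g q.1, slice_tprod g q.2] with x h1 h2
  rw [h1, h2]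
  exact smul_mem_H1zero h (g x) hq

theorem memLp_gradForm_slice (g₀ : Lp (M d) 2 ((volume : Measure (E d)).prod P)) (G : Lp (M d) 2 P) :
    MemLp (fun x => gradForm C₀ P (slice g₀ x) G) 2 (volume : Measure (E d)) := by
  refine (memLp_inner_slice (C₀.op.compLp g₀) G).ae_eq ?_
  filter_upwards [slice_compLp C₀.op g₀] with x hx
  rw [hx, gradForm_eq_inner]

theorem gradForm_tprod (g₀ : Lp (M d) 2 ((volume : Measure (E d)).prod P))
    (h : Lp ℝ 2 (volume : Measure (E d))) (G : Lp (M d) 2 P) :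
    gradForm C₀ (volume.prod P) g₀ (tprod h G) = ∫ x, h x * gradForm C₀ P (slice g₀ x) G := by
  rw [← (gradForm_prod C₀ _ _).2]
  refine integral_congr_ae ?_
  filter_upwards [slice_tprod h G] with x hx
  rw [hx, map_smul, smul_eq_mul]

/-- An equation in `L²(ℝ^d; H¹_0(Ω))` holds in almost every slice. -/
theorem ae_slice_equation (h : IsFlow (T (𝒪 := 𝒪)) P)
    {g₀ : Lp (M d) 2 ((volume : Measure (E d)).prod P)}
    {w : Lp (E d) 2 ((volume : Measure (E d)).prod P)}
    (hw : ∀ q ∈ L2H1zero P, gradForm C₀ (volume.prod P) g₀ q.2 = ⟪w, q.1⟫) :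
    ∀ᵐ x : E d, ∀ q ∈ H1zero P, gradForm C₀ P (slice g₀ x) q.2 = ⟪slice w x, q.1⟫ := by
  have h1 : ∀ q ∈ H1zero P, ∀ᵐ x : E d,
      gradForm C₀ P (slice g₀ x) q.2 = ⟪slice w x, q.1⟫ := by
    intro q hq
    have hF : MemLp (fun x => gradForm C₀ P (slice g₀ x) q.2 - ⟪slice w x, q.1⟫) 2
        (volume : Measure (E d)) := (memLp_gradForm_slice g₀ q.2).sub (memLp_inner_slice w q.1)
    -- The test function in `x` is the defect `F` of the equation itself, so the identity says that
    -- `∫ F² = 0`.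
    have h2 := hw _ (tprod_mem_L2H1zero h (hF.toLp _) hq)
    rw [gradForm_tprod, real_inner_comm, inner_tprod, ← sub_eq_zero, ← integral_sub] at h2
    · have h3 : ∫ x, (gradForm C₀ P (slice g₀ x) q.2 - ⟪slice w x, q.1⟫) ^ 2 = 0 := by
        rw [← h2]
        refine integral_congr_ae ?_
        filter_upwards [hF.coeFn_toLp] with x hx
        rw [hx, real_inner_comm q.1]; ring
      rw [integral_eq_zero_iff_of_nonneg (fun x => sq_nonneg _)] at h3
      · filter_upwards [h3] with x hx
        exact sub_eq_zero.1 (pow_eq_zero_iff two_ne_zero |>.1 hx)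
      · exact hF.integrable_sq
    · exact (Lp.memLp _).integrable_mul (memLp_gradForm_slice g₀ q.2)
    · have h3 : MemLp (fun x => ⟪q.1, slice w x⟫) 2 (volume : Measure (E d)) := by
        simpa only [real_inner_comm] using memLp_inner_slice w q.1
      exact (Lp.memLp (hF.toLp _)).integrable_mul h3
  have : Fact ((2 : ENNReal) ≠ ⊤) := ⟨by norm_num⟩
  -- The exceptional null set depends on `q`. A countable dense set of test functions and continuity
  -- in `q` remove this dependence.
  obtain ⟨D, hD, hDc, hDd⟩ := (TopologicalSpace.IsSeparable.of_separableSpace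
    (H1zero P)).exists_countable_dense_subset
  filter_upwards [(ae_ball_iff hDc).2 fun q hq => h1 q (hD hq)] with x hx q hq
  have hcl : IsClosed {q : Lp (E d) 2 P × Lp (M d) 2 P |
      gradForm C₀ P (slice g₀ x) q.2 = ⟪slice w x, q.1⟫} :=
    isClosed_eq ((gradForm C₀ P (slice g₀ x)).continuous.comp continuous_snd)
      ((innerSL ℝ (slice w x)).continuous.comp continuous_fst)
  exact hcl.closure_subset_iff.2 (fun q hq => hx q hq) (hDd hq)

theorem slice_embed (u : Lp (E d) 2 (volume : Measure (E d))) :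
    ∀ᵐ x, slice (embed P u) x = Lp.constL 2 P ℝ (u x) := by
  filter_upwards [slice_congr (g := fun x _ => u x) (coeFn_embed (P := P) u)] with x hx
  refine Lp.ext ?_
  filter_upwards [hx, Lp.coeFn_const (p := 2) (μ := P) (u x)] with ω h1 h2
  rw [h1]
  exact h2.symm

theorem coeFn_constL (c : E d) : Lp.constL 2 P ℝ c =ᵐ[P] fun _ => c :=
  Lp.coeFn_const (p := 2) (μ := P) c

theorem inner_constL (c : E d) (f : Lp (E d) 2 P) : ⟪Lp.constL 2 P ℝ c, f⟫ = ⟪c, ∫ ω, f ω ∂P⟫ := by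
  rw [L2.inner_def, ← integral_inner ((Lp.memLp f).integrable (by norm_num))]
  refine integral_congr_ae ?_
  filter_upwards [coeFn_constL (P := P) c] with ω h
  rw [h]

theorem norm_constL (c : E d) : ‖Lp.constL 2 P ℝ c‖ = ‖c‖ := by
  have h1 : ∫ ω, Lp.constL 2 P ℝ c ω ∂P = c := by
    rw [integral_congr_ae (coeFn_constL (P := P) c)]; simp
  have h2 := inner_constL (P := P) c (Lp.constL 2 P ℝ c)
  rw [h1, real_inner_self_eq_norm_sq, real_inner_self_eq_norm_sq] at h2
  exact (sq_eq_sq₀ (norm_nonneg _) (norm_nonneg _)).1 h2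

/-- The part of a random vector inside the inclusions. -/
noncomputable def inPart (P : Measure (Config 𝒪)) [IsProbabilityMeasure P] :
    Lp (E d) 2 P →L[ℝ] L2zero P := (L2zero P).orthogonalProjectionOnto

theorem inner_inPart (f : Lp (E d) 2 P) {v : Lp (E d) 2 P} (hv : v ∈ L2zero P) :
    ⟪(inPart P f : Lp (E d) 2 P), v⟫ = ⟪f, v⟫ := by
  have h1 : ⟪f - (inPart P f : Lp (E d) 2 P), v⟫ = 0 :=
    (L2zero P).starProjection_inner_eq_zero f v hv
  rw [inner_sub_left, sub_eq_zero] at h1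
  exact h1.symm

theorem norm_inPart_le (f : Lp (E d) 2 P) : ‖inPart P f‖ ≤ ‖f‖ :=
  (L2zero P).norm_orthogonalProjectionOnto_apply_le f

/-- The projection of the constant `b` onto `L²_0(Ω)` is `b` times the indicator of the event that
the origin lies inside, which has probability `1 - outProb P`. -/
theorem inner_constL_inPart (a b : E d) :
    ⟪Lp.constL 2 P ℝ a, (inPart P (Lp.constL 2 P ℝ b) : Lp (E d) 2 P)⟫ =
      (1 - outProb P) * ⟪a, b⟫ := by
  set χ : Lp (E d) 2 P := indicatorConstLp 2 (measurableSet_originIn (𝒪 := 𝒪))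
    (measure_ne_top P _) b with hχ'
  have hχ : χ =ᵐ[P] (originIn 𝒪).indicator fun _ => b := indicatorConstLp_coeFn
  have hmem : χ ∈ L2zero P := by
    change ∀ᵐ ω ∂P, ω ∉ originIn 𝒪 → χ ω = 0
    filter_upwards [hχ] with ω h1 h2
    rw [h1, indicator_of_notMem h2]
  have horth : ∀ v ∈ L2zero P, ⟪χ, v⟫ = ⟪Lp.constL 2 P ℝ b, v⟫ := by
    intro v hv
    have hv' : ∀ᵐ ω ∂P, ω ∉ originIn 𝒪 → v ω = 0 := hv
    rw [L2.inner_def, L2.inner_def]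
    refine integral_congr_ae ?_
    filter_upwards [hχ, hv', coeFn_constL (P := P) b] with ω h1 h2 h3
    rw [h1, h3]
    by_cases hω : ω ∈ originIn 𝒪
    · rw [indicator_of_mem hω]
    · rw [h2 hω, inner_zero_right, inner_zero_right]
  have heq : (inPart P (Lp.constL 2 P ℝ b) : Lp (E d) 2 P) = χ := by
    have h1 : ∀ v ∈ L2zero P, ⟪(inPart P (Lp.constL 2 P ℝ b) : Lp (E d) 2 P) - χ, v⟫ = 0 := by
      intro v hv
      rw [inner_sub_left, inner_inPart _ hv, horth v hv, sub_self]
    have h2 := h1 _ ((L2zero P).sub_mem (inPart P (Lp.constL 2 P ℝ b)).2 hmem)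
    exact sub_eq_zero.1 (inner_self_eq_zero.1 h2)
  have hint : ∫ ω, χ ω ∂P = (1 - outProb P) • b := by
    rw [integral_congr_ae hχ, integral_indicator_const b measurableSet_originIn, outProb,
      probReal_compl_eq_one_sub measurableSet_originIn]
    simp
  rw [heq, inner_constL, hint, inner_smul_right]

end Weak

/-! ## The Zhikov matrix and the resolvent of the microscopic operator -/

section Zhikov

variable {d : ℕ} {𝒪 : ConfigFamily d} {P : Measure (Config 𝒪)} [IsProbabilityMeasure P]
  {C₀ C₁ : Tensor d}

/-- `Z` is the resolvent of `A₀` at `l`, extended by zero outside `L²_0(Ω)`. -/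
structure IsExtendedResolvent (P : Measure (Config 𝒪)) [IsProbabilityMeasure P] (C₀ : Tensor d)
    (l : ℝ) (Z : Lp (E d) 2 P →L[ℝ] Lp (E d) 2 P) : Prop where
  mem : ∀ f, Z f ∈ L2zero P
  mem_A0 : ∀ f, ((⟨Z f, mem f⟩, inPart P f + l • ⟨Z f, mem f⟩) : L2zero P × L2zero P) ∈ A0 P C₀
  eq_of_mem : ∀ f (x : L2zero P), (x, inPart P f + l • x) ∈ A0 P C₀ → (x : Lp (E d) 2 P) = Z f
  symm : ∀ f g, ⟪Z f, g⟫ = ⟪f, Z g⟫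

theorem exists_isExtendedResolvent (h : IsFlow (T (𝒪 := 𝒪)) P) (hC₀ : C₀.IsElastic) {l : ℝ}
    (hl : l ∈ resolventSet (A0 P C₀)) : ∃ Z, IsExtendedResolvent P C₀ l Z := by
  obtain ⟨R, hR⟩ := hl
  set Z : Lp (E d) 2 P →L[ℝ] Lp (E d) 2 P := (L2zero P).subtypeL ∘L R ∘L inPart P with hZ
  have hmem : ∀ f, Z f ∈ L2zero P := fun f => (R (inPart P f)).2
  have hA : ∀ f, ((⟨Z f, hmem f⟩, inPart P f + l • ⟨Z f, hmem f⟩) : L2zero P × L2zero P) ∈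
      A0 P C₀ := fun f => (hR _ _).2 rfl
  refine ⟨Z, hmem, hA, fun f x hx => ?_, fun f g => ?_⟩
  · exact congrArg Subtype.val ((hR _ _).1 hx)
  · have h1 := (isPosSelfAdjoint_A0 h hC₀).symm _ (hA f) _ (hA g)
    simp only [inner_add_left, inner_add_right] at h1
    have e3 : ⟪l • (⟨Z f, hmem f⟩ : L2zero P), (⟨Z g, hmem g⟩ : L2zero P)⟫ =
        ⟪(⟨Z f, hmem f⟩ : L2zero P), l • (⟨Z g, hmem g⟩ : L2zero P)⟫ :=
      (real_inner_smul_left (Z f) (Z g) l).trans (real_inner_smul_right (Z f) (Z g) l).symm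
    have e1 : ⟪Z f, g⟫ = ⟪(⟨Z f, hmem f⟩ : L2zero P), inPart P g⟫ := by
      rw [real_inner_comm, ← inner_inPart g (hmem f), real_inner_comm]; rfl
    have e2 : ⟪f, Z g⟫ = ⟪inPart P f, (⟨Z g, hmem g⟩ : L2zero P)⟫ :=
      (inner_inPart f (hmem g)).symm
    rw [e1, e2]
    linarith

namespace IsExtendedResolvent

variable {l : ℝ} {Z : Lp (E d) 2 P →L[ℝ] Lp (E d) 2 P}

/-- Test functions in `H¹_0(Ω)` see only the projection of the constant `e_i` onto `L²_0(Ω)`, so the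
cell problem is the resolvent equation for that projection. -/
theorem isCellSolution_iff (hZ : IsExtendedResolvent P C₀ l Z) (i : Fin d) (b : Lp (E d) 2 P) :
    IsCellSolution P C₀ l i b ↔ b = Z (Lp.constL 2 P ℝ (e i)) := by
  have hint : ∀ b q : Lp (E d) 2 P, q ∈ L2zero P → ∫ ω, (l * ⟪b ω, q ω⟫ + ⟪e i, q ω⟫) ∂P =
      ⟪(inPart P (Lp.constL 2 P ℝ (e i)) : Lp (E d) 2 P) + l • b, q⟫ := by
    intro b q hq
    rw [inner_add_left, inner_inPart _ hq, inner_smul_left, inner_constL, L2.inner_def,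
      ← integral_inner ((Lp.memLp q).integrable (by norm_num)), integral_add, integral_const_mul,
      add_comm]
    · rfl
    · exact (L2.integrable_inner (𝕜 := ℝ) b q).const_mul l
    · exact ((Lp.memLp q).integrable (by norm_num)).const_inner (e i)
  constructor
  · rintro ⟨G, hG, h⟩
    refine hZ.eq_of_mem _ ⟨b, hG.1⟩ (mem_A0_iff.2 ⟨G, hG, fun q hq => ?_⟩)
    have h1 := h q hq
    rw [microForm_eq, hint b q.1 hq.1] at h1
    exact h1
  · rintro rfl
    obtain ⟨G, hG, h⟩ := mem_A0_iff.1 (hZ.mem_A0 (Lp.constL 2 P ℝ (e i)))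
    refine ⟨G, hG, fun q hq => ?_⟩
    rw [hint _ q.1 hq.1, microForm_eq]
    exact h q hq

theorem existsUnique_cell (hZ : IsExtendedResolvent P C₀ l Z) (i : Fin d) :
    ∃! b, IsCellSolution P C₀ l i b :=
  ⟨_, (hZ.isCellSolution_iff i _).2 rfl, fun b hb => (hZ.isCellSolution_iff i b).1 hb⟩

theorem cell_eq (hZ : IsExtendedResolvent P C₀ l Z) (i : Fin d) :
    cell P C₀ l i = Z (Lp.constL 2 P ℝ (e i)) := by
  have h : ∃ b, IsCellSolution P C₀ l i b := (hZ.existsUnique_cell i).exists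
  rw [cell, dif_pos h]
  exact (hZ.isCellSolution_iff i _).1 h.choose_spec

/-- The Zhikov matrix, applied to vectors. -/
theorem sum_zhikov (hZ : IsExtendedResolvent P C₀ l Z) (a c : E d) :
    ∑ i, ∑ j, a i * zhikov P C₀ l i j * c j =
      l * ⟪a, c⟫ + l ^ 2 * ⟪Lp.constL 2 P ℝ a, Z (Lp.constL 2 P ℝ c)⟫ := by
  have h1 : ∀ i j, zhikov P C₀ l i j = l * (if i = j then 1 else 0) +
      l ^ 2 * ⟪Lp.constL 2 P ℝ (e i), Z (Lp.constL 2 P ℝ (e j))⟫ := by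
    intro i j
    have hi : Integrable (cell P C₀ l j) P := (Lp.memLp _).integrable (by norm_num)
    have hi' : Integrable (fun ω => cell P C₀ l j ω i) P :=
      (EuclideanSpace.proj (𝕜 := ℝ) i).integrable_comp hi
    have h2 : ⟪(e i : E d), ∫ ω, cell P C₀ l j ω ∂P⟫ = ∫ ω, cell P C₀ l j ω i ∂P := by
      rw [← integral_inner hi]
      refine integral_congr_ae (Eventually.of_forall fun ω => ?_)
      simp [EuclideanSpace.inner_single_left]
    rw [← hZ.cell_eq, inner_constL, h2, zhikov, integral_add (integrable_const _)
      (hi'.const_mul _), Matrix.one_apply]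
    simp [integral_const_mul]
  have hsum : ∀ c : E d, c = ∑ i, c i • (e i : E d) := by
    intro c
    ext q
    simp [Finset.sum_apply, Pi.single_apply]
  have h3 : ⟪a, c⟫ = ∑ i, a i * c i := by
    rw [PiLp.inner_apply]
    exact Finset.sum_congr rfl fun i _ => by simp [mul_comm]
  have h4 : ⟪Lp.constL 2 P ℝ a, Z (Lp.constL 2 P ℝ c)⟫ =
      ∑ i, ∑ j, a i * c j * ⟪Lp.constL 2 P ℝ (e i), Z (Lp.constL 2 P ℝ (e j))⟫ := by
    conv_lhs => rw [hsum a, hsum c]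
    simp only [map_sum, map_smul, sum_inner, inner_sum, inner_smul_left, inner_smul_right,
      conj_trivial, Finset.mul_sum]
    rw [Finset.sum_comm]
    refine Finset.sum_congr rfl fun i _ => Finset.sum_congr rfl fun j _ => ?_
    ring
  rw [h3, h4, Finset.mul_sum, Finset.mul_sum, ← Finset.sum_add_distrib]
  refine Finset.sum_congr rfl fun i _ => ?_
  rw [Finset.mul_sum]
  have h5 : l * (a i * c i) = ∑ j, l * (if i = j then 1 else 0) * (a i * c j) := by
    simp
  rw [h5, ← Finset.sum_add_distrib]
  refine Finset.sum_congr rfl fun j _ => ?_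
  rw [h1]; ring

theorem zhikov_isSymm (hZ : IsExtendedResolvent P C₀ l Z) : (zhikov P C₀ l).IsSymm := by
  have h1 : ∀ i j, ∑ i', ∑ j', (e i : E d) i' * zhikov P C₀ l i' j' * (e j : E d) j' =
      zhikov P C₀ l i j := by
    intro i j
    simp
  refine Matrix.IsSymm.ext fun i j => ?_
  rw [← h1, ← h1, hZ.sum_zhikov, hZ.sum_zhikov, real_inner_comm (e j) (e i),
    ← hZ.symm (Lp.constL 2 P ℝ (e j)), real_inner_comm (Lp.constL 2 P ℝ (e i))]

/-- In `L²(Ω)` this is applied with `k` the constant `u₁(x)` and `g` a slice of the right-hand side.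
The inner product is the quadratic form of the Zhikov matrix plus a term of size `M‖g‖‖k‖`, which
Young's inequality absorbs into half of the negative part. -/
theorem inner_perturbation_le {X : Type*} [NormedAddCommGroup X] [InnerProductSpace ℝ X]
    (Z : X →L[ℝ] X) {l κ : ℝ} (hκ : 0 < κ) (g k : X)
    (hβ : l * ‖k‖ ^ 2 + l ^ 2 * ⟪k, Z k⟫ ≤ -(κ * ‖k‖ ^ 2)) :
    ⟪g + l • (k + (Z g + l • Z k)), k⟫ ≤
      (1 + |l| * ‖Z‖) ^ 2 / (2 * κ) * ‖g‖ ^ 2 - κ / 2 * ‖k‖ ^ 2 := by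
  set M : ℝ := 1 + |l| * ‖Z‖ with hM
  have e1 : ⟪g + l • (k + (Z g + l • Z k)), k⟫ =
      ⟪g + l • Z g, k⟫ + (l * ‖k‖ ^ 2 + l ^ 2 * ⟪k, Z k⟫) := by
    simp only [inner_add_left, real_inner_smul_left, real_inner_comm k (Z k),
      real_inner_self_eq_norm_sq]
    ring
  have e2 : ⟪g + l • Z g, k⟫ ≤ M * ‖g‖ * ‖k‖ := by
    refine (real_inner_le_norm _ _).trans (mul_le_mul_of_nonneg_right ?_ (norm_nonneg _))
    refine (norm_add_le _ _).trans ?_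
    rw [norm_smul, Real.norm_eq_abs, hM, add_mul, one_mul, mul_assoc]
    gcongr
    exact Z.le_opNorm _
  have e3 : M ^ 2 / (2 * κ) * ‖g‖ ^ 2 + κ / 2 * ‖k‖ ^ 2 - M * ‖g‖ * ‖k‖ =
      (M * ‖g‖ - κ * ‖k‖) ^ 2 / (2 * κ) := by
    field_simp; ring
  have e4 : 0 ≤ (M * ‖g‖ - κ * ‖k‖) ^ 2 / (2 * κ) := by positivity
  rw [e1]
  linarith

theorem norm_perturbation_sq_le {X : Type*} [NormedAddCommGroup X] [InnerProductSpace ℝ X]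
    (Z : X →L[ℝ] X) (l : ℝ) (g k : X) :
    ‖Z g + l • Z k‖ ^ 2 ≤ 2 * ‖Z‖ ^ 2 * ‖g‖ ^ 2 + 2 * ‖Z‖ ^ 2 * l ^ 2 * ‖k‖ ^ 2 := by
  have h2 : ‖Z g + l • Z k‖ ≤ ‖Z‖ * ‖g‖ + |l| * (‖Z‖ * ‖k‖) := by
    refine (norm_add_le _ _).trans (add_le_add (Z.le_opNorm _) ?_)
    rw [norm_smul, Real.norm_eq_abs]
    exact mul_le_mul_of_nonneg_left (Z.le_opNorm _) (abs_nonneg _)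
  have h3 := pow_le_pow_left₀ (norm_nonneg _) h2 2
  have h4 : |l| ^ 2 = l ^ 2 := sq_abs l
  have h5 : (‖Z‖ * ‖g‖ + |l| * (‖Z‖ * ‖k‖)) ^ 2 + (‖Z‖ * ‖g‖ - |l| * (‖Z‖ * ‖k‖)) ^ 2 =
      2 * ‖Z‖ ^ 2 * ‖g‖ ^ 2 + 2 * ‖Z‖ ^ 2 * |l| ^ 2 * ‖k‖ ^ 2 := by ring
  rw [h4] at h5
  linarith [sq_nonneg (‖Z‖ * ‖g‖ - |l| * (‖Z‖ * ‖k‖))]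

/-- Elimination of the microscopic unknown: in almost every slice the microscopic equation is a
resolvent equation for `A₀` with source `g + l u₁(x)`. -/
theorem ae_slice_eq (hZ : IsExtendedResolvent P C₀ l Z) (h : IsFlow (T (𝒪 := 𝒪)) P)
    {u₁ : Lp (E d) 2 (volume : Measure (E d))}
    {u₀ w g : Lp (E d) 2 ((volume : Measure (E d)).prod P)}
    {g₀ : Lp (M d) 2 ((volume : Measure (E d)).prod P)} (hu₀ : (u₀, g₀) ∈ L2H1zero P)
    (hmicro : ∀ q ∈ L2H1zero P, gradForm C₀ (volume.prod P) g₀ q.2 = ⟪w, q.1⟫)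
    (hg : w = g + l • (embed P u₁ + u₀)) :
    ∀ᵐ x : E d, slice w x = slice g x + l • (Lp.constL 2 P ℝ (u₁ x) + slice u₀ x) ∧
      slice u₀ x = Z (slice g x) + l • Z (Lp.constL 2 P ℝ (u₁ x)) := by
  have hsl : ∀ᵐ x : E d, slice w x = slice g x + l • (Lp.constL 2 P ℝ (u₁ x) + slice u₀ x) := by
    filter_upwards [slice_add g (l • (embed P u₁ + u₀)), slice_smul l (embed P u₁ + u₀),
      slice_add (embed P u₁) u₀, slice_embed (P := P) u₁] with x h1 h2 h3 h4
    rw [hg, h1, h2, h3, h4]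
  filter_upwards [hsl, ae_slice_equation h hmicro, (mem_L2H1zero_iff h).1 hu₀] with x h1 h2 h3
  refine ⟨h1, ?_⟩
  generalize slice g x = γ at *
  generalize slice w x = ω at *
  generalize slice u₀ x = v at *
  generalize Lp.constL 2 P ℝ (u₁ x) = k at *
  have h4 : v = Z (γ + l • k) := by
    refine hZ.eq_of_mem _ ⟨v, h3.1⟩ (mem_A0_iff.2 ⟨slice g₀ x, h3, fun q hq => ?_⟩)
    rw [h2 q hq, h1]
    have h5 : ⟪γ + l • (k + v), q.1⟫ = ⟪γ + l • k, q.1⟫ + ⟪l • v, q.1⟫ := by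
      rw [smul_add, ← add_assoc, inner_add_left]
    rw [h5, ← inner_inPart _ hq.1, ← inner_add_left]
    rfl
  rw [h4, map_add, map_smul]

set_option maxHeartbeats 1000000 in
/-- If the Zhikov matrix is negative definite, then the two-scale operator is bounded below. -/
theorem exists_bound_Ahom (hZ : IsExtendedResolvent P C₀ l Z) (h : IsFlow (T (𝒪 := 𝒪)) P)
    (hC₁ : ∀ ξ, 0 ≤ (Chom P C₁).contract ξ ξ) {κ : ℝ} (hκ : 0 < κ)
    (hβ : ∀ c : E d, l * ⟪c, c⟫ + l ^ 2 * ⟪Lp.constL 2 P ℝ c, Z (Lp.constL 2 P ℝ c)⟫ ≤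
      -(κ * ‖c‖ ^ 2)) :
    ∃ C, ∀ p ∈ Ahom P C₀ C₁, ‖p.1‖ ≤ C * ‖p.2 - l • p.1‖ := by
  obtain ⟨M, hM⟩ : ∃ M : ℝ, M = 1 + |l| * ‖Z‖ := ⟨_, rfl⟩
  -- `a` and `b` bound `‖u₁‖²` and `‖u₀‖²` in terms of `‖g‖²`; the factor `2` in the final constant
  -- is from `(x + y)² ≤ 2x² + 2y²`.
  set a : ℝ := (M / κ) ^ 2 with ha
  set b : ℝ := 2 * ‖Z‖ ^ 2 * (1 + l ^ 2 * a) with hb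
  refine ⟨√(2 * (a + b)), fun p hp => ?_⟩
  obtain ⟨u₁, g₁, u₀, g₀, hu₁, hu₀, hp1, hp2⟩ := mem_Ahom_iff.1 hp
  obtain ⟨w, hw⟩ : ∃ w : Lp (E d) 2 ((volume : Measure (E d)).prod P), w = p.2.1 := ⟨_, rfl⟩
  obtain ⟨g, hg⟩ : ∃ g, w = g + l • (embed P u₁ + u₀) := ⟨w - l • (embed P u₁ + u₀), by abel⟩
  rw [← hw] at hp2
  have hmicro : ∀ q ∈ L2H1zero P, gradForm C₀ (volume.prod P) g₀ q.2 = ⟪w, q.1⟫ := by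
    intro q hq
    have := hp2 0 zero_mem_H1 q hq
    simpa using this
  -- Testing with `u₁` itself identifies this inner product with the macroscopic energy.
  have hnonneg : 0 ≤ ⟪w, embed P u₁⟫ := by
    have := hp2 _ hu₁ 0 (zero_mem_L2H1zero h)
    simp only [Prod.snd_zero, Prod.fst_zero, map_zero, add_zero] at this
    rw [← this]
    exact gradForm_self_nonneg hC₁ g₁
  have hsl := hZ.ae_slice_eq h hu₀ hmicro hg
  have hpt : ∀ᵐ x : E d, ⟪slice w x, slice (embed P u₁) x⟫ ≤
      M ^ 2 / (2 * κ) * ‖slice g x‖ ^ 2 - κ / 2 * ‖u₁ x‖ ^ 2 := by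
    filter_upwards [hsl, slice_embed (P := P) u₁] with x ⟨h1, h2⟩ h3
    have hn : ‖Lp.constL 2 P ℝ (u₁ x)‖ = ‖u₁ x‖ := norm_constL _
    have h5 : l * ‖Lp.constL 2 P ℝ (u₁ x)‖ ^ 2 + l ^ 2 * ⟪Lp.constL 2 P ℝ (u₁ x),
        Z (Lp.constL 2 P ℝ (u₁ x))⟫ ≤ -(κ * ‖Lp.constL 2 P ℝ (u₁ x)‖ ^ 2) := by
      rw [hn, ← real_inner_self_eq_norm_sq (u₁ x)]
      exact (hβ (u₁ x)).trans_eq (by rw [real_inner_self_eq_norm_sq])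
    have h4 := inner_perturbation_le Z hκ (slice g x) _ h5
    rw [← hM] at h4
    rw [h3, h1, h2]
    exact h4.trans_eq (by rw [hn])
  have hu1i : Integrable fun x => ‖u₁ x‖ ^ 2 := (Lp.memLp u₁).integrable_norm_pow (by norm_num)
  have hu1 : ‖u₁‖ ^ 2 ≤ a * ‖g‖ ^ 2 := by
    rw [← (integrable_inner_slice _ _).2] at hnonneg
    have h1 := integral_mono_ae (integrable_inner_slice w (embed P u₁)).1
      (((integrable_norm_slice_sq g).const_mul _).sub (hu1i.const_mul _)) hpt
    rw [Pi.sub_def, integral_sub ((integrable_norm_slice_sq g).const_mul _) (hu1i.const_mul _),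
      integral_const_mul, integral_const_mul, integral_norm_slice_sq, ← norm_toLp_sq] at h1
    have h2 : κ / 2 * ‖u₁‖ ^ 2 ≤ M ^ 2 / (2 * κ) * ‖g‖ ^ 2 := by linarith
    have h3 : a * ‖g‖ ^ 2 = 2 / κ * (M ^ 2 / (2 * κ) * ‖g‖ ^ 2) := by
      rw [ha]; field_simp
    have h4 : ‖u₁‖ ^ 2 = 2 / κ * (κ / 2 * ‖u₁‖ ^ 2) := by field_simp
    rw [h3, h4]
    exact mul_le_mul_of_nonneg_left h2 (by positivity)
  have hu0 : ‖u₀‖ ^ 2 ≤ b * ‖g‖ ^ 2 := by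
    have h1 : ‖u₀‖ ^ 2 ≤ 2 * ‖Z‖ ^ 2 * ‖g‖ ^ 2 + 2 * ‖Z‖ ^ 2 * l ^ 2 * ‖u₁‖ ^ 2 := by
      rw [← integral_norm_slice_sq u₀, ← integral_norm_slice_sq g, norm_toLp_sq u₁,
        ← integral_const_mul, ← integral_const_mul, ← integral_add
          ((integrable_norm_slice_sq g).const_mul _) (hu1i.const_mul _)]
      refine integral_mono_ae (integrable_norm_slice_sq u₀)
        (((integrable_norm_slice_sq g).const_mul _).add (hu1i.const_mul _)) ?_
      filter_upwards [hsl] with x ⟨_, hx⟩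
      have h2 := norm_perturbation_sq_le Z l (slice g x) (Lp.constL 2 P ℝ (u₁ x))
      rw [norm_constL, ← hx] at h2
      exact h2
    rw [hb]
    nlinarith [mul_le_mul_of_nonneg_left hu1 (by positivity : 0 ≤ 2 * ‖Z‖ ^ 2 * l ^ 2)]
  have hnorm1 : ‖p.1‖ = ‖embed P u₁ + u₀‖ := by rw [Submodule.coe_norm, hp1]
  have hnorm2 : ‖p.2 - l • p.1‖ = ‖g‖ := by
    rw [Submodule.coe_norm, Submodule.coe_sub, Submodule.coe_smul, hp1, ← hw, hg, add_sub_cancel_right]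
  rw [hnorm1, hnorm2]
  refine le_of_sq_le_sq ?_ (by positivity)
  have hb0 : 0 ≤ b := by positivity
  rw [mul_pow, Real.sq_sqrt (by positivity)]
  have h1 : ‖embed P u₁ + u₀‖ ≤ ‖u₁‖ + ‖u₀‖ := by
    rw [← norm_embed (P := P) u₁]; exact norm_add_le _ _
  nlinarith [norm_nonneg (embed P u₁ + u₀), sq_nonneg (‖u₁‖ - ‖u₀‖),
    pow_le_pow_left₀ (norm_nonneg _) h1 2]

end IsExtendedResolvent

end Zhikov

/-! ## Oscillating quasimodes -/

section Quasimode

variable {d : ℕ}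

/-- The plane wave with wave vector `k` and phase `θ`. -/
noncomputable def wave (k : E d) (θ : ℝ) (x : E d) : ℝ := Real.cos (⟪k, x⟫ + θ)

theorem contDiff_wave (k : E d) (θ : ℝ) : ContDiff ℝ (⊤ : ℕ∞) (wave k θ) :=
  Real.contDiff_cos.comp ((contDiff_const.inner ℝ contDiff_id).add contDiff_const)

theorem pd_wave (k : E d) (θ : ℝ) (i : Fin d) (x : E d) :
    pd i (wave k θ) x = k i * wave k (θ + Real.pi / 2) x := by
  have h1 : HasFDerivAt (fun x : E d => ⟪k, x⟫ + θ) (innerSL ℝ k) x :=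
    (innerSL ℝ k).hasFDerivAt.add_const θ
  have h2 : HasFDerivAt (wave k θ) _ x := h1.cos
  rw [pd, h2.fderiv, wave, ← add_assoc, Real.cos_add_pi_div_two]
  simp [EuclideanSpace.inner_single_right, mul_comm]

theorem wave_add_pi (k : E d) (θ : ℝ) (x : E d) :
    wave k (θ + Real.pi / 2 + Real.pi / 2) x = -wave k θ x := by
  rw [wave, wave, ← Real.cos_add_pi]; congr 1; ring

theorem wave_sq_add (k : E d) (θ : ℝ) (x : E d) :
    wave k θ x ^ 2 + wave k (θ + Real.pi / 2) x ^ 2 = 1 := by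
  rw [wave, wave, ← add_assoc, Real.cos_add_pi_div_two, neg_sq, Real.cos_sq_add_sin_sq]

theorem pd_add_mul {f g : E d → ℝ} (hf : ContDiff ℝ (⊤ : ℕ∞) f) (hg : ContDiff ℝ (⊤ : ℕ∞) g)
    (r : ℝ) (i : Fin d) (y : E d) :
    pd i (fun z => f z + r * g z) y = pd i f y + r * pd i g y := by
  have h := ((hf.differentiable (by simp)) y).hasFDerivAt.add
    (((hg.differentiable (by simp)) y).hasFDerivAt.const_mul r)
  rw [pd, HasFDerivAt.fderiv (f := fun z => f z + r * g z) h]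
  simp only [FunLike.coe_add, Pi.add_apply, FunLike.coe_smul, Pi.smul_apply, smul_eq_mul, pd]

theorem pd_mul_wave {a : E d → ℝ} (ha : ContDiff ℝ (⊤ : ℕ∞) a) (k : E d) (θ : ℝ) (i : Fin d) :
    pd i (fun y => a y * wave k θ y) =
      fun y => pd i a y * wave k θ y + k i * (a y * wave k (θ + Real.pi / 2) y) := by
  ext y
  rw [pd_mul ha (contDiff_wave k θ), pd_wave]; ring

theorem pd_pd_mul_wave {a : E d → ℝ} (ha : ContDiff ℝ (⊤ : ℕ∞) a) (k : E d) (θ : ℝ) (i j : Fin d)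
    (y : E d) :
    pd i (pd j fun y => a y * wave k θ y) y + k i * k j * (a y * wave k θ y) =
      pd i (pd j a) y * wave k θ y +
        (k i * pd j a y + k j * pd i a y) * wave k (θ + Real.pi / 2) y := by
  rw [pd_mul_wave ha, pd_add_mul ((contDiff_pd ha j).mul (contDiff_wave k θ))
    (ha.mul (contDiff_wave k _)), pd_mul_wave (contDiff_pd ha j), pd_mul_wave ha]
  beta_reduce
  rw [wave_add_pi]
  ring

theorem pd_pd_comp_smul {χ : E d → ℝ} (hχ : ContDiff ℝ (⊤ : ℕ∞) χ) (r : ℝ) (i j : Fin d) (x : E d) :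
    pd i (pd j fun x => χ (r • x)) x = r ^ 2 * pd i (pd j χ) (r • x) := by
  have h0 : (pd j fun x => χ (r • x)) = fun x => 0 + r * pd j χ (r • x) := by
    ext x; rw [pd_comp_smul hχ r j x, zero_add]
  have h1 : ContDiff ℝ (⊤ : ℕ∞) fun x : E d => pd j χ (r • x) :=
    (contDiff_pd hχ j).comp (contDiff_id.const_smul r)
  have h3 : pd i (fun _ : E d => (0 : ℝ)) x = 0 := by simp [pd]
  rw [h0, pd_add_mul contDiff_const h1, pd_comp_smul (contDiff_pd hχ j), h3]
  ring

/-- Summing over two phases that differ by `π / 2` removes the oscillation through `cos² + sin² =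
1`. What is left depends on `r • x` alone and scales exactly. -/
theorem residual_sq_add {χ : E d → ℝ} (hχ : ContDiff ℝ (⊤ : ℕ∞) χ) (k : E d) (r : ℝ)
    (i j : Fin d) (x : E d) :
    (pd i (pd j fun y => χ (r • y) * wave k 0 y) x + k i * k j * (χ (r • x) * wave k 0 x)) ^ 2 +
      (pd i (pd j fun y => χ (r • y) * wave k (0 + Real.pi / 2) y) x +
        k i * k j * (χ (r • x) * wave k (0 + Real.pi / 2) x)) ^ 2 =
    r ^ 4 * pd i (pd j χ) (r • x) ^ 2 +
      r ^ 2 * (k i * pd j χ (r • x) + k j * pd i χ (r • x)) ^ 2 := by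
  have ha : ContDiff ℝ (⊤ : ℕ∞) fun x : E d => χ (r • x) := hχ.comp (contDiff_id.const_smul r)
  rw [pd_pd_mul_wave ha, pd_pd_mul_wave ha, wave_add_pi, pd_pd_comp_smul hχ, pd_comp_smul hχ,
    pd_comp_smul hχ]
  linear_combination (r ^ 4 * pd i (pd j χ) (r • x) ^ 2 +
      r ^ 2 * (k i * pd j χ (r • x) + k j * pd i χ (r • x)) ^ 2) * wave_sq_add k 0 x

theorem integrable_sq_of_hasCompactSupport {f : E d → ℝ} (hf : Continuous f)
    (hc : HasCompactSupport f) : Integrable fun x => f x ^ 2 := by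
  simp only [pow_two]
  exact (hf.mul hf).integrable_of_hasCompactSupport hc.mul_left

/-- Slowly modulated plane waves are approximate eigenfunctions of the second derivatives. -/
theorem exists_quasimode (k : E d) {δ : ℝ} (hδ : 0 < δ) :
    ∃ h : E d → ℝ, ContDiff ℝ (⊤ : ℕ∞) h ∧ HasCompactSupport h ∧ 0 < ∫ x, h x ^ 2 ∧
      ∀ i j, ∫ x, (pd i (pd j h) x + k i * k j * h x) ^ 2 ≤ δ * ∫ x, h x ^ 2 := by
  obtain ⟨χ, hχ, hχc, hχ0⟩ : ∃ χ : E d → ℝ, ContDiff ℝ (⊤ : ℕ∞) χ ∧ HasCompactSupport χ ∧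
      χ 0 ≠ 0 := by
    let f : ContDiffBump (0 : E d) := default
    refine ⟨f, f.contDiff, f.hasCompactSupport, ?_⟩
    rw [f.one_of_mem_closedBall (by simpa using f.rIn_pos.le)]
    exact one_ne_zero
  have hN : 0 < ∫ x, χ x ^ 2 := by
    simp only [pow_two]
    exact (hχ.continuous.mul hχ.continuous).integral_pos_of_hasCompactSupport_nonneg_nonzero
      hχc.mul_left (fun x => mul_self_nonneg _) (x := 0) (mul_self_ne_zero.2 hχ0)
  obtain ⟨F, hF⟩ : ∃ F : Fin d → Fin d → ℝ, ∀ i j, F i j = ∫ x, pd i (pd j χ) x ^ 2 :=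
    ⟨_, fun _ _ => rfl⟩
  obtain ⟨G, hG⟩ : ∃ G : Fin d → Fin d → ℝ, ∀ i j,
      G i j = ∫ x, (k i * pd j χ x + k j * pd i χ x) ^ 2 := ⟨_, fun _ _ => rfl⟩
  have hF0 : ∀ i j, 0 ≤ F i j := fun i j => hF i j ▸ integral_nonneg fun x => sq_nonneg _
  have hG0 : ∀ i j, 0 ≤ G i j := fun i j => hG i j ▸ integral_nonneg fun x => sq_nonneg _
  obtain ⟨K, hK⟩ : ∃ K : ℝ, K = ∑ i, ∑ j, (F i j + G i j) := ⟨_, rfl⟩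
  have hK0 : 0 ≤ K := hK ▸ Finset.sum_nonneg fun i _ => Finset.sum_nonneg fun j _ =>
    add_nonneg (hF0 i j) (hG0 i j)
  obtain ⟨N, hNdef⟩ : ∃ N : ℝ, N = ∫ x, χ x ^ 2 := ⟨_, rfl⟩
  rw [← hNdef] at hN
  -- A slow modulation: residuals carry `r²` or `r⁴`, both at most `r`, so a small `r` beats the
  -- prescribed tolerance.
  obtain ⟨r, hr0, hr1, hrK⟩ : ∃ r : ℝ, 0 < r ∧ r ≤ 1 ∧ r * K < δ * N := by
    refine ⟨min 1 (δ * N / (K + 1)), by positivity, min_le_left _ _, ?_⟩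
    calc min 1 (δ * N / (K + 1)) * K ≤ δ * N / (K + 1) * K :=
          mul_le_mul_of_nonneg_right (min_le_right _ _) hK0
      _ < δ * N := by
          rw [div_mul_eq_mul_div, div_lt_iff₀ (by positivity)]
          exact mul_lt_mul_of_pos_left (by linarith) (by positivity)
  have ha : ContDiff ℝ (⊤ : ℕ∞) fun x : E d => χ (r • x) := hχ.comp (contDiff_id.const_smul r)
  have hac : HasCompactSupport fun x : E d => χ (r • x) :=
    hχc.comp_homeomorph (Homeomorph.smulOfNeZero r hr0.ne')
  obtain ⟨D, hD0, hscale⟩ : ∃ D : ℝ, 0 < D ∧ ∀ f : E d → ℝ, ∫ x, f (r • x) = D * ∫ x, f x :=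
    ⟨|(r ^ Module.finrank ℝ (E d))⁻¹|, by positivity, fun f =>
      Measure.integral_comp_smul volume f r⟩
  obtain ⟨H, hH⟩ : ∃ H : ℝ → E d → ℝ, ∀ θ, H θ = fun x => χ (r • x) * wave k θ x :=
    ⟨_, fun _ => rfl⟩
  have hHs : ∀ θ, ContDiff ℝ (⊤ : ℕ∞) (H θ) := fun θ => hH θ ▸ ha.mul (contDiff_wave k θ)
  have hHc : ∀ θ, HasCompactSupport (H θ) := fun θ => hH θ ▸ hac.mul_right
  obtain ⟨R, hR⟩ : ∃ R : ℝ → Fin d → Fin d → E d → ℝ, ∀ θ i j,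
      R θ i j = fun x => pd i (pd j (H θ)) x + k i * k j * H θ x := ⟨_, fun _ _ _ => rfl⟩
  have hRi : ∀ θ i j, Integrable fun x => R θ i j x ^ 2 := fun θ i j => by
    rw [hR]
    exact integrable_sq_of_hasCompactSupport
      ((contDiff_pd (contDiff_pd (hHs θ) j) i).continuous.add ((hHs θ).continuous.const_mul _))
      ((hasCompactSupport_pd (hasCompactSupport_pd (hHc θ) j) i).add (hHc θ).mul_left)
  have hHi : ∀ θ, Integrable fun x => H θ x ^ 2 := fun θ =>
    integrable_sq_of_hasCompactSupport (hHs θ).continuous (hHc θ)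
  have hsumH : (∫ x, H 0 x ^ 2) + ∫ x, H (0 + Real.pi / 2) x ^ 2 = D * N := by
    rw [← integral_add (hHi _) (hHi _), hNdef, ← hscale fun x => χ x ^ 2]
    refine integral_congr_ae (Eventually.of_forall fun x => ?_)
    have := wave_sq_add k 0 x
    simp only [hH, mul_pow]
    rw [← mul_add, this, mul_one]
  have hsumR : ∀ i j, (∫ x, R 0 i j x ^ 2) + ∫ x, R (0 + Real.pi / 2) i j x ^ 2 ≤
      D * (r * (F i j + G i j)) := by
    intro i j
    have hFi : Integrable fun x => pd i (pd j χ) x ^ 2 :=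
      integrable_sq_of_hasCompactSupport (contDiff_pd (contDiff_pd hχ j) i).continuous
        (hasCompactSupport_pd (hasCompactSupport_pd hχc j) i)
    have hGi : Integrable fun x => (k i * pd j χ x + k j * pd i χ x) ^ 2 :=
      integrable_sq_of_hasCompactSupport
        (((contDiff_pd hχ j).continuous.const_mul _).add
          ((contDiff_pd hχ i).continuous.const_mul _))
        ((hasCompactSupport_pd hχc j).mul_left.add (hasCompactSupport_pd hχc i).mul_left)
    have h1 : (∫ x, R 0 i j x ^ 2) + ∫ x, R (0 + Real.pi / 2) i j x ^ 2 =
        D * ∫ x, (r ^ 4 * pd i (pd j χ) x ^ 2 +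
          r ^ 2 * (k i * pd j χ x + k j * pd i χ x) ^ 2) := by
      rw [← integral_add (hRi _ _ _) (hRi _ _ _), ← hscale fun x => r ^ 4 * pd i (pd j χ) x ^ 2 +
          r ^ 2 * (k i * pd j χ x + k j * pd i χ x) ^ 2]
      refine integral_congr_ae (Eventually.of_forall fun x => ?_)
      rw [hR, hR, hH, hH]
      exact residual_sq_add hχ k r i j x
    rw [h1, integral_add (hFi.const_mul _) (hGi.const_mul _), integral_const_mul,
      integral_const_mul, ← hF, ← hG, mul_add r]
    have h2 : r ^ 2 ≤ r := pow_le_of_le_one hr0.le hr1 two_ne_zero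
    have h4 : r ^ 4 ≤ r := pow_le_of_le_one hr0.le hr1 four_ne_zero
    exact mul_le_mul_of_nonneg_left (add_le_add (mul_le_mul_of_nonneg_right h4 (hF0 i j))
      (mul_le_mul_of_nonneg_right h2 (hG0 i j))) hD0.le
  -- The estimate holds for the sum over the two phases, so at least one phase satisfies it. As it
  -- is strict, that wave is also nonzero.
  obtain ⟨θ, hθ⟩ : ∃ θ, ∑ i, ∑ j, ∫ x, R θ i j x ^ 2 < δ * ∫ x, H θ x ^ 2 := by
    by_contra! hcon
    have h1 := add_le_add (hcon 0) (hcon (0 + Real.pi / 2))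
    rw [← mul_add, hsumH, ← Finset.sum_add_distrib] at h1
    simp only [← Finset.sum_add_distrib] at h1
    have h2 : ∑ i, ∑ j, ((∫ x, R 0 i j x ^ 2) + ∫ x, R (0 + Real.pi / 2) i j x ^ 2) ≤
        D * (r * K) := by
      rw [hK]
      simp only [Finset.mul_sum]
      exact Finset.sum_le_sum fun i _ => Finset.sum_le_sum fun j _ => hsumR i j
    have h3 : D * (r * K) < D * (δ * N) := mul_lt_mul_of_pos_left hrK hD0
    linarith
  have hR0 : ∀ i j, 0 ≤ ∫ x, R θ i j x ^ 2 := fun i j => integral_nonneg fun x => sq_nonneg _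
  refine ⟨H θ, hHs θ, hHc θ, ?_, fun i j => ?_⟩
  · have h1 : 0 < δ * ∫ x, H θ x ^ 2 := lt_of_le_of_lt
      (Finset.sum_nonneg fun i _ => Finset.sum_nonneg fun j _ => hR0 i j) hθ
    exact (mul_pos_iff_of_pos_left hδ).1 h1
  · have hRij : ∫ x, (pd i (pd j (H θ)) x + k i * k j * H θ x) ^ 2 = ∫ x, R θ i j x ^ 2 := by
      rw [hR]
    rw [hRij]
    refine le_trans ?_ hθ.le
    refine le_trans ?_ (Finset.single_le_sum (f := fun i => ∑ j, ∫ x, R θ i j x ^ 2)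
      (fun i _ => Finset.sum_nonneg fun j _ => hR0 i j) (Finset.mem_univ i))
    exact Finset.single_le_sum (f := fun j => ∫ x, R θ i j x ^ 2) (fun j _ => hR0 i j)
      (Finset.mem_univ j)

end Quasimode

/-! ## Elementary tensors -/

section TensorProduct

variable {α β F : Type*} [MeasurableSpace α] [MeasurableSpace β] {μ : Measure α} {ν : Measure β}
  [SFinite μ] [SFinite ν] [NormedAddCommGroup F] [InnerProductSpace ℝ F]

theorem tprod_add (g : Lp ℝ 2 μ) (v w : Lp F 2 ν) : tprod g (v + w) = tprod g v + tprod g w := by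
  refine slice_ext ?_
  filter_upwards [slice_tprod g v, slice_tprod g w, slice_tprod g (v + w),
    slice_add (tprod g v) (tprod g w)] with x h1 h2 h3 h4
  rw [h3, h4, h1, h2, smul_add]

theorem tprod_smul (g : Lp ℝ 2 μ) (c : ℝ) (v : Lp F 2 ν) : tprod g (c • v) = c • tprod g v := by
  refine slice_ext ?_
  filter_upwards [slice_tprod g v, slice_tprod g (c • v), slice_smul c (tprod g v)] with x h1 h2 h3
  rw [h2, h3, h1, smul_comm]

theorem add_tprod (g g' : Lp ℝ 2 μ) (v : Lp F 2 ν) : tprod (g + g') v = tprod g v + tprod g' v := by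
  refine slice_ext ?_
  filter_upwards [slice_tprod g v, slice_tprod g' v, slice_tprod (g + g') v,
    slice_add (tprod g v) (tprod g' v), Lp.coeFn_add g g'] with x h1 h2 h3 h4 h5
  rw [h3, h4, h1, h2, h5, Pi.add_apply, add_smul]

theorem smul_tprod (c : ℝ) (g : Lp ℝ 2 μ) (v : Lp F 2 ν) : tprod (c • g) v = c • tprod g v := by
  refine slice_ext ?_
  filter_upwards [slice_tprod g v, slice_tprod (c • g) v, slice_smul c (tprod g v),
    Lp.coeFn_smul c g] with x h1 h2 h3 h4
  rw [h2, h3, h1, h4, Pi.smul_apply, smul_assoc]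

/-- The elementary tensor as a linear map of its second factor. -/
noncomputable def tprodₗ (g : Lp ℝ 2 μ) : Lp F 2 ν →ₗ[ℝ] Lp F 2 (μ.prod ν) where
  toFun := tprod g
  map_add' := tprod_add g
  map_smul' := tprod_smul g

theorem tprodₗ_apply (g : Lp ℝ 2 μ) (v : Lp F 2 ν) : tprodₗ g v = tprod g v := rfl

end TensorProduct

/-! ## The acoustic tensor -/

namespace Tensor

variable {d : ℕ} (C : Tensor d)

/-- The matrix `C_{αβμν}` in the indices `β, ν`. -/
noncomputable def slot (α μ : Fin d) : E d →L[ℝ] E d :=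
  LinearMap.toContinuousLinearMap
    { toFun := fun c => WithLp.toLp 2 fun β => ∑ ν, C α β μ ν * c ν
      map_add' := fun c c' => by
        ext β; simp [mul_add, Finset.sum_add_distrib]
      map_smul' := fun r c => by
        ext β; simp [Finset.mul_sum, mul_left_comm] }

theorem slot_apply (α μ : Fin d) (c : E d) (β : Fin d) : C.slot α μ c β = ∑ ν, C α β μ ν * c ν := rfl

/-- The acoustic tensor `C_{αβμν} k_α k_μ`. -/
noncomputable def acoustic (k : E d) : E d →L[ℝ] E d := ∑ α, ∑ μ, (k α * k μ) • C.slot α μ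

theorem acoustic_apply (k c : E d) : C.acoustic k c = ∑ α, ∑ μ, (k α * k μ) • C.slot α μ c := by
  simp [acoustic]

end Tensor

section Dyad

variable {d : ℕ}

/-- The dyadic product `k ⊗ c`. -/
noncomputable def dyad (k c : E d) : M d := WithLp.toLp 2 fun p => k p.1 * c p.2

theorem inner_acoustic (C : Tensor d) (k c b : E d) :
    ⟪C.acoustic k c, b⟫ = C.contract (dyad k c) (dyad k b) := by
  have h1 : ∀ α β, (∑ μ, (k α * k μ) • C.slot α μ c) β * b β =
      ∑ μ, ∑ ν, C α β μ ν * dyad k c (μ, ν) * dyad k b (α, β) := by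
    intro α β
    simp only [WithLp.ofLp_sum, Finset.sum_apply, PiLp.smul_apply, smul_eq_mul,
      Tensor.slot_apply, Finset.mul_sum, Finset.sum_mul, dyad]
    refine Finset.sum_congr rfl fun μ _ => Finset.sum_congr rfl fun ν _ => ?_
    ring
  rw [C.acoustic_apply, sum_inner, Tensor.contract]
  refine Finset.sum_congr rfl fun α _ => ?_
  rw [PiLp.inner_apply]
  refine Finset.sum_congr rfl fun β _ => ?_
  rw [← h1]
  exact mul_comm _ _

/-- Dyads are never skew: `2‖sym(k ⊗ c)‖² = ‖k‖²‖c‖² + (k · c)²`. Coercivity on symmetric parts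
therefore makes the acoustic tensor positive definite. -/
theorem mul_norm_sq_le_symPart_dyad (k c : E d) :
    ‖k‖ ^ 2 * ‖c‖ ^ 2 / 2 ≤ ‖symPart (dyad k c)‖ ^ 2 := by
  have h1 : ‖symPart (dyad k c)‖ ^ 2 = (‖k‖ ^ 2 * ‖c‖ ^ 2 + ⟪k, c⟫ ^ 2) / 2 := by
    have e1 : ‖k‖ ^ 2 = ∑ i, k i ^ 2 := EuclideanSpace.real_norm_sq_eq k
    have e2 : ‖c‖ ^ 2 = ∑ i, c i ^ 2 := EuclideanSpace.real_norm_sq_eq c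
    have e3 : ⟪k, c⟫ = ∑ i, k i * c i := by
      rw [PiLp.inner_apply]; exact Finset.sum_congr rfl fun i _ => mul_comm _ _
    have e4 : ‖k‖ ^ 2 * ‖c‖ ^ 2 = ∑ i, ∑ j, k j ^ 2 * c i ^ 2 := by
      rw [e1, e2, Finset.sum_mul_sum, Finset.sum_comm]
    have e5 : ‖k‖ ^ 2 * ‖c‖ ^ 2 = ∑ i, ∑ j, k i ^ 2 * c j ^ 2 := by
      rw [e1, e2, Finset.sum_mul_sum]
    have e6 : ⟪k, c⟫ ^ 2 = ∑ i, ∑ j, k i * c i * (k j * c j) := by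
      rw [e3, pow_two, Finset.sum_mul_sum]
    have e7 : ‖symPart (dyad k c)‖ ^ 2 = ∑ i, ∑ j, (k i ^ 2 * c j ^ 2 / 4 + k j ^ 2 * c i ^ 2 / 4 +
        k i * c i * (k j * c j) / 2) := by
      rw [norm_sq_matrix]
      refine Finset.sum_congr rfl fun i _ => Finset.sum_congr rfl fun j _ => ?_
      rw [symPart_apply]
      simp only [dyad]
      ring
    rw [e7]
    simp only [Finset.sum_add_distrib, ← Finset.sum_div]
    rw [← e4, ← e5, ← e6]
    ring
  rw [h1]
  nlinarith [sq_nonneg ⟪k, c⟫]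

end Dyad

/-! ## Smooth test fields -/

section TestField

variable {d : ℕ}

/-- A continuous function with compact support as an element of `L²`. -/
noncomputable def toL2 {h : E d → ℝ} (hh : Continuous h) (hc : HasCompactSupport h) :
    Lp ℝ 2 (volume : Measure (E d)) := (hh.memLp_of_hasCompactSupport hc).toLp h

theorem coeFn_toL2 {h : E d → ℝ} (hh : Continuous h) (hc : HasCompactSupport h) :
    toL2 hh hc =ᵐ[volume] h := MemLp.coeFn_toLp _

theorem norm_sq_toL2 {h : E d → ℝ} (hh : Continuous h) (hc : HasCompactSupport h) :
    ‖toL2 hh hc‖ ^ 2 = ∫ x, h x ^ 2 := by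
  rw [norm_toLp_sq]
  refine integral_congr_ae ?_
  filter_upwards [coeFn_toL2 hh hc] with x hx
  rw [hx, Real.norm_eq_abs, sq_abs]

/-- Multiples of a fixed vector by a test function belong to `H¹(ℝ^d)`, and the form can be
integrated by parts against them. -/
theorem exists_mem_H1_smul (C : Tensor d) {h : E d → ℝ} (hh : ContDiff ℝ (⊤ : ℕ∞) h)
    (hc : HasCompactSupport h) (c : E d) :
    ∃ p ∈ H1 d, (p.1 =ᵐ[volume] fun x => h x • c) ∧ ∀ q ∈ H1 d, gradForm C volume p.2 q.2 =
      -∑ α, ∑ μ, ∫ x, pd α (pd μ h) x * ⟪C.slot α μ c, q.1 x⟫ := by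
  set G : E d → M d := fun x => WithLp.toLp 2 fun p => pd p.1 h x * c p.2 with hG
  have hGc : Continuous G := (PiLp.continuous_toLp 2 _).comp
    (continuous_pi fun p => (contDiff_pd hh p.1).continuous.mul continuous_const)
  have hGs : HasCompactSupport G := by
    refine HasCompactSupport.intro hc fun x hx => ?_
    ext p
    have : pd p.1 h x = 0 :=
      image_eq_zero_of_notMem_tsupport fun h' => hx (tsupport_pd_subset h p.1 h')
    simp [hG, this]
  have hu : Continuous fun x => h x • c := hh.continuous.smul continuous_const
  have hus : HasCompactSupport fun x => h x • c := hc.smul_right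
  have hum := hu.memLp_of_hasCompactSupport (μ := volume) (p := 2) hus
  have hGm := hGc.memLp_of_hasCompactSupport (μ := volume) (p := 2) hGs
  have hwg : HasWeakGrad (fun x => h x • c) G := by
    refine ⟨hu.locallyIntegrable, hGc.locallyIntegrable, fun φ hφ hφc μ ν => ?_⟩
    have h1 := integral_pd_mul hh hφ hφc μ
    have h2 : ∀ y, (h y • c) ν * fderiv ℝ φ y (e μ) = c ν * (h y * pd μ φ y) := fun y => by
      simp only [PiLp.smul_apply, smul_eq_mul, pd]; ring
    have h3 : ∀ y, G y (μ, ν) * φ y = c ν * (pd μ h y * φ y) := fun y => by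
      simp only [hG]; ring
    simp only [h2, h3, integral_const_mul, h1, mul_neg]
  refine ⟨(hum.toLp _, hGm.toLp _), hwg.congr hum.coeFn_toLp.symm hGm.coeFn_toLp.symm,
    hum.coeFn_toLp, fun q hq => ?_⟩
  have hq2 : ∀ α β, MemLp (fun x => q.2 x (α, β)) 2 volume := fun α β =>
    (EuclideanSpace.proj (𝕜 := ℝ) (α, β)).comp_memLp' (Lp.memLp q.2)
  have hq1 : ∀ β, MemLp (fun x => q.1 x β) 2 volume := fun β =>
    (EuclideanSpace.proj (𝕜 := ℝ) β).comp_memLp' (Lp.memLp q.1)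
  have hpd : ∀ μ, MemLp (pd μ h) 2 volume := fun μ =>
    (contDiff_pd hh μ).continuous.memLp_of_hasCompactSupport (hasCompactSupport_pd hc μ)
  have hppd : ∀ α μ, MemLp (pd α (pd μ h)) 2 volume := fun α μ =>
    (contDiff_pd (contDiff_pd hh μ) α).continuous.memLp_of_hasCompactSupport
      (hasCompactSupport_pd (hasCompactSupport_pd hc μ) α)
  have hparts : ∀ α β μ, ∫ x, pd μ h x * q.2 x (α, β) = -∫ x, pd α (pd μ h) x * q.1 x β := by
    intro α β μ
    have := hq.2.2 (pd μ h) (contDiff_pd hh μ) (hasCompactSupport_pd hc μ) α β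
    simp only [mul_comm (pd μ h _), mul_comm (pd α (pd μ h) _)]
    rw [← neg_eq_iff_eq_neg, ← this]
    rfl
  have hlhs : gradForm C volume (hGm.toLp G) q.2 =
      ∑ α, ∑ β, ∑ μ, ∑ ν, C α β μ ν * c ν * ∫ x, pd μ h x * q.2 x (α, β) := by
    rw [gradForm_apply]
    have h1 : ∀ᵐ x, C.contract (hGm.toLp G x) (q.2 x) =
        ∑ α, ∑ β, ∑ μ, ∑ ν, C α β μ ν * c ν * (pd μ h x * q.2 x (α, β)) := by
      filter_upwards [hGm.coeFn_toLp] with x hx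
      rw [hx, Tensor.contract]
      refine Finset.sum_congr rfl fun α _ => Finset.sum_congr rfl fun β _ =>
        Finset.sum_congr rfl fun μ _ => Finset.sum_congr rfl fun ν _ => ?_
      simp only [hG]; ring
    have hi : ∀ α β μ, Integrable fun x => pd μ h x * q.2 x (α, β) := fun α β μ =>
      (hpd μ).integrable_mul (hq2 α β)
    rw [integral_congr_ae h1, integral_finsetSum _ fun α _ => integrable_finsetSum _ fun β _ =>
      integrable_finsetSum _ fun μ _ => integrable_finsetSum _ fun ν _ => (hi α β μ).const_mul _]
    refine Finset.sum_congr rfl fun α _ => ?_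
    rw [integral_finsetSum _ fun β _ => integrable_finsetSum _ fun μ _ =>
      integrable_finsetSum _ fun ν _ => (hi α β μ).const_mul _]
    refine Finset.sum_congr rfl fun β _ => ?_
    rw [integral_finsetSum _ fun μ _ => integrable_finsetSum _ fun ν _ => (hi α β μ).const_mul _]
    refine Finset.sum_congr rfl fun μ _ => ?_
    rw [integral_finsetSum _ fun ν _ => (hi α β μ).const_mul _]
    exact Finset.sum_congr rfl fun ν _ => integral_const_mul _ _
  have hrhs : ∀ α μ, ∫ x, pd α (pd μ h) x * ⟪C.slot α μ c, q.1 x⟫ =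
      ∑ β, ∑ ν, C α β μ ν * c ν * ∫ x, pd α (pd μ h) x * q.1 x β := by
    intro α μ
    have hi : ∀ β, Integrable fun x => pd α (pd μ h) x * q.1 x β := fun β =>
      (hppd α μ).integrable_mul (hq1 β)
    have h1 : ∀ x, pd α (pd μ h) x * ⟪C.slot α μ c, q.1 x⟫ =
        ∑ β, (∑ ν, C α β μ ν * c ν) * (pd α (pd μ h) x * q.1 x β) := by
      intro x
      rw [PiLp.inner_apply, Finset.mul_sum]
      refine Finset.sum_congr rfl fun β _ => ?_
      rw [C.slot_apply]
      simp only [RCLike.inner_apply, conj_trivial]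
      ring
    simp only [h1]
    rw [integral_finsetSum _ fun β _ => (hi β).const_mul _]
    refine Finset.sum_congr rfl fun β _ => ?_
    rw [integral_const_mul, Finset.sum_mul]
  rw [hlhs]
  simp only [hrhs, hparts, mul_neg, Finset.sum_neg_distrib]
  congr 1
  refine Finset.sum_congr rfl fun α _ => ?_
  rw [Finset.sum_comm]

end TestField

/-! ## The symbol of the two-scale operator -/

section Symbol

variable {d : ℕ} {𝒪 : ConfigFamily d} {P : Measure (Config 𝒪)} [IsProbabilityMeasure P]
  {C₀ C₁ : Tensor d}

/-- The random vector that equals `a` outside the inclusions and zero inside. -/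
noncomputable def outConst (P : Measure (Config 𝒪)) [IsProbabilityMeasure P] :
    E d →ₗ[ℝ] Lp (E d) 2 P :=
  ((ContinuousLinearMap.id ℝ _ - (L2zero P).subtypeL ∘L inPart P) ∘L
    Lp.constL 2 P ℝ : E d →L[ℝ] Lp (E d) 2 P)

theorem outConst_apply (a : E d) :
    outConst P a = Lp.constL 2 P ℝ a - (inPart P (Lp.constL 2 P ℝ a) : Lp (E d) 2 P) := rfl

theorem inner_outConst (a : E d) {v : Lp (E d) 2 P} (hv : v ∈ L2zero P) :
    ⟪outConst P a, v⟫ = 0 := by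
  rw [outConst_apply, inner_sub_left, inner_inPart _ hv, sub_self]

theorem inner_outConst_constL (a b : E d) :
    ⟪outConst P a, Lp.constL 2 P ℝ b⟫ = outProb P * ⟪a, b⟫ := by
  have h1 : ⟪Lp.constL 2 P ℝ b, Lp.constL 2 P ℝ a⟫ = ⟪b, a⟫ := by
    rw [inner_constL, integral_congr_ae (coeFn_constL (P := P) a)]; simp
  rw [outConst_apply, real_inner_comm, inner_sub_right, inner_constL_inPart, h1,
    real_inner_comm b a]
  ring

theorem tprod_constL_mem (g : Lp ℝ 2 (volume : Measure (E d))) (a : E d) :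
    tprod g (Lp.constL 2 P ℝ a) ∈ twoScaleSpace P := by
  have hm : MemLp (fun x => g x • a) 2 (volume : Measure (E d)) :=
    ((ContinuousLinearMap.id ℝ ℝ).smulRight a).comp_memLp' (Lp.memLp g)
  have h1 : tprod g (Lp.constL 2 P ℝ a) = embed P (hm.toLp _) := by
    refine slice_ext ?_
    filter_upwards [slice_tprod g (Lp.constL 2 P ℝ a), slice_embed (P := P) (hm.toLp _),
      hm.coeFn_toLp] with x h1 h2 h3
    rw [h1, h2, h3, map_smul]
  rw [h1]
  exact Submodule.mem_sup_left ⟨_, rfl⟩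

theorem tprod_mem_L2prodZero (g : Lp ℝ 2 (volume : Measure (E d))) {v : Lp (E d) 2 P}
    (hv : v ∈ L2zero P) : tprod g v ∈ L2prodZero P := by
  rw [mem_L2prodZero_iff]
  filter_upwards [slice_tprod g v] with x hx
  rw [hx]
  exact (L2zero P).smul_mem _ hv

theorem tprod_mem_twoScaleSpace (g : Lp ℝ 2 (volume : Measure (E d))) {v : Lp (E d) 2 P}
    (hv : v ∈ L2zero P) : tprod g v ∈ twoScaleSpace P :=
  Submodule.mem_sup_right (tprod_mem_L2prodZero g hv)

theorem tprod_outConst_mem (g : Lp ℝ 2 (volume : Measure (E d))) (a : E d) :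
    tprod g (outConst P a) ∈ twoScaleSpace P := by
  rw [outConst_apply, ← tprodₗ_apply, map_sub]
  exact (twoScaleSpace P).sub_mem (tprod_constL_mem g a)
    (tprod_mem_twoScaleSpace g (inPart P (Lp.constL 2 P ℝ a)).2)

theorem inner_tprod_embed (g : Lp ℝ 2 (volume : Measure (E d))) (v : Lp (E d) 2 P)
    (u : Lp (E d) 2 (volume : Measure (E d))) :
    ⟪tprod g v, embed P u⟫ = ∫ x, g x * ⟪v, Lp.constL 2 P ℝ (u x)⟫ := by
  rw [inner_tprod]
  refine integral_congr_ae ?_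
  filter_upwards [slice_embed (P := P) u] with x hx
  rw [hx]

theorem inner_tprod_outConst (g : Lp ℝ 2 (volume : Measure (E d))) (a : E d)
    {f : Lp (E d) 2 ((volume : Measure (E d)).prod P)} (hf : f ∈ L2prodZero P) :
    ⟪tprod g (outConst P a), f⟫ = 0 := by
  rw [inner_tprod]
  refine integral_eq_zero_of_ae ?_
  filter_upwards [mem_L2prodZero_iff.1 hf] with x hx
  rw [inner_outConst a hx, mul_zero]
  rfl

theorem mk_mem_Ahom {u w : Lp (E d) 2 ((volume : Measure (E d)).prod P)} (hu : u ∈ twoScaleSpace P)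
    (hw : w ∈ twoScaleSpace P) {u₁ g₁ u₀ g₀} (hu₁ : (u₁, g₁) ∈ H1 d) (hu₀ : (u₀, g₀) ∈ L2H1zero P)
    (huu : u = embed P u₁ + u₀)
    (hweak : ∀ q₁ ∈ H1 d, ∀ q₀ ∈ L2H1zero P,
      gradForm (Chom P C₁) volume g₁ q₁.2 + gradForm C₀ (volume.prod P) g₀ q₀.2 =
        ⟪w, embed P q₁.1 + q₀.1⟫) :
    ((⟨u, hu⟩, ⟨w, hw⟩) : twoScaleSpace P × twoScaleSpace P) ∈ Ahom P C₀ C₁ :=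
  mem_Ahom_iff.2 ⟨u₁, g₁, u₀, g₀, hu₁, hu₀, huu, hweak⟩

theorem inner_tprod_slot (hp : 0 < outProb P) {γ : Lp ℝ 2 (volume : Measure (E d))} {ψ : E d → ℝ}
    (hγ : γ =ᵐ[volume] ψ) (a : E d) (u : Lp (E d) 2 (volume : Measure (E d))) :
    ⟪tprod γ (outConst P ((outProb P)⁻¹ • a)), embed P u⟫ = ∫ x, ψ x * ⟪a, u x⟫ := by
  rw [inner_tprod_embed]
  refine integral_congr_ae ?_
  filter_upwards [hγ] with x hx
  rw [hx, inner_outConst_constL, real_inner_smul_left, mul_inv_cancel_left₀ hp.ne']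

/-- Macroscopic test fields see only the mean of `z`, which can equally be carried by a constant on
the complement of the inclusions, divided by its probability. -/
theorem inner_tprod_mean (hp : 0 < outProb P) (g : Lp ℝ 2 (volume : Measure (E d)))
    (z : Lp (E d) 2 P) (u : Lp (E d) 2 (volume : Measure (E d))) :
    ⟪tprod g (outConst P ((outProb P)⁻¹ • ∫ ω, z ω ∂P)), embed P u⟫ = ⟪tprod g z, embed P u⟫ := by
  rw [inner_tprod_embed, inner_tprod_embed]
  refine integral_congr_ae (Eventually.of_forall fun x => ?_)
  have h1 : ⟪z, Lp.constL 2 P ℝ (u x)⟫ = ⟪∫ ω, z ω ∂P, u x⟫ := by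
    rw [real_inner_comm, inner_constL, real_inner_comm]
  have h2 := inner_outConst_constL (P := P) ((outProb P)⁻¹ • ∫ ω, z ω ∂P) (u x)
  rw [real_inner_smul_left, mul_inv_cancel_left₀ hp.ne'] at h2
  exact congrArg (g x * ·) (h2.trans h1.symm)

theorem gradForm_tprod_eq (h : IsFlow (T (𝒪 := 𝒪)) P) (hC₀ : C₀.IsElastic)
    (g : Lp ℝ 2 (volume : Measure (E d))) {G : Lp (M d) 2 P} {z : Lp (E d) 2 P}
    (hG : ∀ q ∈ H1zero P, gradForm C₀ P G q.2 = ⟪z, q.1⟫)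
    {q : Lp (E d) 2 ((volume : Measure (E d)).prod P) ×
      Lp (M d) 2 ((volume : Measure (E d)).prod P)} (hq : q ∈ L2H1zero P) :
    gradForm C₀ (volume.prod P) (tprod g G) q.2 = ⟪tprod g z, q.1⟫ := by
  rw [gradForm_comm hC₀.contract_comm, gradForm_tprod, inner_tprod]
  refine integral_congr_ae ?_
  filter_upwards [(mem_L2H1zero_iff h).1 hq] with x hx
  have h1 := hG _ hx
  rw [gradForm_comm hC₀.contract_comm] at h1
  exact congrArg (g x * ·) h1

/-- The element of `A^hom` built from a test function and an element of `A₀`. -/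
theorem exists_mem_Ahom (h : IsFlow (T (𝒪 := 𝒪)) P) (hC₀ : C₀.IsElastic) (hp : 0 < outProb P)
    {φ : E d → ℝ} (hφ : ContDiff ℝ (⊤ : ℕ∞) φ) (hφc : HasCompactSupport φ) (c : E d)
    {q : L2zero P × L2zero P} (hq : q ∈ A0 P C₀) {g : Lp ℝ 2 (volume : Measure (E d))}
    (hg : g =ᵐ[volume] φ) {γ : Fin d → Fin d → Lp ℝ 2 (volume : Measure (E d))}
    (hγ : ∀ α μ, γ α μ =ᵐ[volume] pd α (pd μ φ)) :
    ∃ p ∈ Ahom P C₀ C₁, p.1.1 = tprod g (Lp.constL 2 P ℝ c + q.1.1) ∧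
      p.2.1 = tprod g q.2.1 - tprod g (outConst P ((outProb P)⁻¹ • ∫ ω, q.2.1 ω ∂P)) -
          ∑ α, ∑ μ, tprod (γ α μ) (outConst P ((outProb P)⁻¹ • (Chom P C₁).slot α μ c)) := by
  obtain ⟨G, hG, hqG⟩ := mem_A0_iff.1 hq
  obtain ⟨p₁, hp₁, hp₁', hp₁''⟩ := exists_mem_H1_smul (Chom P C₁) hφ hφc c
  -- The image under `A^hom` must act as `g ⊗ A₀v` on microscopic tests and as `-C^hom ∂∂φ` on
  -- macroscopic ones. Fields of the form `outConst` are orthogonal to microscopic tests, so they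
  -- can be used to cancel the mean of `A₀v` and to carry the second derivatives.
  have hw : tprod g q.2.1 - tprod g (outConst P ((outProb P)⁻¹ • ∫ ω, q.2.1 ω ∂P)) -
      ∑ α, ∑ μ, tprod (γ α μ) (outConst P ((outProb P)⁻¹ • (Chom P C₁).slot α μ c)) ∈
      twoScaleSpace P :=
    (twoScaleSpace P).sub_mem ((twoScaleSpace P).sub_mem (tprod_mem_twoScaleSpace g q.2.2)
      (tprod_outConst_mem g _)) ((twoScaleSpace P).sum_mem fun α _ =>
        (twoScaleSpace P).sum_mem fun μ _ => tprod_outConst_mem _ _)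
  have hu : tprod g (Lp.constL 2 P ℝ c + q.1.1) ∈ twoScaleSpace P := by
    rw [tprod_add]
    exact (twoScaleSpace P).add_mem (tprod_constL_mem g c) (tprod_mem_twoScaleSpace g q.1.2)
  have hemb : embed P p₁.1 = tprod g (Lp.constL 2 P ℝ c) := by
    refine slice_ext ?_
    filter_upwards [slice_tprod g (Lp.constL 2 P ℝ c), slice_embed (P := P) p₁.1, hp₁',
      hg] with x h1 h2 h3 h4
    rw [h1, h2, h3, map_smul, h4]
  refine ⟨_, mk_mem_Ahom hu hw hp₁ (tprod_mem_L2H1zero h g hG)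
    (by rw [hemb, tprod_add]) fun q₁ hq₁ q₀ hq₀ => ?_, rfl, rfl⟩
  have e6 : ∀ f : Lp (E d) 2 ((volume : Measure (E d)).prod P),
      ⟪∑ α, ∑ μ, tprod (γ α μ) (outConst P ((outProb P)⁻¹ • (Chom P C₁).slot α μ c)), f⟫ =
      ∑ α, ∑ μ, ⟪tprod (γ α μ) (outConst P ((outProb P)⁻¹ • (Chom P C₁).slot α μ c)), f⟫ :=
    fun f => by
      rw [sum_inner]
      exact Finset.sum_congr rfl fun α _ => sum_inner _ _ _
  have e7 : ⟪∑ α, ∑ μ, tprod (γ α μ) (outConst P ((outProb P)⁻¹ • (Chom P C₁).slot α μ c)),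
      embed P q₁.1⟫ = ∑ α, ∑ μ, ∫ x, pd α (pd μ φ) x * ⟪(Chom P C₁).slot α μ c, q₁.1 x⟫ :=
    (e6 _).trans (Finset.sum_congr rfl fun α _ => Finset.sum_congr rfl fun μ _ =>
      inner_tprod_slot hp (hγ α μ) _ _)
  have e8 : ⟪∑ α, ∑ μ, tprod (γ α μ) (outConst P ((outProb P)⁻¹ • (Chom P C₁).slot α μ c)),
      q₀.1⟫ = 0 :=
    (e6 _).trans (Finset.sum_eq_zero fun α _ => Finset.sum_eq_zero fun μ _ =>
      inner_tprod_outConst _ _ hq₀.1)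
  rw [hp₁'' q₁ hq₁, gradForm_tprod_eq h hC₀ g hqG hq₀, inner_add_right, inner_sub_left,
    inner_sub_left, inner_sub_left, inner_sub_left, inner_tprod_mean hp, e7, e8,
    inner_tprod_outConst g _ hq₀.1]
  ring

/-- A lower bound for `A^hom - l` passes to its symbol. -/
theorem norm_symbol_le (h : IsFlow (T (𝒪 := 𝒪)) P) (hC₀ : C₀.IsElastic) (hp : 0 < outProb P)
    {l C : ℝ} (hC0 : 0 ≤ C) (hC : ∀ p ∈ Ahom P C₀ C₁, ‖p.1‖ ≤ C * ‖p.2 - l • p.1‖) (k c : E d)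
    {q : L2zero P × L2zero P} (hq : q ∈ A0 P C₀) :
    ‖Lp.constL 2 P ℝ c + q.1.1‖ ≤
      C * ‖q.2.1 - l • (Lp.constL 2 P ℝ c + q.1.1) +
        outConst P ((outProb P)⁻¹ • ((Chom P C₁).acoustic k c - ∫ ω, q.2.1 ω ∂P))‖ := by
  obtain ⟨X, hX⟩ : ∃ X, X = q.2.1 - l • (Lp.constL 2 P ℝ c + q.1.1) +
        outConst P ((outProb P)⁻¹ • ((Chom P C₁).acoustic k c - ∫ ω, q.2.1 ω ∂P)) := ⟨_, rfl⟩
  rw [← hX]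
  obtain ⟨b, hb⟩ : ∃ b : Fin d → Fin d → E d,
      ∀ α μ, b α μ = (outProb P)⁻¹ • (Chom P C₁).slot α μ c := ⟨_, fun _ _ => rfl⟩
  obtain ⟨S, hS⟩ : ∃ S : ℝ, S = ∑ α, ∑ μ, ‖outConst P (b α μ)‖ := ⟨_, rfl⟩
  have hS0 : 0 ≤ S := hS ▸ Finset.sum_nonneg fun _ _ => Finset.sum_nonneg fun _ _ => norm_nonneg _
  refine le_of_forall_pos_le_add fun ε hε => ?_
  obtain ⟨δ, hδ, hδε⟩ : ∃ δ : ℝ, 0 < δ ∧ C * (δ * S) ≤ ε := by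
    refine ⟨ε / (C * S + 1), by positivity, ?_⟩
    have : C * (ε / (C * S + 1) * S) = ε * (C * S / (C * S + 1)) := by ring
    rw [this]
    refine mul_le_of_le_one_right hε.le ?_
    rw [div_le_one (by positivity)]
    linarith
  -- The tolerance is `δ²` because the quasimode estimate is for squared norms.
  obtain ⟨φ, hφ, hφc, hφ0, hφr⟩ := exists_quasimode k (pow_pos hδ 2)
  obtain ⟨g, hg⟩ : ∃ g, g = toL2 hφ.continuous hφc := ⟨_, rfl⟩
  obtain ⟨γ, hγ⟩ : ∃ γ : Fin d → Fin d → Lp ℝ 2 (volume : Measure (E d)), ∀ α μ, γ α μ =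
      toL2 (contDiff_pd (contDiff_pd hφ μ) α).continuous
        (hasCompactSupport_pd (hasCompactSupport_pd hφc μ) α) := ⟨_, fun _ _ => rfl⟩
  have hg' : g =ᵐ[volume] φ := hg ▸ coeFn_toL2 _ _
  have hγ' : ∀ α μ, γ α μ =ᵐ[volume] pd α (pd μ φ) := fun α μ => hγ α μ ▸ coeFn_toL2 _ _
  obtain ⟨p, hpA, hp1, hp2⟩ := exists_mem_Ahom (C₁ := C₁) h hC₀ hp hφ hφc c hq hg' hγ'
  simp only [← hb] at hp2
  have hgn : ‖g‖ ^ 2 = ∫ x, φ x ^ 2 := by rw [hg, norm_sq_toL2]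
  have hg0 : 0 < ‖g‖ := by
    rw [← hgn] at hφ0
    exact (sq_pos_iff.1 hφ0).lt_of_le' (norm_nonneg _)
  have hρ : ∀ α μ, ‖γ α μ + (k α * k μ) • g‖ ≤ δ * ‖g‖ := by
    intro α μ
    refine le_of_sq_le_sq ?_ (by positivity)
    rw [mul_pow, hgn]
    refine le_trans (le_of_eq ?_) (hφr α μ)
    rw [norm_toLp_sq]
    refine integral_congr_ae ?_
    filter_upwards [Lp.coeFn_add (γ α μ) ((k α * k μ) • g), Lp.coeFn_smul (k α * k μ) g,
      hg', hγ' α μ] with x h1 h2 h3 h4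
    rw [h1, Pi.add_apply, h2, Pi.smul_apply, h3, h4, Real.norm_eq_abs, sq_abs, smul_eq_mul]
  -- With `-∂_α∂_μφ` replaced by `k_αk_μφ`, the element `(A^hom - l)u` becomes `φ ⊗ X`, where `X` is
  -- the symbol applied to `c + v`; the remainder is at most `δ‖φ‖S`. Dividing by `‖φ‖` leaves the
  -- bound on `L²(Ω)`.
  have hw : p.2.1 -
      l • p.1.1 = tprod g X -
        ∑ α, ∑ μ, tprod (γ α μ + (k α * k μ) • g) (outConst P (b α μ)) := by
    have h1 : ∑ α, ∑ μ, tprod (γ α μ + (k α * k μ) • g) (outConst P (b α μ)) =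
        (∑ α, ∑ μ, tprod (γ α μ) (outConst P (b α μ))) +
          tprodₗ g (outConst P ((outProb P)⁻¹ • (Chom P C₁).acoustic k c)) := by
      rw [Tensor.acoustic_apply, Finset.smul_sum, map_sum, map_sum, ← Finset.sum_add_distrib]
      refine Finset.sum_congr rfl fun α _ => ?_
      rw [Finset.smul_sum, map_sum, map_sum, ← Finset.sum_add_distrib]
      refine Finset.sum_congr rfl fun μ _ => ?_
      rw [add_tprod, smul_tprod, smul_comm, ← hb, map_smul, map_smul, tprodₗ_apply]
    rw [hp1, hp2, h1, hX, smul_sub, map_sub]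
    simp only [← tprodₗ_apply, map_add, map_sub, map_smul]
    abel
  have h1 : ‖p.1‖ = ‖g‖ * ‖Lp.constL 2 P ℝ c + q.1.1‖ := by
    rw [Submodule.coe_norm, hp1, norm_tprod]
  have h2 : ‖p.2 - l • p.1‖ ≤ ‖g‖ * ‖X‖ + δ * ‖g‖ * S := by
    rw [Submodule.coe_norm, Submodule.coe_sub, Submodule.coe_smul, hw]
    refine (norm_sub_le _ _).trans (add_le_add (norm_tprod g X).le ?_)
    rw [hS, Finset.mul_sum]
    refine (norm_sum_le _ _).trans (Finset.sum_le_sum fun α _ => ?_)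
    rw [Finset.mul_sum]
    refine (norm_sum_le _ _).trans (Finset.sum_le_sum fun μ _ => ?_)
    rw [norm_tprod]
    exact mul_le_mul_of_nonneg_right (hρ α μ) (norm_nonneg _)
  have h3 := (hC p hpA).trans (mul_le_mul_of_nonneg_left h2 hC0)
  rw [h1] at h3
  have h4 : ‖g‖ * ‖Lp.constL 2 P ℝ c + q.1.1‖ ≤ ‖g‖ * (C * ‖X‖ + C * (δ * S)) :=
    h3.trans (le_of_eq (by ring))
  have h5 := le_of_mul_le_mul_left h4 hg0
  linarith

end Symbol

/-! ## Symmetric pencils in finite dimensions -/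

section Pencil

variable {V : Type*} [NormedAddCommGroup V] [InnerProductSpace ℝ V] {A B : V →L[ℝ] V}

/-- A vector on which a nonnegative symmetric form vanishes belongs to its kernel. -/
theorem eq_zero_of_inner_eq_zero (hA : ∀ x y, ⟪A x, y⟫ = ⟪x, A y⟫) (h0 : ∀ x, 0 ≤ ⟪A x, x⟫)
    {y : V} (hy : ⟪A y, y⟫ = 0) : A y = 0 := by
  have h1 : ∀ t : ℝ, 0 ≤ ⟪A (A y), A y⟫ * (t * t) + 2 * ‖A y‖ ^ 2 * t + 0 := by
    intro t
    have h2 := h0 (y + t • A y)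
    have h3 : ⟪A (A y), y⟫ = ‖A y‖ ^ 2 := by rw [hA, real_inner_self_eq_norm_sq]
    rw [map_add, map_smul, inner_add_left, inner_add_right, inner_add_right, real_inner_smul_left,
      real_inner_smul_left, real_inner_smul_right, real_inner_smul_right, hy, h3,
      real_inner_self_eq_norm_sq] at h2
    linarith
  have h2 := discrim_le_zero h1
  rw [discrim] at h2
  have h3 : ‖A y‖ ^ 2 = 0 := by nlinarith [sq_nonneg (‖A y‖ ^ 2)]
  simpa using h3

/-- Maximise the quotient `⟪Bx, x⟫ / ⟪Ax, x⟫` on the compact sphere. With `s` the maximum, `sA - B`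
is nonnegative and its form vanishes at the maximiser, which therefore lies in the kernel. -/
theorem exists_maximal_pencil [FiniteDimensional ℝ V] [Nontrivial V]
    (hA : ∀ x y, ⟪A x, y⟫ = ⟪x, A y⟫) (hB : ∀ x y, ⟪B x, y⟫ = ⟪x, B y⟫) {a : ℝ} (ha : 0 < a)
    (hAa : ∀ x, a * ‖x‖ ^ 2 ≤ ⟪A x, x⟫) :
    ∃ s : ℝ, ∃ y : V, ‖y‖ = 1 ∧ B y = s • A y ∧ ∀ x, ⟪B x, x⟫ ≤ s * ⟪A x, x⟫ := by
  have hpos : ∀ x ≠ 0, 0 < ⟪A x, x⟫ := fun x hx =>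
    lt_of_lt_of_le (mul_pos ha (pow_pos (norm_pos_iff.2 hx) 2)) (hAa x)
  have hne : ∀ x ∈ Metric.sphere (0 : V) 1, x ≠ 0 := by
    rintro x hx rfl
    simp at hx
  have hcont : ContinuousOn (fun x => ⟪B x, x⟫ / ⟪A x, x⟫) (Metric.sphere (0 : V) 1) :=
    (B.continuous.inner continuous_id).continuousOn.div (A.continuous.inner continuous_id).continuousOn
      fun x hx => (hpos x (hne x hx)).ne'
  obtain ⟨y, hy, hmax⟩ := (isCompact_sphere (0 : V) 1).exists_isMaxOn
    (NormedSpace.sphere_nonempty.2 zero_le_one) hcont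
  obtain ⟨s, hs⟩ : ∃ s : ℝ, s = ⟪B y, y⟫ / ⟪A y, y⟫ := ⟨_, rfl⟩
  have hle : ∀ x, ⟪B x, x⟫ ≤ s * ⟪A x, x⟫ := by
    intro x
    by_cases hx : x = 0
    · simp [hx]
    · have hn : ‖x‖ ≠ 0 := norm_ne_zero_iff.2 hx
      have h1 : ‖x‖⁻¹ • x ∈ Metric.sphere (0 : V) 1 := by simp [norm_smul, hn]
      have h2 : ⟪B (‖x‖⁻¹ • x), ‖x‖⁻¹ • x⟫ / ⟪A (‖x‖⁻¹ • x), ‖x‖⁻¹ • x⟫ ≤ s := hs ▸ hmax h1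
      rw [map_smul, map_smul, real_inner_smul_left, real_inner_smul_right, real_inner_smul_left,
        real_inner_smul_right, mul_div_mul_left _ _ (inv_ne_zero hn),
        mul_div_mul_left _ _ (inv_ne_zero hn), div_le_iff₀ (hpos x hx)] at h2
      exact h2
  refine ⟨s, y, by simpa using hy, ?_, hle⟩
  have h1 : (s • A - B) y = 0 := by
    refine eq_zero_of_inner_eq_zero (fun x z => ?_) (fun x => ?_) ?_
    · simp only [FunLike.coe_sub, FunLike.coe_smul, Pi.sub_apply, Pi.smul_apply, inner_sub_left,
        inner_sub_right, real_inner_smul_left, real_inner_smul_right, hA, hB]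
    · simp only [FunLike.coe_sub, FunLike.coe_smul, Pi.sub_apply, Pi.smul_apply, inner_sub_left,
        real_inner_smul_left]
      linarith [hle x]
    · simp only [FunLike.coe_sub, FunLike.coe_smul, Pi.sub_apply, Pi.smul_apply, inner_sub_left,
        real_inner_smul_left, hs]
      rw [div_mul_cancel₀ _ (hpos y (hne y hy)).ne', sub_self]
  exact (sub_eq_zero.1 h1).symm

/-- For large `t` the operator `t²A - r` has coercivity constant at least `1 + ‖m‖ / ε`, hence is
invertible with solution of norm at most `ε`. This is the high frequency limit, in which the
macroscopic field drops out. -/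
theorem exists_small_solution [FiniteDimensional ℝ V] {a : ℝ} (ha : 0 < a)
    (hAa : ∀ x, a * ‖x‖ ^ 2 ≤ ⟪A x, x⟫) (r : ℝ) (m : V) {ε : ℝ} (hε : 0 < ε) :
    ∃ t : ℝ, ∃ c : V, t ^ 2 • A c - r • c = m ∧ ‖c‖ ≤ ε := by
  have h0 : 0 ≤ (|r| + 1 + ‖m‖ / ε) / a := by positivity
  refine ⟨√((|r| + 1 + ‖m‖ / ε) / a), ?_⟩
  rw [Real.sq_sqrt h0]
  obtain ⟨s, hs⟩ : ∃ s, s = (|r| + 1 + ‖m‖ / ε) / a := ⟨_, rfl⟩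
  rw [← hs] at h0 ⊢
  have hsa : s * a = |r| + 1 + ‖m‖ / ε := by rw [hs, div_mul_cancel₀ _ ha.ne']
  have hcoer : ∀ x, (1 + ‖m‖ / ε) * ‖x‖ ^ 2 ≤ ⟪s • A x - r • x, x⟫ := by
    intro x
    rw [inner_sub_left, real_inner_smul_left, real_inner_smul_left, real_inner_self_eq_norm_sq]
    have h1 := mul_le_mul_of_nonneg_left (hAa x) h0
    have h2 : r * ‖x‖ ^ 2 ≤ |r| * ‖x‖ ^ 2 := mul_le_mul_of_nonneg_right (le_abs_self r) (sq_nonneg _)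
    have h3 : s * (a * ‖x‖ ^ 2) = (|r| + 1 + ‖m‖ / ε) * ‖x‖ ^ 2 := by rw [← mul_assoc, hsa]
    linarith
  have hinj : Function.Injective (s • A - r • ContinuousLinearMap.id ℝ V : V →L[ℝ] V).toLinearMap := by
    refine (injective_iff_map_eq_zero _).2 fun x hx => ?_
    have h1 : s • A x - r • x = 0 := hx
    have h2 := hcoer x
    rw [h1, inner_zero_left] at h2
    have h3 : 0 ≤ ‖m‖ / ε := by positivity
    have h4 : ‖x‖ ^ 2 ≤ 0 := by nlinarith [sq_nonneg ‖x‖]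
    simpa using le_antisymm h4 (sq_nonneg _)
  obtain ⟨c, hc⟩ := LinearMap.surjective_of_injective hinj m
  have hc' : s • A c - r • c = m := hc
  refine ⟨c, hc', ?_⟩
  have h1 := hcoer c
  rw [hc'] at h1
  have h2 := h1.trans (real_inner_le_norm m c)
  rcases (norm_nonneg c).eq_or_lt with h | h
  · rw [← h]; exact hε.le
  · have h3 : (1 + ‖m‖ / ε) * ‖c‖ ≤ ‖m‖ := by
      refine le_of_mul_le_mul_right ?_ h
      linarith
    by_contra! hcon
    have h4 : ‖m‖ ≤ ‖m‖ / ε * ‖c‖ := by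
      rw [div_mul_eq_mul_div, le_div_iff₀ hε]
      exact mul_le_mul_of_nonneg_left hcon.le (norm_nonneg m)
    linarith

end Pencil

/-! ## The largest eigenvalue of a symmetric matrix -/

section LargestEigenvalue

variable {d : ℕ} {W : Matrix (Fin d) (Fin d) ℝ}

theorem exists_clm_matrix (W : Matrix (Fin d) (Fin d) ℝ) : ∃ B : E d →L[ℝ] E d,
    (∀ a c, ⟪B c, a⟫ = ∑ i, ∑ j, a i * W i j * c j) ∧
      ∀ c i, B c i = Matrix.toLin' W (WithLp.ofLp c) i := by
  refine ⟨LinearMap.toContinuousLinearMap (Matrix.toEuclideanLin W), fun a c => ?_, fun c i => rfl⟩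
  rw [PiLp.inner_apply]
  refine Finset.sum_congr rfl fun i _ => ?_
  simp [Matrix.toLpLin_apply, Matrix.mulVec, dotProduct, Finset.mul_sum, mul_assoc, mul_comm,
    mul_left_comm]

/-- The maximum of the quadratic form of a symmetric matrix on the unit sphere is its largest
eigenvalue, and its sign decides whether the matrix is negative definite. -/
theorem isGreatest_eigenvalue [NeZero d] (hW : W.IsSymm) :
    ∃ S : ℝ, S = ⨆ k : Metric.sphere (0 : E d) 1, ∑ i, ∑ j, (k : E d) i * W i j * (k : E d) j ∧
      IsGreatest {m : ℝ | Module.End.HasEigenvalue (Matrix.toLin' W) m} S ∧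
      (0 ≤ S ↔ ¬ (-W).PosDef) ∧
      (∀ c : E d, ∑ i, ∑ j, c i * W i j * c j ≤ S * ‖c‖ ^ 2) ∧
      ∃ y : E d, y ≠ 0 ∧ ∑ i, ∑ j, y i * W i j * y j = S := by
  have : Nontrivial (E d) := inferInstance
  obtain ⟨B, hB, hB'⟩ := exists_clm_matrix W
  have hBs : ∀ x y, ⟪B x, y⟫ = ⟪x, B y⟫ := by
    intro x y
    rw [hB, real_inner_comm, hB, Finset.sum_comm]
    refine Finset.sum_congr rfl fun i _ => Finset.sum_congr rfl fun j _ => ?_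
    rw [hW.apply]; ring
  obtain ⟨S, y, hy1, hy2, hS⟩ := exists_maximal_pencil (A := ContinuousLinearMap.id ℝ (E d))
    (fun _ _ => rfl) hBs zero_lt_one (fun x => by
      rw [one_mul]; exact (real_inner_self_eq_norm_sq x).ge)
  have hy0 : y ≠ 0 := norm_ne_zero_iff.1 (by rw [hy1]; exact one_ne_zero)
  have hq : ∀ c : E d, ∑ i, ∑ j, c i * W i j * c j ≤ S * ‖c‖ ^ 2 := fun c => by
    rw [← hB, ← real_inner_self_eq_norm_sq]; exact hS c
  have hy3 : ∑ i, ∑ j, y i * W i j * y j = S := by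
    rw [← hB, hy2, real_inner_smul_left]
    change S * ⟪y, y⟫ = S
    rw [real_inner_self_eq_norm_sq, hy1, one_pow, mul_one]
  refine ⟨S, ?_, ⟨?_, ?_⟩, ⟨fun h0 hW' => ?_, fun h0 => ?_⟩, hq, y, hy0, hy3⟩
  · have hle : ∀ k : Metric.sphere (0 : E d) 1,
        ∑ i, ∑ j, (k : E d) i * W i j * (k : E d) j ≤ S := fun k => by
      have h1 := hq k
      rwa [norm_eq_of_mem_sphere, one_pow, mul_one] at h1
    have : Nonempty (Metric.sphere (0 : E d) 1) := ⟨⟨y, by simpa using hy1⟩⟩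
    refine le_antisymm ?_ (ciSup_le hle)
    have h1 := le_ciSup (f := fun k : Metric.sphere (0 : E d) 1 =>
      ∑ i, ∑ j, (k : E d) i * W i j * (k : E d) j) ⟨S, by rintro _ ⟨k, rfl⟩; exact hle k⟩
      ⟨y, by simpa using hy1⟩
    exact hy3.ge.trans h1
  · refine Module.End.hasEigenvalue_of_hasEigenvector (x := WithLp.ofLp y)
      (Module.End.hasEigenvector_iff.2 ⟨Module.End.mem_eigenspace_iff.2 ?_, ?_⟩)
    · ext i
      rw [← hB', hy2]
      rfl
    · intro h0
      exact hy0 (by ext i; exact congrFun h0 i)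
  · rintro m hm
    obtain ⟨x, hx⟩ := hm.exists_hasEigenvector
    have hx1 : ⟪B (WithLp.toLp 2 x), WithLp.toLp 2 x⟫ = m * ‖(WithLp.toLp 2 x : E d)‖ ^ 2 := by
      have h1 : B (WithLp.toLp 2 x) = m • WithLp.toLp 2 x := by
        ext i
        rw [hB']
        exact congrFun hx.apply_eq_smul i
      rw [h1, real_inner_smul_left, real_inner_self_eq_norm_sq]
    have hx0 : (WithLp.toLp 2 x : E d) ≠ 0 := by
      intro h0
      exact hx.2 (by simpa using h0)
    have h1 := hq (WithLp.toLp 2 x)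
    rw [← hB, hx1] at h1
    exact le_of_mul_le_mul_right h1 (pow_pos (norm_pos_iff.2 hx0) 2)
  · have h1 := hW'.dotProduct_mulVec_pos (x := WithLp.ofLp y) (by
      intro h0
      exact hy0 (by ext i; exact congrFun h0 i))
    have h2 : star (WithLp.ofLp y) ⬝ᵥ ((-W).mulVec (WithLp.ofLp y)) = -S := by
      rw [← hy3]
      simp [Matrix.mulVec, dotProduct, Finset.mul_sum, mul_assoc]
    linarith
  · by_contra! hS0
    refine h0 (Matrix.PosDef.of_dotProduct_mulVec_pos ?_ fun x hx => ?_)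
    · rw [Matrix.IsHermitian, Matrix.conjTranspose_eq_transpose_of_trivial, Matrix.transpose_neg,
        hW.eq]
    · have h2 : star x ⬝ᵥ ((-W).mulVec x) =
          -∑ i, ∑ j, (WithLp.toLp 2 x : E d) i * W i j * (WithLp.toLp 2 x : E d) j := by
        simp [Matrix.mulVec, dotProduct, Finset.mul_sum, mul_assoc]
      have hx0 : (WithLp.toLp 2 x : E d) ≠ 0 := by
        intro h0
        exact hx (by simpa using h0)
      rw [h2]
      nlinarith [hq (WithLp.toLp 2 x), pow_pos (norm_pos_iff.2 hx0) 2]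

end LargestEigenvalue

/-! ## The spectrum of the two-scale operator -/

section Spectrum

variable {d : ℕ} {𝒪 : ConfigFamily d} {P : Measure (Config 𝒪)} [IsProbabilityMeasure P]
  {C₀ C₁ : Tensor d} {l : ℝ}

theorem inner_integral (a : E d) (f : Lp (E d) 2 P) :
    ⟪∫ ω, f ω ∂P, a⟫ = ⟪Lp.constL 2 P ℝ a, f⟫ := by
  rw [inner_constL, real_inner_comm]

theorem Tensor.acoustic_smul (C : Tensor d) (t : ℝ) (k c : E d) :
    C.acoustic (t • k) c = t ^ 2 • C.acoustic k c := by
  rw [C.acoustic_apply, C.acoustic_apply, Finset.smul_sum]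
  refine Finset.sum_congr rfl fun α _ => ?_
  rw [Finset.smul_sum]
  refine Finset.sum_congr rfl fun μ _ => ?_
  rw [smul_smul, PiLp.smul_apply, PiLp.smul_apply, smul_eq_mul, smul_eq_mul]
  congr 1; ring

/-- In a unit direction the acoustic tensor of the homogenised medium is symmetric and
positive definite. -/
theorem exists_coercive_acoustic (hd : 2 ≤ d) (h𝒪 : 𝒪.IsAdmissible) (h : IsFlow (T (𝒪 := 𝒪)) P)
    (hC₁ : C₁.IsElastic) {k : E d} (hk : ‖k‖ = 1) :
    (∀ x y, ⟪(Chom P C₁).acoustic k x, y⟫ = ⟪x, (Chom P C₁).acoustic k y⟫) ∧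
      ∃ a, 0 < a ∧ ∀ x, a * ‖x‖ ^ 2 ≤ ⟪(Chom P C₁).acoustic k x, x⟫ := by
  refine ⟨fun x y => ?_, ?_⟩
  · rw [real_inner_comm _ x, inner_acoustic, inner_acoustic, (exists_contract_Chom_eq h hC₁).1]
  · obtain ⟨c, hc, hc'⟩ := exists_coercive_Chom hd h𝒪 h hC₁
    refine ⟨c / 2, by positivity, fun x => ?_⟩
    rw [inner_acoustic]
    refine le_trans ?_ (hc' (dyad k x))
    have h1 := mul_norm_sq_le_symPart_dyad k x
    rw [hk, one_pow, one_mul] at h1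
    have h2 := mul_le_mul_of_nonneg_left h1 hc.le
    linarith

/-- For `q = (v, A₀v)`, a wave of high frequency and small amplitude `c` compensates the mean of
`A₀v`. The symbol bound then says that `‖v‖ ≤ C‖A₀v - l v‖` up to errors that vanish with `c`. -/
theorem resolventSet_Ahom_subset (hd : 2 ≤ d) (h𝒪 : 𝒪.IsAdmissible) (h : IsFlow (T (𝒪 := 𝒪)) P)
    (hC₀ : C₀.IsElastic) (hC₁ : C₁.IsElastic) :
    resolventSet (Ahom P C₀ C₁) ⊆ resolventSet (A0 P C₀) := by
  intro l hl
  obtain ⟨C, hC0, hC⟩ := exists_bound_of_mem_resolventSet hl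
  have hp := outProb_pos h𝒪.isRegular h
  have : NeZero d := ⟨by omega⟩
  have hk : ‖(e 0 : E d)‖ = 1 := by simp
  obtain ⟨-, a, ha, hAa⟩ := exists_coercive_acoustic hd h𝒪 h hC₁ (P := P) hk
  refine (isPosSelfAdjoint_A0 h hC₀).mem_resolventSet_of_bound (C := C) fun q hq => ?_
  refine le_of_forall_pos_le_add fun ε hε => ?_
  obtain ⟨ε', hε', hεε⟩ : ∃ ε' : ℝ, 0 < ε' ∧ C * (|l| * ε') + ε' ≤ ε := by
    refine ⟨ε / (C * |l| + 1), by positivity, le_of_eq ?_⟩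
    field_simp
  -- The shift `l * outProb P` makes the constant on the complement equal to `l c`, so that it
  -- cancels the outer part of `-l c`.
  obtain ⟨t, c, hc, hcε⟩ := exists_small_solution ha hAa (l * outProb P) (∫ ω, q.2.1 ω ∂P) hε'
  have h1 := norm_symbol_le h hC₀ hp hC0 hC (t • e 0) c hq
  have h2 : (Chom P C₁).acoustic (t • e 0) c - ∫ ω, q.2.1 ω ∂P = (l * outProb P) • c := by
    rw [← hc, Tensor.acoustic_smul, sub_sub_cancel]
  have h3 : q.2.1 - l • (Lp.constL 2 P ℝ c + q.1.1) +
      outConst P ((outProb P)⁻¹ • ((Chom P C₁).acoustic (t • e 0) c - ∫ ω, q.2.1 ω ∂P)) =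
      (q.2.1 - l • q.1.1) - l • (inPart P (Lp.constL 2 P ℝ c) : Lp (E d) 2 P) := by
    rw [h2, smul_smul, mul_comm l, inv_mul_cancel_left₀ hp.ne', map_smul, outConst_apply, smul_sub,
      smul_add]
    abel
  rw [h3] at h1
  have h4 : ‖(inPart P (Lp.constL 2 P ℝ c) : Lp (E d) 2 P)‖ ≤ ε' :=
    (norm_inPart_le _).trans ((norm_constL c).le.trans hcε)
  have h5 : ‖q.1.1‖ ≤ ‖Lp.constL 2 P ℝ c + q.1.1‖ + ε' := by
    have : q.1.1 = (Lp.constL 2 P ℝ c + q.1.1) - Lp.constL 2 P ℝ c := by abel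
    calc ‖q.1.1‖ = ‖(Lp.constL 2 P ℝ c + q.1.1) - Lp.constL 2 P ℝ c‖ := by rw [← this]
      _ ≤ _ := (norm_sub_le _ _).trans (add_le_add le_rfl ((norm_constL c).le.trans hcε))
  have h6 : ‖(q.2.1 - l • q.1.1) - l • (inPart P (Lp.constL 2 P ℝ c) : Lp (E d) 2 P)‖ ≤
      ‖q.2.1 - l • q.1.1‖ + |l| * ε' := by
    refine (norm_sub_le _ _).trans (add_le_add le_rfl ?_)
    rw [norm_smul, Real.norm_eq_abs]
    exact mul_le_mul_of_nonneg_left h4 (abs_nonneg l)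
  have h7 := mul_le_mul_of_nonneg_left h6 hC0
  change ‖q.1.1‖ ≤ C * ‖q.2.1 - l • q.1.1‖ + ε
  linarith

/-- If the Zhikov matrix is not negative definite, then plane waves at a suitable frequency
belong to the spectrum. -/
theorem notMem_resolventSet_Ahom (hd : 2 ≤ d) (h𝒪 : 𝒪.IsAdmissible) (h : IsFlow (T (𝒪 := 𝒪)) P)
    (hC₀ : C₀.IsElastic) (hC₁ : C₁.IsElastic) {Z : Lp (E d) 2 P →L[ℝ] Lp (E d) 2 P}
    (hZ : IsExtendedResolvent P C₀ l Z) {x : E d} (hx : x ≠ 0)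
    (hβ : 0 ≤ l * ⟪x, x⟫ + l ^ 2 * ⟪Lp.constL 2 P ℝ x, Z (Lp.constL 2 P ℝ x)⟫) :
    l ∉ resolventSet (Ahom P C₀ C₁) := by
  intro hl
  obtain ⟨C, hC0, hC⟩ := exists_bound_of_mem_resolventSet hl
  have hp := outProb_pos h𝒪.isRegular h
  have : NeZero d := ⟨by omega⟩
  have hk : ‖(e 0 : E d)‖ = 1 := by simp
  obtain ⟨hAs, a, ha, hAa⟩ := exists_coercive_acoustic hd h𝒪 h hC₁ (P := P) hk
  obtain ⟨B, hB⟩ : ∃ B : E d →L[ℝ] E d, ∀ b c, ⟪b, B c⟫ = l * ⟪b, c⟫ +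
      l ^ 2 * ⟪Lp.constL 2 P ℝ b, Z (Lp.constL 2 P ℝ c)⟫ := by
    refine ⟨l • ContinuousLinearMap.id ℝ (E d) + l ^ 2 •
      (ContinuousLinearMap.adjoint (Lp.constL 2 P ℝ) ∘L Z ∘L Lp.constL 2 P ℝ), fun b c => ?_⟩
    have h1 := ContinuousLinearMap.adjoint_inner_right (Lp.constL 2 P ℝ) b (Z (Lp.constL 2 P ℝ c))
    rw [← h1, ← real_inner_smul_right, ← real_inner_smul_right, ← inner_add_right]
    rfl
  have hBs : ∀ b c, ⟪B b, c⟫ = ⟪b, B c⟫ := by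
    intro b c
    rw [real_inner_comm, hB, hB, real_inner_comm c b, ← hZ.symm (Lp.constL 2 P ℝ c),
      real_inner_comm (Lp.constL 2 P ℝ b)]
  -- `B` is the Zhikov matrix. Since `B c = s A(e₀) c` with `s ≥ 0`, the wave vector `√s e₀`
  -- satisfies `A(√s e₀) c = B c`, so a plane wave with amplitude `c` solves the macroscopic
  -- equation.
  obtain ⟨s, c, hc1, hBc, hmax⟩ := exists_maximal_pencil hAs hBs ha hAa
  have hs : 0 ≤ s := by
    have h1 := hmax x
    rw [real_inner_comm, hB] at h1
    have h2 : 0 < ⟪(Chom P C₁).acoustic (e 0) x, x⟫ :=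
      lt_of_lt_of_le (mul_pos ha (pow_pos (norm_pos_iff.2 hx) 2)) (hAa x)
    exact nonneg_of_mul_nonneg_left (hβ.trans h1) h2
  -- The microscopic profile responding to the macroscopic amplitude `c` is `l Z c`.
  have hZm := hZ.mem_A0 (l • Lp.constL 2 P ℝ c)
  have h1 := norm_symbol_le h hC₀ hp hC0 hC (√s • e 0) c hZm
  simp only [Submodule.coe_add, Submodule.coe_smul] at h1
  have hz : ∫ ω, ((inPart P (l • Lp.constL 2 P ℝ c) : Lp (E d) 2 P) +
      l • Z (l • Lp.constL 2 P ℝ c) : Lp (E d) 2 P) ω ∂P =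
      (Chom P C₁).acoustic (√s • e 0) c - (l * outProb P) • c := by
    refine ext_inner_right ℝ fun b => ?_
    rw [inner_integral, Tensor.acoustic_smul, Real.sq_sqrt hs, ← hBc, inner_sub_left,
      real_inner_comm b (B c), hB, real_inner_smul_left, inner_add_right, map_smul, map_smul,
      Submodule.coe_smul, real_inner_smul_right, inner_constL_inPart, real_inner_smul_right,
      real_inner_smul_right, real_inner_comm b c]
    ring
  rw [hz, sub_sub_cancel, smul_smul, mul_comm l (outProb P), inv_mul_cancel_left₀ hp.ne',
    (outConst P).map_smul, outConst_apply, map_smul, map_smul, Submodule.coe_smul] at h1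
  have hX : l • (inPart P (Lp.constL 2 P ℝ c) : Lp (E d) 2 P) + l • l • Z (Lp.constL 2 P ℝ c) -
      l • (Lp.constL 2 P ℝ c + l • Z (Lp.constL 2 P ℝ c)) +
      l • (Lp.constL 2 P ℝ c - (inPart P (Lp.constL 2 P ℝ c) : Lp (E d) 2 P)) = 0 := by
    module
  rw [hX, norm_zero, mul_zero] at h1
  have h2 : Lp.constL 2 P ℝ c + l • Z (Lp.constL 2 P ℝ c) = 0 :=
    norm_eq_zero.1 (le_antisymm h1 (norm_nonneg _))
  -- The symbol annihilates `c + l Z c`, but this vector is not zero: outside the inclusions it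
  -- equals `c`.
  have h3 : ⟪outConst P c, Lp.constL 2 P ℝ c + l • Z (Lp.constL 2 P ℝ c)⟫ = outProb P := by
    rw [inner_add_right, real_inner_smul_right, inner_outConst c (hZ.mem _), inner_outConst_constL,
      real_inner_self_eq_norm_sq, hc1]
    ring
  rw [h2, inner_zero_right] at h3
  exact hp.ne h3

theorem mem_resolventSet_Ahom_of_bound (hd : 2 ≤ d) (h𝒪 : 𝒪.IsAdmissible)
    (h : IsFlow (T (𝒪 := 𝒪)) P) (hC₀ : C₀.IsElastic) (hC₁ : C₁.IsElastic)
    (hl : ∃ C, ∀ p ∈ Ahom P C₀ C₁, ‖p.1‖ ≤ C * ‖p.2 - l • p.1‖) :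
    l ∈ resolventSet (Ahom P C₀ C₁) := by
  have : CompleteSpace (twoScaleSpace P) :=
    (isClosed_twoScaleSpace (outProb_pos h𝒪.isRegular h)).completeSpace_coe
  obtain ⟨C, hC⟩ := hl
  exact (isPosSelfAdjoint_Ahom hd h𝒪 h hC₀ hC₁).mem_resolventSet_of_bound hC

theorem mem_resolventSet_Ahom_of_neg (hd : 2 ≤ d) (h𝒪 : 𝒪.IsAdmissible)
    (h : IsFlow (T (𝒪 := 𝒪)) P) (hC₀ : C₀.IsElastic) (hC₁ : C₁.IsElastic) (hl : l < 0) :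
    l ∈ resolventSet (Ahom P C₀ C₁) := by
  have : CompleteSpace (twoScaleSpace P) :=
    (isClosed_twoScaleSpace (outProb_pos h𝒪.isRegular h)).completeSpace_coe
  exact (isPosSelfAdjoint_Ahom hd h𝒪 h hC₀ hC₁).mem_resolventSet_of_neg hl

theorem isClosed_spec_Ahom (hd : 2 ≤ d) (h𝒪 : 𝒪.IsAdmissible)
    (h : IsFlow (T (𝒪 := 𝒪)) P) (hC₀ : C₀.IsElastic) (hC₁ : C₁.IsElastic) :
    IsClosed (spec (Ahom P C₀ C₁)) := by
  have : CompleteSpace (twoScaleSpace P) :=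
    (isClosed_twoScaleSpace (outProb_pos h𝒪.isRegular h)).completeSpace_coe
  exact (isPosSelfAdjoint_Ahom hd h𝒪 h hC₀ hC₁).isClosed_spec

/-- Outside the spectrum of `A₀`, the spectrum of the two-scale operator is determined by the
sign of the largest eigenvalue of the Zhikov matrix. -/
theorem mem_spec_Ahom_iff (hd : 2 ≤ d) (h𝒪 : 𝒪.IsAdmissible) (h : IsFlow (T (𝒪 := 𝒪)) P)
    (hC₀ : C₀.IsElastic) (hC₁ : C₁.IsElastic) (hl : l ∈ zhikovDomain P C₀) :
    (l ∈ spec (Ahom P C₀ C₁) ↔ 0 ≤ zhikovMax P C₀ l) ∧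
      (0 ≤ zhikovMax P C₀ l ↔ ¬ (-(zhikov P C₀ l)).PosDef) ∧
      (∀ i, ∃! b, IsCellSolution P C₀ l i b) ∧ (zhikov P C₀ l).IsSymm ∧
      IsGreatest {m : ℝ | Module.End.HasEigenvalue (Matrix.toLin' (zhikov P C₀ l)) m}
        (zhikovMax P C₀ l) := by
  have : NeZero d := ⟨by omega⟩
  obtain ⟨Z, hZ⟩ := exists_isExtendedResolvent h hC₀ (not_not.1 hl.2)
  obtain ⟨S, hS, hgr, hpd, hle, y, hy0, hy⟩ := isGreatest_eigenvalue hZ.zhikov_isSymm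
  have hS' : S = zhikovMax P C₀ l := hS
  rw [← hS']
  refine ⟨⟨fun hl' => ?_, fun h0 => ?_⟩, hpd, hZ.existsUnique_cell, hZ.zhikov_isSymm, hgr⟩
  · by_contra! hneg
    refine hl' (mem_resolventSet_Ahom_of_bound hd h𝒪 h hC₀ hC₁ (hZ.exists_bound_Ahom h
      (fun ξ => ?_) (neg_pos.2 hneg) fun c => ?_))
    · obtain ⟨c, hc, hc'⟩ := exists_coercive_Chom hd h𝒪 h hC₁
      exact le_trans (by positivity) (hc' ξ)
    · rw [← hZ.sum_zhikov, neg_mul, neg_neg]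
      exact hle c
  · refine notMem_resolventSet_Ahom hd h𝒪 h hC₀ hC₁ hZ hy0 ?_
    rw [← hZ.sum_zhikov, hy]
    exact h0

end Spectrum

end HighContrast


theorem theorem4p7 (d : ℕ) (hd : 2 ≤ d) (𝒪 : ConfigFamily d) (h𝒪 : 𝒪.IsAdmissible)
    (P : Measure (Config 𝒪)) [IsProbabilityMeasure P] (hP : IsStationaryErgodic P)
    (C₀ C₁ : Tensor d) (hC₀ : C₀.IsElastic) (hC₁ : C₁.IsElastic) :
    -- the Zhikov matrix is well defined and symmetric, with `zhikovMax` as its largest eigenvalue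
    (∀ l ∈ zhikovDomain P C₀,
      (∀ i, ∃! b, IsCellSolution P C₀ l i b) ∧
      (zhikov P C₀ l).IsSymm ∧
      IsGreatest {m : ℝ | Module.End.HasEigenvalue (Matrix.toLin' (zhikov P C₀ l)) m}
        (zhikovMax P C₀ l)) ∧
    -- the spectrum of the two-scale limit operator
    spec (Ahom P C₀ C₁) =
      spec (A0 P C₀) ∪ closure {l ∈ zhikovDomain P C₀ | ¬ (-(zhikov P C₀ l)).PosDef} ∧
    spec (Ahom P C₀ C₁) =
      spec (A0 P C₀) ∪ {l ∈ zhikovDomain P C₀ | 0 ≤ zhikovMax P C₀ l} := by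
  have h := isFlow_T h𝒪.isRegular hP
  have key := fun {l : ℝ} (hl : l ∈ zhikovDomain P C₀) => mem_spec_Ahom_iff hd h𝒪 h hC₀ hC₁ hl
  have hsub : spec (A0 P C₀) ⊆ spec (Ahom P C₀ C₁) :=
    Set.compl_subset_compl.2 (resolventSet_Ahom_subset hd h𝒪 h hC₀ hC₁)
  have hset : {l ∈ zhikovDomain P C₀ | ¬ (-(zhikov P C₀ l)).PosDef} =
      {l ∈ zhikovDomain P C₀ | 0 ≤ zhikovMax P C₀ l} := by
    ext l
    exact and_congr_right fun hl => (key hl).2.1.symm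
  have hmem : {l ∈ zhikovDomain P C₀ | 0 ≤ zhikovMax P C₀ l} ⊆ spec (Ahom P C₀ C₁) :=
    fun l hl => (key hl.1).1.2 hl.2
  have hle : spec (Ahom P C₀ C₁) ⊆
      spec (A0 P C₀) ∪ {l ∈ zhikovDomain P C₀ | 0 ≤ zhikovMax P C₀ l} := by
    intro l hl
    by_cases hl0 : l ∈ spec (A0 P C₀)
    · exact Or.inl hl0
    · have hl1 : 0 ≤ l := by
        by_contra! hneg
        exact hl (mem_resolventSet_Ahom_of_neg hd h𝒪 h hC₀ hC₁ hneg)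
      exact Or.inr ⟨⟨hl1, hl0⟩, (key ⟨hl1, hl0⟩).1.1 hl⟩
  refine ⟨fun l hl => (key hl).2.2, ?_, hle.antisymm (Set.union_subset hsub hmem)⟩
  rw [hset]
  -- Taking the closure adds nothing, because the set already lies in the closed set `spec (Ahom P
  -- C₀ C₁)`.
  refine Set.Subset.antisymm (hle.trans (Set.union_subset_union_right _ subset_closure))
    (Set.union_subset hsub (closure_minimal hmem (isClosed_spec_Ahom hd h𝒪 h hC₀ hC₁)))
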